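/- Let $L\in\mathbb N$ and let $H=H^*$ be a bounded, translation invariant operator on $\ell^2(\mathbb Z^3,\mathbb C^L)$, i.e. $\langle n+l|H|m+l\rangle=\langle n|H|m\rangle$ for all $n,m,l\in\mathbb Z^3$. With the unitary Fourier transform $(\mathcal F\phi)(k)=(2\pi)^{-3/2}\sum_{n}e^{-\imath k\cdot n}\phi_n$, suppose that $\mathcal F H\mathcal F^*$ is multiplication by a real analytic function $k\in\mathbb T^3=\mathbb R^3/2\pi\mathbb Z^3\mapsto\mathcal E(k)=\mathcal E(k)^*\in\mathbb C^{L\times L}$ (the symbol of $H$). Let $\mathcal W\subset\mathbb T^3$ be the set of Weyl points, that is, of all $k$ such that $\mathcal E(k)$ has a degenerate eigenvalue. Assume: 1. $\mathcal W$ is discrete. 2. For $k^W\in\mathcal W$, every eigenvalue of $\mathcal E(k^W)$ has multiplicity at most two. 3. Away from band touchings all energy bands are Morse: whenever $f$ is a real-valued function that is real analytic near a point $k\in\mathbb T^3$, with $f(k')$ an eigenvalue of $\mathcal E(k')$ for all $k'$ near $k$ and with $f(k)$ a simple eigenvalue of $\mathcal E(k)$, then $\nabla f(k)=0$ implies that the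 Hessian of $f$ at $k$ is non-degenerate. (This includes the bands which are simple at some $k^W\in\mathcal W$ while two other bands touch there.) 4. All Weyl points are non-degenerate and weakly tilted (type I): let $k^W\in\mathcal W$ and let $\lambda$ be a double eigenvalue of $\mathcal E(k^W)$. For $k$ near $k^W$ let $P(k)$ be the rank two Riesz projection of $\mathcal E(k)$ for a small circle around $\lambda$ enclosing no other eigenvalue of $\mathcal E(k^W)$, let $\Phi(k)\in\mathbb C^{L\times 2}$ be a real analytic frame near $k^W$ with $\Phi(k)^*\Phi(k)=\mathbf 1_2$ and $\Phi(k)\Phi(k)^*=P(k)$, and write $\Phi(k)^*\mathcal E(k)\Phi(k)=e(k)\mathbf 1_2+\sum_{j=1}^3h_j(k)\sigma_j$ with the Pauli matrices $\sigma_j$, $e(k)\in\mathbb R$ and $h(k)\in\mathbb R^3$. Then $\det(Dh(k^W))\neq0$ and, with $h^{-1}$ the local inverse of $h$ at $k^W$, $|\nabla(e\circ h^{-1})(0)|<\kappa$ for some $\kappa<1$. (These conditions do not depend on the choice of the frame.) Let $X$ be the position operator, $\langle X\rangle=(\mathbf 1+X^2)^{1/2}$, and $\mathcal R^z_\alpha=\langle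 X\rangle^{-\alpha}(H-z\mathbf 1)^{-1}\langle X\rangle^{-\alpha}$ for $z\in\mathbb C\setminus\mathbb R$. Then for every $\alpha>\frac54$ and every $E\in\mathbb R$ the limits $$\mathcal R^{E\pm\imath0}_\alpha=\lim_{\epsilon\downarrow0}\mathcal R^{E\pm\imath\epsilon}_\alpha$$ exist in operator norm. Moreover, for every $\beta$ with $0<\beta<1$ and $\beta<\min\{2\alpha-\frac52,\frac12,\alpha-1\}$ there is a constant $C_\beta$ such that, for all $E,E'\in\mathbb R$, $$\|\mathcal R^{E\pm\imath0}_\alpha-\mathcal R^{E'\pm\imath0}_\alpha\|\le C_\beta\,|E-E'|^\beta .$$ -/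

import Mathlib

open scoped Topology Matrix ComplexConjugate InnerProductSpace
open Filter Set MeasureTheory

noncomputable section

namespace LAP

/-- The momentum space `ℝ^d`, the universal cover of the Brillouin torus `ℝ^d / 2πℤ^d`. Functions
on the torus are `2πℤ^d`-periodic functions on `Mom d`. -/
abbrev Mom (d : ℕ) : Type := EuclideanSpace ℝ (Fin d)

/-- The Hilbert space `ℓ²(ℤ^d, ℂ^L)`. -/
abbrev LatticeHilbert (d L : ℕ) : Type :=
  lp (fun _ : Fin d → ℤ => EuclideanSpace ℂ (Fin L)) 2

/-- Bounded operators on `ℓ²(ℤ^d, ℂ^L)`. -/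
abbrev BoundedOp (d L : ℕ) : Type := LatticeHilbert d L →L[ℂ] LatticeHilbert d L

/-- Translation invariance `⟨n+l|H|m+l⟩ = ⟨n|H|m⟩`, where `⟨n|H|m⟩ v` is the value at site `n`
of `H` applied to the state `v ∈ ℂ^L` placed at site `m`. -/
def TranslationInvariant {d L : ℕ} (H : BoundedOp d L) : Prop :=
  ∀ (n m l : Fin d → ℤ) (v : EuclideanSpace ℂ (Fin L)),
    H (lp.single 2 (m + l) v) (n + l) = H (lp.single 2 m v) n

/-- The Fourier series `(2π)^{-d/2} ∑ₙ e^{-i k·n} φₙ`, for absolutely summable `φ`. -/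
def latticeFourier {d L : ℕ} (φ : LatticeHilbert d L) (k : Mom d) : EuclideanSpace ℂ (Fin L) :=
  (((2 * Real.pi) ^ (-(d : ℝ) / 2) : ℝ) : ℂ) •
    ∑' n : Fin d → ℤ, Complex.exp (-Complex.I * ((∑ i, k i * (n i : ℝ) : ℝ) : ℂ)) • φ n

/-- The fundamental cell `(-π, π]^d` of the Brillouin torus. -/
def brillouinCell (d : ℕ) : Set (Mom d) := {k | ∀ i, k i ∈ Ioc (-Real.pi) Real.pi}

/-- The vector `2π n`, `n ∈ ℤ^d`. -/
def recipVector {d : ℕ} (n : Fin d → ℤ) : Mom d := WithLp.toLp 2 fun i => 2 * Real.pi * (n i : ℝ)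

/-- `𝓔` is the (real analytic) symbol of `H`: a real analytic function on the Brillouin torus with
selfadjoint matrix values such that the Fourier transform conjugates `H` to multiplication by `𝓔`.
The last property is expressed through matrix elements between absolutely summable sequences,
which are dense. -/
structure IsAnalyticSymbol {d L : ℕ} (H : BoundedOp d L)
    (𝓔 : Mom d → Matrix (Fin L) (Fin L) ℂ) : Prop where
  periodic : ∀ (k : Mom d) (n : Fin d → ℤ), 𝓔 (k + recipVector n) = 𝓔 k
  isHermitian : ∀ k, (𝓔 k).IsHermitian
  analytic : ∀ i j, AnalyticOnNhd ℝ (fun k => 𝓔 k i j) univ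
  fourier : ∀ φ ψ : LatticeHilbert d L,
    (Summable fun n => ‖φ n‖) → (Summable fun n => ‖ψ n‖) →
      ⟪ψ, H φ⟫_ℂ = ∫ k in brillouinCell d,
        ⟪latticeFourier ψ k, Matrix.toEuclideanLin (𝓔 k) (latticeFourier φ k)⟫_ℂ

/-- Multiplicity of the real number `E` as an eigenvalue of `A` (`0` if it is not an eigenvalue). -/
def mult {L : ℕ} (A : Matrix (Fin L) (Fin L) ℂ) (E : ℝ) : ℕ :=
  Module.finrank ℂ (Module.End.eigenspace (Matrix.toLin' A) (E : ℂ))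

/-- The set `𝓦` of momenta `k` at which `𝓔 k` has degenerate spectrum. -/
def weylSet {d L : ℕ} (𝓔 : Mom d → Matrix (Fin L) (Fin L) ℂ) : Set (Mom d) :=
  {k | ∃ E : ℝ, 2 ≤ mult (𝓔 k) E}

/-- All degeneracies are at most double. -/
def AtMostDouble {d L : ℕ} (𝓔 : Mom d → Matrix (Fin L) (Fin L) ℂ) : Prop :=
  ∀ k ∈ weylSet 𝓔, ∀ E : ℝ, mult (𝓔 k) E ≤ 2

/-- `f` is, near `k`, an analytic energy band which at `k` does not touch another band. -/
structure IsSimpleBandAt {d L : ℕ} (𝓔 : Mom d → Matrix (Fin L) (Fin L) ℂ)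
    (f : Mom d → ℝ) (k : Mom d) : Prop where
  analytic : AnalyticAt ℝ f k
  eigenvalue : ∀ᶠ k' in 𝓝 k, 0 < mult (𝓔 k') (f k')
  simple : mult (𝓔 k) (f k) = 1

/-- The Hessian matrix of `f` at `k`. -/
def hessian {d : ℕ} (f : Mom d → ℝ) (k : Mom d) : Matrix (Fin d) (Fin d) ℝ :=
  Matrix.of fun i j =>
    fderiv ℝ (fderiv ℝ f) k (EuclideanSpace.single i 1) (EuclideanSpace.single j 1)

/-- Away from band touchings, all energy bands are Morse functions. -/
def BandsMorse {d L : ℕ} (𝓔 : Mom d → Matrix (Fin L) (Fin L) ℂ) : Prop :=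
  ∀ (k : Mom d) (f : Mom d → ℝ), IsSimpleBandAt 𝓔 f k → gradient f k = 0 →
    (hessian f k).det ≠ 0

/-- The Riesz projection `(2πi)⁻¹ ∮_{|z-c|=r} (z - A)⁻¹ dz`, as an entrywise integral. -/
def rieszProj {L : ℕ} (A : Matrix (Fin L) (Fin L) ℂ) (c : ℂ) (r : ℝ) :
    Matrix (Fin L) (Fin L) ℂ :=
  Matrix.of fun i j =>
    (2 * Real.pi * Complex.I)⁻¹ * ∮ z in C(c, r), ((z • (1 : Matrix (Fin L) (Fin L) ℂ) - A)⁻¹) i j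

/-- The Pauli matrices `σ₁, σ₂, σ₃`. -/
def pauli : Fin 3 → Matrix (Fin 2) (Fin 2) ℂ :=
  ![!![0, 1; 1, 0], !![0, -Complex.I; Complex.I, 0], !![1, 0; 0, -1]]

/-- Near `kW`, the two bands touching at `kW` with energy `E` are described by the `2 × 2` symbol
`e(k) 1 + ⟨h(k), σ⟩`: for a small loop around `E` that encloses no other eigenvalue of `𝓔 kW`, the
Riesz projections of `𝓔 k` have a real analytic orthonormal frame `Φ k`, and
`Φ(k)* 𝓔(k) Φ(k) = e(k) 1 + ⟨h(k), σ⟩`. Another frame changes `h` by an analytic rotation and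
leaves `e` unchanged. -/
def IsTwoBandModel {L : ℕ} (𝓔 : Mom 3 → Matrix (Fin L) (Fin L) ℂ) (kW : Mom 3) (E : ℝ)
    (e : Mom 3 → ℝ) (h : Mom 3 → Mom 3) : Prop :=
  ∃ (r : ℝ) (Φ : Mom 3 → Matrix (Fin L) (Fin 2) ℂ),
    0 < r ∧
    (∀ E' : ℝ, |E' - E| ≤ r → 0 < mult (𝓔 kW) E' → E' = E) ∧
    (∀ i j, AnalyticAt ℝ (fun k => Φ k i j) kW) ∧
    (∀ᶠ k in 𝓝 kW, (Φ k)ᴴ * Φ k = 1 ∧ Φ k * (Φ k)ᴴ = rieszProj (𝓔 k) E r) ∧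
    (∀ᶠ k in 𝓝 kW, (Φ k)ᴴ * 𝓔 k * Φ k =
      (e k : ℂ) • (1 : Matrix (Fin 2) (Fin 2) ℂ) + ∑ j, (h k j : ℂ) • pauli j)

/-- Every Weyl point is non-degenerate, `det Dh(kW) ≠ 0`, and weakly tilted (type I),
`|∇(e ∘ h⁻¹)(0)| < κ` for some `κ < 1`, with `h⁻¹` the local inverse of `h` at `kW`. -/
def WeylTypeI {L : ℕ} (𝓔 : Mom 3 → Matrix (Fin L) (Fin L) ℂ) : Prop :=
  ∀ kW ∈ weylSet 𝓔, ∀ E : ℝ, 2 ≤ mult (𝓔 kW) E →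
    ∀ (e : Mom 3 → ℝ) (h : Mom 3 → Mom 3), IsTwoBandModel 𝓔 kW E e h →
      (fderiv ℝ h kW).det ≠ 0 ∧
      ∀ hinv : Mom 3 → Mom 3, (∀ᶠ k in 𝓝 kW, hinv (h k) = k) →
        (∀ᶠ x in 𝓝 0, h (hinv x) = x) →
        ∃ κ : ℝ, κ < 1 ∧ ‖gradient (e ∘ hinv) 0‖ < κ

/-- `⟨n⟩ = (1 + |n|²)^{1/2}` for `n ∈ ℤ^d`. -/
def bracket {d : ℕ} (n : Fin d → ℤ) : ℝ := Real.sqrt (1 + ∑ i, (n i : ℝ) ^ 2)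

theorem one_le_bracket {d : ℕ} (n : Fin d → ℤ) : 1 ≤ bracket n := by
  have h : (0 : ℝ) ≤ ∑ i, (n i : ℝ) ^ 2 := Finset.sum_nonneg fun i _ => sq_nonneg _
  exact Real.one_le_sqrt.2 (by linarith)

theorem norm_bracket_rpow_smul_le {d L : ℕ} {α : ℝ} (hα : 0 ≤ α) (n : Fin d → ℤ)
    (v : EuclideanSpace ℂ (Fin L)) : ‖((bracket n ^ (-α) : ℝ) : ℂ) • v‖ ≤ ‖v‖ := by
  have h0 : 0 ≤ bracket n ^ (-α) := Real.rpow_nonneg (by linarith [one_le_bracket n]) _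
  have h1 : bracket n ^ (-α) ≤ 1 :=
    Real.rpow_le_one_of_one_le_of_nonpos (one_le_bracket n) (by linarith)
  rw [norm_smul, Complex.norm_real, Real.norm_of_nonneg h0]
  exact mul_le_of_le_one_left (norm_nonneg _) h1

/-- The bounded operator `⟨X⟩^{-α}`, `(⟨X⟩^{-α} φ)ₙ = ⟨n⟩^{-α} φₙ`, for `α ≥ 0`. -/
def damping (d L : ℕ) (α : ℝ) (hα : 0 ≤ α) : BoundedOp d L :=
  LinearMap.mkContinuous
    { toFun := fun φ => ⟨fun n => ((bracket n ^ (-α) : ℝ) : ℂ) • φ n,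
        (lp.memℓp φ).mono' fun n => norm_bracket_rpow_smul_le hα n (φ n)⟩
      map_add' := fun φ ψ => by
        ext1; funext n; exact smul_add _ _ _
      map_smul' := fun c φ => by
        ext1; funext n
        exact smul_comm ((bracket n ^ (-α) : ℝ) : ℂ) c (φ n) }
    1 (fun φ => by
      rw [one_mul]
      exact lp.norm_mono (by norm_num) fun n => norm_bracket_rpow_smul_le hα n (φ n))

theorem damping_apply (d L : ℕ) (α : ℝ) (hα : 0 ≤ α) (φ : LatticeHilbert d L) (n : Fin d → ℤ) :
    damping d L α hα φ n = ((bracket n ^ (-α) : ℝ) : ℂ) • φ n := rfl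

/-- The damped resolvent `⟨X⟩^{-α} (H - z)⁻¹ ⟨X⟩^{-α}`. It is used for selfadjoint `H` and
non-real `z` only, where `H - z` is invertible. -/
def dampedResolvent {d L : ℕ} (H : BoundedOp d L) (α : ℝ) (hα : 0 ≤ α) (z : ℂ) : BoundedOp d L :=
  damping d L α hα * Ring.inverse (H - algebraMap ℂ (BoundedOp d L) z) * damping d L α hα

end LAP

end

/-! Everything follows from one bound on the `z`-derivative of the damped resolvent. For `0 < β <
1/2` and `1 + β < α`, the norm of `⟨X⟩^{-α} (H - z)⁻² ⟨X⟩^{-α}` is at most `C |Im z|^{β-1}` when `0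
< |Im z| ≤ 1`. This power is integrable at the real axis, so boundary values exist. Moving from `E`
up to height `|E - E'|`, across, and down to `E'` costs `|E - E'|^β` on each leg, which is the
Hölder bound (`boundary_values`).

In momentum space a matrix element of `(H - z)⁻²` between finitely supported states is the integral
of `u (𝓔 - z)⁻² v` with trigonometric polynomials `u`, `v`. Near a momentum `c` and an energy `E`,
an analytic orthonormal frame splits off the spectrum close to `E`; the complement contributes a
bounded term. The rest is a sum of scalar terms `p (λ - z)⁻²` (`HasLocalBands`), with no band, one
simple Morse band, or two bands `e ± |h|` touching in a cone. Each such `λ` admits a vector field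
`W` with `W·∇λ = 1` and `|W| ≲ |k - c|⁻¹`, namely `∇λ / |∇λ|²`. At a non-degenerate critical point
the gradient vanishes exactly to first order. At a cone it stays away from zero, because the type I
condition makes `e` vary more slowly than `|h|`. The eigenprojections `p` are discontinuous at a
cone, but they are bounded with derivative `O(|k - c|⁻¹)`, which suffices.

The estimate for one band (`band_estimate`) cuts at `|k - c|² ~ y = |Im z|`. Inside, the trivial
bound `|λ - z|⁻² ≤ y⁻²` is affordable because the weight `|k - c|^{-2-2β}` is large there. Outside,
`(λ - z)⁻² = -W·∇(λ - z)⁻¹`, and integration by parts leaves a single power `|λ - z|⁻¹`. Young's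
inequality pairs it with the Poisson density `y |λ - z|⁻²`. A second integration by parts bounds the
integral of that density without loss in `y`, since the Poisson kernel is the derivative of a
bounded arctangent (`poisson_bound`). All bounds are in terms of `∫ |k - c|^{-2-2β} |u|² + |k -
c|^{-2β} |Du|²`, which Hardy's inequality controls by `∑ ⟨n⟩^{2α} |aₙ|²` when `1 + β < min(α, 3/2)`
(`localEnergy_trigPoly_le`); the weight cancels the damping.

A smooth compactly supported weight whose lattice translates sum to one replaces the Brillouin cell,
so that no boundary terms arise. Compactness in momentum and in energy makes the constants uniform.
-/

namespace LAP

/-! ### Calculus of functions with a power singularity at a point. -/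

/-- `f` is `C¹` on a punctured neighbourhood of `c` with `f = O(|k - c|^p)` and
`Df = O(|k - c|^(p - 1))`. -/
def IsSym {E F : Type*} [NormedAddCommGroup E] [NormedSpace ℝ E] [NormedAddCommGroup F]
    [NormedSpace ℝ F] (c : E) (p : ℝ) (f : E → F) : Prop :=
  ∃ C : ℝ, ∀ᶠ k in 𝓝[≠] c, ContDiffAt ℝ 1 f k ∧ ‖f k‖ ≤ C * ‖k - c‖ ^ p ∧
    ‖fderiv ℝ f k‖ ≤ C * ‖k - c‖ ^ (p - 1)

section IsSym

variable {E F : Type*} [NormedAddCommGroup E] [NormedSpace ℝ E] [NormedAddCommGroup F]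
  [NormedSpace ℝ F] {c : E} {p q : ℝ}

theorem eventually_norm_sub_pos {E : Type*} [NormedAddCommGroup E] (c : E) :
    ∀ᶠ k in 𝓝[≠] c, 0 < ‖k - c‖ := by
  filter_upwards [self_mem_nhdsWithin] with k hk
  exact norm_pos_iff.2 (sub_ne_zero.2 hk)

theorem eventually_norm_sub_lt {E : Type*} [NormedAddCommGroup E] (c : E) {r : ℝ} (hr : 0 < r) :
    ∀ᶠ k in 𝓝 c, ‖k - c‖ < r := by
  filter_upwards [Metric.ball_mem_nhds c hr] with k hk
  simpa [dist_eq_norm] using hk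

theorem IsSym.exists_nonneg {f : E → F} (hf : IsSym c p f) : ∃ C : ℝ, 0 ≤ C ∧
    ∀ᶠ k in 𝓝[≠] c, ContDiffAt ℝ 1 f k ∧ ‖f k‖ ≤ C * ‖k - c‖ ^ p ∧
      ‖fderiv ℝ f k‖ ≤ C * ‖k - c‖ ^ (p - 1) := by
  obtain ⟨C, hC⟩ := hf
  refine ⟨max C 0, le_max_right _ _, ?_⟩
  filter_upwards [hC, eventually_norm_sub_pos c] with k ⟨h1, h2, h3⟩ hk
  exact ⟨h1, h2.trans (by gcongr; exact le_max_left _ _), h3.trans (by gcongr; exact le_max_left _ _)⟩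

theorem IsSym.mono {f : E → F} (hf : IsSym c p f) (hqp : q ≤ p) : IsSym c q f := by
  obtain ⟨C, hC0, hC⟩ := hf.exists_nonneg
  refine ⟨C, ?_⟩
  filter_upwards [hC, eventually_norm_sub_pos c,
    nhdsWithin_le_nhds (eventually_norm_sub_lt c one_pos)] with k ⟨h1, h2, h3⟩ hk hk1
  refine ⟨h1, h2.trans ?_, h3.trans ?_⟩
  · exact mul_le_mul_of_nonneg_left (Real.rpow_le_rpow_of_exponent_ge hk hk1.le hqp) hC0
  · exact mul_le_mul_of_nonneg_left
      (Real.rpow_le_rpow_of_exponent_ge hk hk1.le (by linarith)) hC0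

theorem IsSym.add {f g : E → F} (hf : IsSym c p f) (hg : IsSym c p g) :
    IsSym c p (fun k => f k + g k) := by
  obtain ⟨C, hC⟩ := hf
  obtain ⟨C', hC'⟩ := hg
  refine ⟨C + C', ?_⟩
  filter_upwards [hC, hC'] with k ⟨h1, h2, h3⟩ ⟨h1', h2', h3'⟩
  refine ⟨h1.add h1', ?_, ?_⟩
  · rw [add_mul]; exact (norm_add_le _ _).trans (add_le_add h2 h2')
  · rw [fderiv_fun_add (h1.differentiableAt one_ne_zero) (h1'.differentiableAt one_ne_zero), add_mul]
    exact (norm_add_le _ _).trans (add_le_add h3 h3')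

theorem IsSym.zero : IsSym c p (fun _ : E => (0 : F)) :=
  ⟨0, Eventually.of_forall fun k => ⟨contDiffAt_const, by simp, by simp⟩⟩

theorem IsSym.sum {ι : Type*} (s : Finset ι) {f : ι → E → F} (hf : ∀ i ∈ s, IsSym c p (f i)) :
    IsSym c p (fun k => ∑ i ∈ s, f i k) := by
  classical
  induction s using Finset.induction_on with
  | empty => simpa using IsSym.zero
  | insert a s ha ih =>
    simp only [Finset.sum_insert ha]
    exact (hf a (by simp)).add (ih fun i hi => hf i (by simp [hi]))

theorem IsSym.clm_comp {G : Type*} [NormedAddCommGroup G] [NormedSpace ℝ G] {f : E → F}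
    (hf : IsSym c p f) (A : F →L[ℝ] G) : IsSym c p (fun k => A (f k)) := by
  obtain ⟨C, hC⟩ := hf
  refine ⟨‖A‖ * C, ?_⟩
  filter_upwards [hC] with k ⟨h1, h2, h3⟩
  refine ⟨A.contDiff.contDiffAt.comp k h1, ?_, ?_⟩
  · rw [mul_assoc]; exact A.le_opNorm_of_le h2
  · have : fderiv ℝ (fun k => A (f k)) k = A.comp (fderiv ℝ f k) :=
      (A.hasFDerivAt.comp k (h1.differentiableAt one_ne_zero).hasFDerivAt).fderiv
    rw [this, mul_assoc]
    exact (A.opNorm_comp_le _).trans (mul_le_mul_of_nonneg_left h3 (norm_nonneg _))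

theorem IsSym.ofReal {f : E → ℝ} (hf : IsSym c p f) : IsSym c p (fun k => (f k : ℂ)) := by
  simpa using hf.clm_comp Complex.ofRealCLM

theorem norm_fderiv_mul_le {𝔸 : Type*} [NormedField 𝔸] [NormedAlgebra ℝ 𝔸] {f g : E → 𝔸} {k : E}
    (hf : DifferentiableAt ℝ f k) (hg : DifferentiableAt ℝ g k) :
    ‖fderiv ℝ (fun k => f k * g k) k‖ ≤ ‖f k‖ * ‖fderiv ℝ g k‖ + ‖g k‖ * ‖fderiv ℝ f k‖ := by
  rw [fderiv_fun_mul hf hg]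
  refine (norm_add_le _ _).trans (add_le_add ?_ ?_) <;>
  · refine ContinuousLinearMap.opNorm_le_bound _ (by positivity) fun x => ?_
    simp only [smul_apply, smul_eq_mul, norm_mul, mul_assoc]
    gcongr
    exact ContinuousLinearMap.le_opNorm _ _

theorem IsSym.mul {𝔸 : Type*} [NormedField 𝔸] [NormedAlgebra ℝ 𝔸] {f g : E → 𝔸}
    (hf : IsSym c p f) (hg : IsSym c q g) : IsSym c (p + q) (fun k => f k * g k) := by
  obtain ⟨C, hC0, hC⟩ := hf.exists_nonneg
  obtain ⟨C', hC0', hC'⟩ := hg.exists_nonneg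
  refine ⟨2 * (C * C'), ?_⟩
  filter_upwards [hC, hC', eventually_norm_sub_pos c] with k ⟨h1, h2, h3⟩ ⟨h1', h2', h3'⟩ hk
  refine ⟨h1.mul h1', ?_, ?_⟩
  · calc ‖f k * g k‖ ≤ ‖f k‖ * ‖g k‖ := norm_mul_le _ _
      _ ≤ (C * ‖k - c‖ ^ p) * (C' * ‖k - c‖ ^ q) := by gcongr
      _ = (C * C') * ‖k - c‖ ^ (p + q) := by rw [Real.rpow_add hk]; ring
      _ ≤ _ := by
        have : 0 ≤ C * C' * ‖k - c‖ ^ (p + q) := by positivity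
        linarith
  · calc ‖fderiv ℝ (fun k => f k * g k) k‖
        ≤ ‖f k‖ * ‖fderiv ℝ g k‖ + ‖g k‖ * ‖fderiv ℝ f k‖ :=
          norm_fderiv_mul_le (h1.differentiableAt one_ne_zero) (h1'.differentiableAt one_ne_zero)
      _ ≤ (C * ‖k - c‖ ^ p) * (C' * ‖k - c‖ ^ (q - 1)) +
          (C' * ‖k - c‖ ^ q) * (C * ‖k - c‖ ^ (p - 1)) := by gcongr
      _ = C * C' * (‖k - c‖ ^ p * ‖k - c‖ ^ (q - 1)) +
          C * C' * (‖k - c‖ ^ q * ‖k - c‖ ^ (p - 1)) := by ring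
      _ = _ := by
        rw [← Real.rpow_add hk, ← Real.rpow_add hk, show p + (q - 1) = p + q - 1 by ring,
          show q + (p - 1) = p + q - 1 by ring]; ring

/-- The lower bound makes `f` comparable to `‖k - c‖ ^ p` from both sides, so real powers of either
sign are controlled. The derivative `s f^{s-1} Df` needs this for the exponent `s - 1` as well. -/
theorem IsSym.rpow {f : E → ℝ} (hf : IsSym c p f) {a : ℝ} (ha : 0 < a)
    (hlow : ∀ᶠ k in 𝓝[≠] c, a * ‖k - c‖ ^ p ≤ f k) (s : ℝ) :
    IsSym c (p * s) (fun k => f k ^ s) := by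
  obtain ⟨C, hC0, hC⟩ := hf.exists_nonneg
  have key : ∀ t : ℝ, ∃ K : ℝ, 0 ≤ K ∧ ∀ᶠ k in 𝓝[≠] c, f k ^ t ≤ K * ‖k - c‖ ^ (p * t) := by
    intro t
    refine ⟨max (a ^ t) (C ^ t), (Real.rpow_nonneg ha.le _).trans (le_max_left _ _), ?_⟩
    filter_upwards [hC, hlow, eventually_norm_sub_pos c] with k ⟨h1, h2, h3⟩ hl hk
    have hr : 0 < ‖k - c‖ ^ p := Real.rpow_pos_of_pos hk p
    have hfk : 0 < f k := (mul_pos ha hr).trans_le hl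
    have hfC : f k ≤ C * ‖k - c‖ ^ p := (le_abs_self _).trans h2
    rw [Real.rpow_mul hk.le]
    rcases le_total 0 t with ht | ht
    · calc f k ^ t ≤ (C * ‖k - c‖ ^ p) ^ t := Real.rpow_le_rpow hfk.le hfC ht
        _ = C ^ t * (‖k - c‖ ^ p) ^ t := Real.mul_rpow hC0 hr.le
        _ ≤ _ := by gcongr; exact le_max_right _ _
    · calc f k ^ t ≤ (a * ‖k - c‖ ^ p) ^ t :=
            Real.rpow_le_rpow_of_nonpos (mul_pos ha hr) hl ht
        _ = a ^ t * (‖k - c‖ ^ p) ^ t := Real.mul_rpow ha.le hr.le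
        _ ≤ _ := by gcongr; exact le_max_left _ _
  obtain ⟨K, hK0, hK⟩ := key s
  obtain ⟨K', hK0', hK'⟩ := key (s - 1)
  refine ⟨K + |s| * K' * C, ?_⟩
  filter_upwards [hC, hlow, eventually_norm_sub_pos c, hK, hK'] with k ⟨h1, h2, h3⟩ hl hk hk1 hk2
  have hr : 0 < ‖k - c‖ ^ p := Real.rpow_pos_of_pos hk p
  have hfk : 0 < f k := (mul_pos ha hr).trans_le hl
  refine ⟨h1.rpow_const_of_ne hfk.ne', ?_, ?_⟩
  · rw [Real.norm_of_nonneg (Real.rpow_nonneg hfk.le _)]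
    refine hk1.trans ?_
    gcongr
    have : 0 ≤ |s| * K' * C := by positivity
    linarith
  · rw [((h1.differentiableAt one_ne_zero).hasFDerivAt.rpow_const (Or.inl hfk.ne')).fderiv,
      norm_smul, norm_mul, Real.norm_eq_abs, Real.norm_of_nonneg (Real.rpow_nonneg hfk.le _)]
    calc |s| * f k ^ (s - 1) * ‖fderiv ℝ f k‖
        ≤ |s| * (K' * ‖k - c‖ ^ (p * (s - 1))) * (C * ‖k - c‖ ^ (p - 1)) := by gcongr
      _ = |s| * K' * C * (‖k - c‖ ^ (p * (s - 1)) * ‖k - c‖ ^ (p - 1)) := by ring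
      _ = |s| * K' * C * ‖k - c‖ ^ (p * s - 1) := by
        rw [← Real.rpow_add hk]; congr 2; ring
      _ ≤ _ := by gcongr; linarith

theorem IsSym.inv {f : E → ℝ} (hf : IsSym c p f) {a : ℝ} (ha : 0 < a)
    (hlow : ∀ᶠ k in 𝓝[≠] c, a * ‖k - c‖ ^ p ≤ f k) : IsSym c (-p) (fun k => (f k)⁻¹) := by
  have := hf.rpow ha hlow (-1)
  simpa [Real.rpow_neg_one] using this

/-- The derivative is only bounded, but order `0` allows it to grow like `‖k - c‖⁻¹`, which is at
least `1` near `c`. -/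
theorem IsSym.of_contDiffAt {f : E → F} (hf : ContDiffAt ℝ 1 f c) : IsSym c 0 f := by
  have h1 : ∀ᶠ k in 𝓝 c, ContDiffAt ℝ 1 f k := hf.eventually (by simp)
  have h2 : ∀ᶠ k in 𝓝 c, ‖f k‖ < ‖f c‖ + 1 :=
    hf.continuousAt.norm.eventually_lt continuousAt_const (by simp)
  have h3 : ∀ᶠ k in 𝓝 c, ‖fderiv ℝ f k‖ < ‖fderiv ℝ f c‖ + 1 :=
    (hf.fderiv_right (m := 0) le_rfl).continuousAt.norm.eventually_lt continuousAt_const (by simp)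
  refine ⟨max (‖f c‖ + 1) (‖fderiv ℝ f c‖ + 1), ?_⟩
  filter_upwards [nhdsWithin_le_nhds h1, nhdsWithin_le_nhds h2, nhdsWithin_le_nhds h3,
    eventually_norm_sub_pos c, nhdsWithin_le_nhds (eventually_norm_sub_lt c one_pos)]
    with k h1 h2 h3 hk hk1
  refine ⟨h1, ?_, ?_⟩
  · simpa using h2.le.trans (le_max_left _ _)
  · have : 1 ≤ ‖k - c‖ ^ ((0 : ℝ) - 1) :=
      Real.one_le_rpow_of_pos_of_le_one_of_nonpos hk hk1.le (by norm_num)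
    have h0 : 0 ≤ max (‖f c‖ + 1) (‖fderiv ℝ f c‖ + 1) := le_max_of_le_left (by positivity)
    calc _ ≤ max (‖f c‖ + 1) (‖fderiv ℝ f c‖ + 1) * 1 := by
          simpa using h3.le.trans (le_max_right _ _)
      _ ≤ _ := by gcongr

theorem IsSym.const (v : F) : IsSym c 0 (fun _ : E => v) := .of_contDiffAt contDiffAt_const

theorem IsSym.const_mul {𝔸 : Type*} [NormedField 𝔸] [NormedAlgebra ℝ 𝔸] {f : E → 𝔸}
    (hf : IsSym c p f) (a : 𝔸) : IsSym c p (fun k => a * f k) := by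
  simpa using (IsSym.const (c := c) a).mul hf

/-- The first order Taylor expansion turns a zero at `c` into one extra order of decay. -/
theorem IsSym.of_contDiffAt_zero {f : E → F} (hf : ContDiffAt ℝ 1 f c) (h0 : f c = 0) :
    IsSym c 1 f := by
  have h1 : ∀ᶠ k in 𝓝 c, ContDiffAt ℝ 1 f k := hf.eventually (by simp)
  have h3 : ∀ᶠ k in 𝓝 c, ‖fderiv ℝ f k‖ < ‖fderiv ℝ f c‖ + 1 :=
    (hf.fderiv_right (m := 0) le_rfl).continuousAt.norm.eventually_lt continuousAt_const (by simp)
  have h2 : ∀ᶠ k in 𝓝 c, ‖f k - f c - fderiv ℝ f c (k - c)‖ ≤ 1 * ‖k - c‖ :=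
    (hf.differentiableAt one_ne_zero).hasFDerivAt.isLittleO.def one_pos
  refine ⟨‖fderiv ℝ f c‖ + 1, ?_⟩
  filter_upwards [nhdsWithin_le_nhds h1, nhdsWithin_le_nhds h2, nhdsWithin_le_nhds h3] with k h1 h2 h3
  refine ⟨h1, ?_, by simpa using h3.le⟩
  rw [h0, sub_zero] at h2
  have := (fderiv ℝ f c).le_opNorm (k - c)
  have h4 := norm_le_norm_add_norm_sub' (f k) (fderiv ℝ f c (k - c))
  simp only [Real.rpow_one]
  linarith

end IsSym

/-- `lam` is a `C¹` energy band on a punctured neighbourhood of `c`, transported at unit speed by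
a vector field which is singular of order `-1` at `c`. -/
def IsLocalBand {d : ℕ} (c : Mom d) (lam : Mom d → ℝ) : Prop :=
  ∃ W : Fin d → Mom d → ℝ, (∀ i, IsSym c (-1) (W i)) ∧
    ∀ᶠ k in 𝓝[≠] c, ContDiffAt ℝ 1 lam k ∧
      ∑ i, W i k * fderiv ℝ lam k (EuclideanSpace.single i 1) = 1

/-- The field is `W = g / |g|²` with `g = ∇lam`. The lower bound on `|g|²` gives it order `p - 2p =
-p`, and `p ≤ 1` is what makes this at least `-1`. -/
theorem IsLocalBand.of_gradient {d : ℕ} {c : Mom d} {lam : Mom d → ℝ} {g : Fin d → Mom d → ℝ}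
    {p : ℝ} (hp : p ≤ 1) (hg : ∀ i, IsSym c p (g i)) {a : ℝ} (ha : 0 < a)
    (hlow : ∀ᶠ k in 𝓝[≠] c, a * ‖k - c‖ ^ (p + p) ≤ ∑ i, g i k * g i k)
    (hlam : ∀ᶠ k in 𝓝[≠] c, ContDiffAt ℝ 1 lam k ∧
      ∀ i, fderiv ℝ lam k (EuclideanSpace.single i 1) = g i k) : IsLocalBand c lam := by
  have hs : IsSym c (p + p) (fun k => ∑ i, g i k * g i k) :=
    IsSym.sum _ fun i _ => (hg i).mul (hg i)
  refine ⟨fun i k => g i k * (∑ j, g j k * g j k)⁻¹, fun i => ?_, ?_⟩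
  · exact ((hg i).mul (hs.inv ha hlow)).mono (by linarith)
  · filter_upwards [hlam, hlow, eventually_norm_sub_pos c] with k hk hl hpos
    refine ⟨hk.1, ?_⟩
    have h0 : 0 < ∑ j, g j k * g j k := lt_of_lt_of_le (by positivity) hl
    simp only [hk.2]
    calc ∑ i, g i k * (∑ j, g j k * g j k)⁻¹ * g i k
        = (∑ i, g i k * g i k) * (∑ j, g j k * g j k)⁻¹ := by
          rw [Finset.sum_mul]; exact Finset.sum_congr rfl fun i _ => by ring
      _ = 1 := mul_inv_cancel₀ h0.ne'

end LAP

/-! ### Integration by parts along the transporting vector field, and cutoffs. -/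

namespace LAP

/-- All integrands below are a cutoff times a factor that may be singular at `c` or undefined far
away; regularity of that factor is available only on the closed support of the cutoff. -/
theorem continuous_mul_of_tsupport {X : Type*} [TopologicalSpace X] {f h : X → ℂ}
    (hf : Continuous f) (hh : ∀ x ∈ tsupport f, ContinuousAt h x) :
    Continuous fun x => f x * h x := by
  rw [continuous_iff_continuousAt]
  intro x
  by_cases hx : x ∈ tsupport f
  · exact hf.continuousAt.mul (hh x hx)
  · have : (fun x => f x * h x) =ᶠ[𝓝 x] fun _ => 0 := by
      filter_upwards [notMem_tsupport_iff_eventuallyEq.1 hx] with y hy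
      simp [hy]
    exact continuousAt_const.congr this.symm

theorem contDiff_mul_of_tsupport {E : Type*} [NormedAddCommGroup E] [NormedSpace ℝ E]
    {f h : E → ℂ} {n : WithTop ℕ∞} (hf : ContDiff ℝ n f)
    (hh : ∀ x ∈ tsupport f, ContDiffAt ℝ n h x) : ContDiff ℝ n fun x => f x * h x := by
  rw [contDiff_iff_contDiffAt]
  intro x
  by_cases hx : x ∈ tsupport f
  · exact hf.contDiffAt.mul (hh x hx)
  · have : (fun x => f x * h x) =ᶠ[𝓝 x] fun _ => 0 := by
      filter_upwards [notMem_tsupport_iff_eventuallyEq.1 hx] with y hy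
      simp [hy]
    exact contDiffAt_const.congr_of_eventuallyEq this

variable {d : ℕ}

/-- The standard basis vector `eᵢ` of momentum space. -/
noncomputable abbrev momBasis (i : Fin d) : Mom d := EuclideanSpace.single i 1

theorem norm_fderiv_momBasis_le {F : Type*} [NormedAddCommGroup F] [NormedSpace ℝ F]
    (A : Mom d →L[ℝ] F) (i : Fin d) : ‖A (momBasis i)‖ ≤ ‖A‖ := by
  simpa using A.le_opNorm (momBasis i)

theorem integral_sum_mul_fderiv {m : Mom d → ℂ} {q : Fin d → Mom d → ℂ}
    (hq : ∀ i, ContDiff ℝ 1 (q i)) (hs : ∀ i, HasCompactSupport (q i))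
    (hm : ∀ i, ∀ k ∈ tsupport (q i), ContDiffAt ℝ 1 m k) :
    ∫ k, ∑ i, q i k * fderiv ℝ m k (momBasis i) =
      -∫ k, ∑ i, fderiv ℝ (q i) k (momBasis i) * m k := by
  have hq' : ∀ i, Continuous fun k => fderiv ℝ (q i) k (momBasis i) := fun i =>
    ((hq i).continuous_fderiv one_ne_zero).clm_apply continuous_const
  have h1 : ∀ i, Integrable fun k => q i k * fderiv ℝ m k (momBasis i) := fun i => by
    refine Continuous.integrable_of_hasCompactSupport ?_ (hs i).mul_right
    refine continuous_mul_of_tsupport (hq i).continuous fun k hk => ?_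
    exact ((hm i k hk).fderiv_right (m := 0) le_rfl).continuousAt.clm_apply continuousAt_const
  have h2 : ∀ i, Integrable fun k => fderiv ℝ (q i) k (momBasis i) * m k := fun i => by
    refine Continuous.integrable_of_hasCompactSupport ?_
      (((hs i).fderiv_apply (𝕜 := ℝ) (momBasis i)).mul_right)
    refine continuous_mul_of_tsupport (hq' i) fun k hk => ?_
    exact (hm i k (tsupport_fderiv_apply_subset ℝ _ hk)).continuousAt
  have h3 : ∀ i, Integrable fun k => q i k * m k := fun i => by
    refine Continuous.integrable_of_hasCompactSupport ?_ (hs i).mul_right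
    exact continuous_mul_of_tsupport (hq i).continuous fun k hk => (hm i k hk).continuousAt
  rw [integral_finsetSum _ fun i _ => h1 i, integral_finsetSum _ fun i _ => h2 i,
    ← Finset.sum_neg_distrib]
  refine Finset.sum_congr rfl fun i _ => ?_
  exact integral_mul_fderiv_eq_neg_fderiv_mul_of_integrable (h2 i) (h1 i) (h3 i)
    (fun k _ => (hq i).differentiable one_ne_zero k)
    (fun k hk => (hm i k hk).differentiableAt one_ne_zero)

theorem fderiv_comp_real_apply {φ : ℝ → ℂ} {φ' : ℂ} {lam : Mom d → ℝ} {k : Mom d}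
    (hφ : HasDerivAt φ φ' (lam k)) (hlam : DifferentiableAt ℝ lam k) (v : Mom d) :
    fderiv ℝ (fun k => φ (lam k)) k v = φ' * (fderiv ℝ lam k v : ℂ) := by
  have h : HasFDerivAt (fun k => φ (lam k)) _ k := hφ.hasFDerivAt.comp k hlam.hasFDerivAt
  rw [h.fderiv]
  simp [mul_comm]

/-- Integration by parts along the vector field which transports `lam` at unit speed. -/
theorem transport_bound {c : Mom d} {r K p : ℝ} {lam : Mom d → ℝ} {W : Fin d → Mom d → ℝ}
    {κ w : Mom d → ℂ} {η : Mom d → ℝ} {φ φ' : ℝ → ℂ} (hK : 0 ≤ K)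
    (hlam : ∀ k, 0 < ‖k - c‖ → ‖k - c‖ < r → ContDiffAt ℝ 1 lam k ∧
      ∑ i, W i k * fderiv ℝ lam k (momBasis i) = 1)
    (hκ : ∀ i k, 0 < ‖k - c‖ → ‖k - c‖ < r → ContDiffAt ℝ 1 (fun k => (W i k : ℂ) * κ k) k ∧
      ‖(W i k : ℂ) * κ k‖ ≤ K * ‖k - c‖ ^ p ∧
      ‖fderiv ℝ (fun k => (W i k : ℂ) * κ k) k‖ ≤ K * ‖k - c‖ ^ (p - 1))
    (hη : ContDiff ℝ 1 η) (hηc : HasCompactSupport η)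
    (hηs : ∀ k ∈ tsupport η, 0 < ‖k - c‖ ∧ ‖k - c‖ < r) (hη0 : ∀ k, 0 ≤ η k) (hη1 : ∀ k, η k ≤ 1)
    (hη' : ∀ k, ‖fderiv ℝ η k‖ * ‖k - c‖ ≤ K) (hw : ContDiff ℝ 1 w)
    (hφ : ContDiff ℝ 1 φ) (hφ' : ∀ x, HasDerivAt φ (φ' x) x) :
    Integrable (fun k => ‖φ (lam k)‖ * (η k * (‖k - c‖ ^ (p - 1) * ‖w k‖ +
        ‖k - c‖ ^ p * ‖fderiv ℝ w k‖))) ∧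
    ‖∫ k, (η k : ℂ) ^ 2 * κ k * w k * φ' (lam k)‖ ≤ d * (K + 2 * K ^ 2) *
      ∫ k, ‖φ (lam k)‖ * (η k * (‖k - c‖ ^ (p - 1) * ‖w k‖ + ‖k - c‖ ^ p * ‖fderiv ℝ w k‖)) := by
  have hηC : ContDiff ℝ 1 fun k => (η k : ℂ) := Complex.ofRealCLM.contDiff.comp hη
  have hηs2 : ∀ k ∈ tsupport (fun k => (η k : ℂ)), 0 < ‖k - c‖ ∧ ‖k - c‖ < r := fun k hk =>
    hηs k (tsupport_comp_subset (g := ((↑) : ℝ → ℂ)) (by simp) η hk)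
  have hηCc : HasCompactSupport fun k => (η k : ℂ) := hηc.comp_left (g := ((↑) : ℝ → ℂ)) (by simp)
  have hη2s : ∀ k ∈ tsupport (fun k => (η k : ℂ) ^ 2), 0 < ‖k - c‖ ∧ ‖k - c‖ < r := fun k hk =>
    hηs2 k (tsupport_comp_subset (g := fun z : ℂ => z ^ 2) (by simp) (fun k => (η k : ℂ)) hk)
  have hlamc : ∀ k, 0 < ‖k - c‖ → ‖k - c‖ < r → ContDiffAt ℝ 1 (fun k => φ (lam k)) k :=
    fun k h1 h2 => hφ.contDiffAt.comp k (hlam k h1 h2).1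
  have hFc : ∀ i k, 0 < ‖k - c‖ → ‖k - c‖ < r →
      ContDiffAt ℝ 1 (fun k => (W i k : ℂ) * κ k * w k) k :=
    fun i k h1 h2 => (hκ i k h1 h2).1.mul hw.contDiffAt
  have hnorm : ∀ (s : ℝ) k, 0 < ‖k - c‖ → ContinuousAt (fun k => ‖k - c‖ ^ s) k := fun s k hk =>
    ((continuous_id.sub continuous_const).norm.continuousAt).rpow_const (Or.inl hk.ne')
  -- The cutoff enters squared so that one factor `η` survives differentiation. Squaring that factor
  -- in Young's inequality later reproduces the `η²` of the Poisson density.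
  set q : Fin d → Mom d → ℂ := fun i k => (η k : ℂ) ^ 2 * ((W i k : ℂ) * κ k * w k) with hqdef
  have hq : ∀ i, ContDiff ℝ 1 (q i) := fun i =>
    contDiff_mul_of_tsupport (hηC.pow 2) fun k hk => hFc i k (hη2s k hk).1 (hη2s k hk).2
  have hqs : ∀ i, tsupport (q i) ⊆ tsupport (fun k => (η k : ℂ) ^ 2) := fun i =>
    tsupport_mul_subset_left
  have hqc : ∀ i, HasCompactSupport (q i) := fun i =>
    (hηCc.comp_left (g := fun z : ℂ => z ^ 2) (by simp)).mul_right
  set G : Mom d → ℝ := fun k => ‖φ (lam k)‖ * (η k * (‖k - c‖ ^ (p - 1) * ‖w k‖ +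
        ‖k - c‖ ^ p * ‖fderiv ℝ w k‖)) with hG
  have hGint : Integrable G := by
    have : Integrable fun k => (η k : ℂ) * ((‖φ (lam k)‖ * (‖k - c‖ ^ (p - 1) * ‖w k‖ +
        ‖k - c‖ ^ p * ‖fderiv ℝ w k‖) : ℝ) : ℂ) := by
      refine Continuous.integrable_of_hasCompactSupport ?_ hηCc.mul_right
      refine continuous_mul_of_tsupport hηC.continuous fun k hk => ?_
      obtain ⟨h1, h2⟩ := hηs2 k hk
      refine Complex.continuous_ofReal.continuousAt.comp ?_
      exact (hlamc k h1 h2).continuousAt.norm.mul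
        (((hnorm _ k h1).mul hw.continuous.norm.continuousAt).add
          ((hnorm _ k h1).mul (hw.continuous_fderiv one_ne_zero).norm.continuousAt))
    refine this.re.congr (Eventually.of_forall fun k => ?_)
    simp only [hG, RCLike.re_eq_complex_re, Complex.re_ofReal_mul, Complex.ofReal_re]
    ring
  have hqd : ∀ i k, ‖fderiv ℝ (q i) k‖ ≤ (K + 2 * K ^ 2) * (η k * (‖k - c‖ ^ (p - 1) * ‖w k‖ +
        ‖k - c‖ ^ p * ‖fderiv ℝ w k‖)) := fun i k => by
    by_cases hk : k ∈ tsupport (fun k => (η k : ℂ))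
    · obtain ⟨h1, h2⟩ := hηs2 k hk
      obtain ⟨k1, k2, k3⟩ := hκ i k h1 h2
      have hwd : DifferentiableAt ℝ w k := hw.differentiable one_ne_zero k
      have hηd : DifferentiableAt ℝ (fun k => (η k : ℂ)) k := hηC.differentiable one_ne_zero k
      have e1 := norm_fderiv_mul_le (k1.differentiableAt one_ne_zero) hwd
      have e2 : ‖fderiv ℝ (fun k => (η k : ℂ)) k‖ ≤ K * ‖k - c‖⁻¹ := by
        have : fderiv ℝ (fun k => (η k : ℂ)) k = Complex.ofRealCLM.comp (fderiv ℝ η k) :=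
          (Complex.ofRealCLM.hasFDerivAt.comp k
            (hη.differentiable one_ne_zero k).hasFDerivAt).fderiv
        rw [this, ← div_eq_mul_inv, le_div_iff₀ h1]
        refine le_trans ?_ (hη' k)
        gcongr
        refine (Complex.ofRealCLM.opNorm_comp_le _).trans ?_
        simp
      have e3 : ‖fderiv ℝ (fun k => (η k : ℂ) ^ 2) k‖ ≤ 2 * (η k * (K * ‖k - c‖⁻¹)) := by
        have := norm_fderiv_mul_le hηd hηd
        simp only [← pow_two] at this
        rw [Complex.norm_of_nonneg (hη0 k)] at this
        have h5 := mul_le_mul_of_nonneg_left e2 (hη0 k)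
        linarith
      have e4 := norm_fderiv_mul_le (f := fun k => (η k : ℂ) ^ 2) (hηd.pow 2)
        ((hFc i k h1 h2).differentiableAt one_ne_zero)
      have e5 : ‖(η k : ℂ) ^ 2‖ ≤ η k := by
        rw [norm_pow, Complex.norm_of_nonneg (hη0 k), pow_two]
        exact mul_le_of_le_one_left (hη0 k) (hη1 k)
      have e6 : ‖fderiv ℝ (fun k => (W i k : ℂ) * κ k * w k) k‖ ≤
          K * (‖k - c‖ ^ (p - 1) * ‖w k‖ + ‖k - c‖ ^ p * ‖fderiv ℝ w k‖) := by
        refine e1.trans ?_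
        have a1 := mul_le_mul_of_nonneg_right k2 (norm_nonneg (fderiv ℝ w k))
        have a2 := mul_le_mul_of_nonneg_left k3 (norm_nonneg (w k))
        linarith
      have e7 : ‖(W i k : ℂ) * κ k * w k‖ ≤ K * ‖k - c‖ ^ p * ‖w k‖ := by
        rw [norm_mul]; gcongr
      have hpow : ‖k - c‖⁻¹ * ‖k - c‖ ^ p = ‖k - c‖ ^ (p - 1) := by
        rw [Real.rpow_sub_one h1.ne']; ring
      calc ‖fderiv ℝ (q i) k‖ ≤ _ := e4
        _ ≤ η k * (K * (‖k - c‖ ^ (p - 1) * ‖w k‖ + ‖k - c‖ ^ p * ‖fderiv ℝ w k‖)) +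
            (K * ‖k - c‖ ^ p * ‖w k‖) * (2 * (η k * (K * ‖k - c‖⁻¹))) := by
            gcongr
            exact hη0 k
        _ = η k * (K * (‖k - c‖ ^ (p - 1) * ‖w k‖ + ‖k - c‖ ^ p * ‖fderiv ℝ w k‖)) +
            2 * K ^ 2 * (η k * ((‖k - c‖⁻¹ * ‖k - c‖ ^ p) * ‖w k‖)) := by ring
        _ ≤ η k * (K * (‖k - c‖ ^ (p - 1) * ‖w k‖ + ‖k - c‖ ^ p * ‖fderiv ℝ w k‖)) +
            2 * K ^ 2 * (η k * (‖k - c‖ ^ (p - 1) * ‖w k‖ + ‖k - c‖ ^ p * ‖fderiv ℝ w k‖)) := by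
            rw [hpow]
            gcongr
            · exact hη0 k
            · exact le_add_of_nonneg_right (by positivity)
        _ = _ := by ring
    · have : fderiv ℝ (q i) k = 0 := by
        by_contra h
        refine hk (tsupport_comp_subset (g := fun z : ℂ => z ^ 2) (by simp) (fun k => (η k : ℂ))
          (hqs i (tsupport_fderiv_subset ℝ (subset_tsupport _ h))))
      rw [this, norm_zero]
      have := hη0 k
      positivity
  refine ⟨hGint, ?_⟩
  have hibp := integral_sum_mul_fderiv (m := fun k => φ (lam k)) hq hqc
    fun i k hk => hlamc k (hη2s k (hqs i hk)).1 (hη2s k (hqs i hk)).2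
  -- By the chain rule the sum is `η² κ w φ'(lam)` times `∑ Wᵢ ∂ᵢ lam`, and the last factor is `1`
  -- wherever the cutoff is nonzero.
  have hL : ∀ k, ∑ i, q i k * fderiv ℝ (fun k => φ (lam k)) k (momBasis i) =
      (η k : ℂ) ^ 2 * κ k * w k * φ' (lam k) := fun k => by
    by_cases hk : η k = 0
    · simp [hqdef, hk]
    · obtain ⟨h1, h2⟩ := hηs k (subset_tsupport _ hk)
      have hs := (hlam k h1 h2).2
      have hs' : ∑ i, (W i k : ℂ) * (fderiv ℝ lam k (momBasis i) : ℂ) = 1 := by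
        exact_mod_cast congrArg ((↑) : ℝ → ℂ) hs
      calc _ = ∑ i, ((η k : ℂ) ^ 2 * κ k * w k * φ' (lam k)) *
            ((W i k : ℂ) * (fderiv ℝ lam k (momBasis i) : ℂ)) := by
            refine Finset.sum_congr rfl fun i _ => ?_
            rw [fderiv_comp_real_apply (hφ' _) ((hlam k h1 h2).1.differentiableAt one_ne_zero)]
            simp only [hqdef]; ring
        _ = _ := by rw [← Finset.mul_sum, hs', mul_one]
  simp only [hL] at hibp
  rw [hibp, norm_neg, ← integral_const_mul]
  refine norm_integral_le_of_norm_le (hGint.const_mul _) (Eventually.of_forall fun k => ?_)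
  calc ‖∑ i, fderiv ℝ (q i) k (momBasis i) * φ (lam k)‖
      ≤ ∑ i : Fin d, (K + 2 * K ^ 2) * (η k * (‖k - c‖ ^ (p - 1) * ‖w k‖ +
        ‖k - c‖ ^ p * ‖fderiv ℝ w k‖)) * ‖φ (lam k)‖ := by
        refine norm_sum_le_of_le _ fun i _ => ?_
        rw [norm_mul]
        gcongr
        exact (norm_fderiv_momBasis_le _ i).trans (hqd i k)
    _ = _ := by
      rw [Finset.sum_const, Finset.card_univ, Fintype.card_fin, nsmul_eq_mul]; ring

/-- The cutoff is a fixed profile of `‖k - c‖² / t`. Its derivative vanishes for `‖k - c‖² > t`, and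
for `‖k - c‖² ≤ t` it is at most a constant times `‖k - c‖ / t`. Multiplying by `‖k - c‖` therefore
gives a bound independent of `t`, which is essential since `t` will be `|Im z|`. -/
theorem exists_cutoff (c : Mom d) : ∃ K : ℝ, 0 ≤ K ∧ ∀ t : ℝ, 0 < t → ∃ θ : Mom d → ℝ,
    ContDiff ℝ 1 θ ∧ (∀ k, 0 ≤ θ k) ∧ (∀ k, θ k ≤ 1) ∧ (∀ k, ‖k - c‖ ^ 2 ≤ t / 2 → θ k = 0) ∧
      (∀ k, t ≤ ‖k - c‖ ^ 2 → θ k = 1) ∧ ∀ k, ‖fderiv ℝ θ k‖ * ‖k - c‖ ≤ K := by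
  have hT : ContDiff ℝ 1 Real.smoothTransition := Real.smoothTransition.contDiff
  obtain ⟨K, hK⟩ := (isCompact_Icc (a := (-1 : ℝ)) (b := 1)).exists_bound_of_continuousOn
    (hT.continuous_deriv le_rfl).continuousOn
  have hK0 : 0 ≤ K := (norm_nonneg _).trans (hK 0 (by norm_num))
  refine ⟨4 * K, by positivity, fun t ht => ?_⟩
  have hN : ContDiff ℝ 1 fun k : Mom d => 2 * ‖k - c‖ ^ 2 / t - 1 :=
    (((contDiff_id.sub contDiff_const).norm_sq ℝ).const_smul (2 : ℝ)).div_const t |>.sub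
      contDiff_const
  refine ⟨fun k => Real.smoothTransition (2 * ‖k - c‖ ^ 2 / t - 1), hT.comp hN,
    fun k => Real.smoothTransition.nonneg _, fun k => Real.smoothTransition.le_one _,
    fun k hk => Real.smoothTransition.zero_of_nonpos ?_,
    fun k hk => Real.smoothTransition.one_of_one_le ?_, fun k => ?_⟩
  · rw [sub_nonpos, div_le_one ht]; linarith
  · rw [le_sub_iff_add_le, le_div_iff₀ ht]; linarith
  · rcases lt_or_ge t (‖k - c‖ ^ 2) with h | h
    · have : (fun k => Real.smoothTransition (2 * ‖k - c‖ ^ 2 / t - 1)) =ᶠ[𝓝 k] fun _ => 1 := by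
        have hc : Continuous fun k : Mom d => ‖k - c‖ ^ 2 :=
          (continuous_id.sub continuous_const).norm.pow 2
        filter_upwards [hc.continuousAt.eventually_const_lt h] with x hx
        refine Real.smoothTransition.one_of_one_le ?_
        rw [le_sub_iff_add_le, le_div_iff₀ ht]; linarith
      rw [this.fderiv_eq]
      simp only [fderiv_const_apply, norm_zero, zero_mul]
      positivity
    · have h1 : HasFDerivAt (fun k : Mom d => 2 * ‖k - c‖ ^ 2 / t - 1)
          ((4 / t) • innerSL ℝ (k - c)) k := by
        have := (((((hasFDerivAt_id k).sub_const c).norm_sq).const_mul 2).mul_const t⁻¹).sub_const 1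
        simp only [← div_eq_mul_inv] at this
        refine this.congr_fderiv ?_
        ext x
        simp
        ring
      have h2 : HasFDerivAt (fun k => Real.smoothTransition (2 * ‖k - c‖ ^ 2 / t - 1)) _ k :=
        ((hT.differentiable one_ne_zero _).hasDerivAt).comp_hasFDerivAt k h1
      rw [h2.fderiv, norm_smul, norm_smul, innerSL_apply_norm]
      have h3 : ‖deriv Real.smoothTransition (2 * ‖k - c‖ ^ 2 / t - 1)‖ ≤ K := by
        refine hK _ ⟨?_, ?_⟩
        · have : 0 ≤ 2 * ‖k - c‖ ^ 2 / t := by positivity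
          linarith
        · rw [sub_le_iff_le_add, div_le_iff₀ ht]; linarith
      have h4 : ‖4 / t‖ * ‖k - c‖ * ‖k - c‖ ≤ 4 := by
        rw [Real.norm_of_nonneg (by positivity), mul_assoc, ← pow_two, div_mul_eq_mul_div,
          div_le_iff₀ ht]
        linarith
      calc _ = ‖deriv Real.smoothTransition (2 * ‖k - c‖ ^ 2 / t - 1)‖ *
            (‖4 / t‖ * ‖k - c‖ * ‖k - c‖) := by ring
        _ ≤ K * 4 := by gcongr
        _ = _ := by ring

end LAP

/-! ### Weighted local energy and Young's inequality on the outer shell. -/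

namespace LAP

theorem integrableOn_norm_sub_rpow (c : Mom 3) (r : ℝ) {s : ℝ} (hs : -3 < s) :
    IntegrableOn (fun k : Mom 3 => ‖k - c‖ ^ s) (Metric.ball c r) := by
  have h0 : IntegrableOn (fun k : Mom 3 => ‖k‖ ^ s) (Metric.ball 0 r) := by
    rw [integrableOn_fun_norm_addHaar (μ := volume) (f := fun y : ℝ => y ^ s)]
    have h1 : IntegrableOn (fun y : ℝ => y ^ (s + 2)) (Ioo 0 r) := by
      rcases le_or_gt r 0 with hr | hr
      · simp [Ioo_eq_empty (not_lt.2 hr)]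
      · exact (intervalIntegral.integrableOn_Ioo_rpow_iff hr).2 (by linarith)
    refine h1.congr_fun (fun y hy => ?_) measurableSet_Ioo
    simp [Real.rpow_add hy.1, mul_comm]
  have h2 := (measurePreserving_sub_right volume c).integrableOn_comp_preimage
    (MeasurableEquiv.subRight c).measurableEmbedding (f := fun k : Mom 3 => ‖k‖ ^ s)
    (s := Metric.ball 0 r)
  have h3 : (fun x : Mom 3 => x - c) ⁻¹' Metric.ball 0 r = Metric.ball c r := by
    ext x; simp [dist_eq_norm]
  rw [h3] at h2
  exact h2.2 h0

theorem integrable_mul_of_tsupport {d : ℕ} {f h : Mom d → ℂ} (hf : Continuous f)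
    (hfc : HasCompactSupport f) (hh : ∀ x ∈ tsupport f, ContinuousAt h x) :
    Integrable fun x => f x * h x :=
  (continuous_mul_of_tsupport hf hh).integrable_of_hasCompactSupport hfc.mul_right

theorem aestronglyMeasurable_mul_of_tsupport {d : ℕ} {c : Mom d} {f h : Mom d → ℂ}
    (hf : Continuous f) (hh : ∀ x ∈ tsupport f, x ≠ c → ContinuousAt h x) [NeZero d] :
    AEStronglyMeasurable (fun x => f x * h x) volume := by
  have hm : MeasurableSet (tsupport f \ {c}) :=
    (isClosed_tsupport f).measurableSet.diff (measurableSet_singleton c)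
  have h1 : AEStronglyMeasurable ((tsupport f \ {c}).indicator fun x => f x * h x) volume := by
    rw [aestronglyMeasurable_indicator_iff hm]
    refine ContinuousOn.aestronglyMeasurable (fun x hx => ?_) hm
    exact (hf.continuousAt.mul (hh x hx.1 hx.2)).continuousWithinAt
  refine h1.congr ?_
  have : ∀ᵐ x : Mom d, x ≠ c := by
    have : Nontrivial (Mom d) := by
      have : Nonempty (Fin d) := ⟨0⟩
      infer_instance
    simp [ae_iff]
  filter_upwards [this] with x hx
  by_cases hxf : x ∈ tsupport f
  · rw [indicator_of_mem (show x ∈ tsupport f \ {c} from ⟨hxf, hx⟩)]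
  · rw [indicator_of_notMem (fun h => hxf h.1), image_eq_zero_of_notMem_tsupport hxf, zero_mul]

/-- The density of the scale invariant local energy. -/
noncomputable def localDensity {d : ℕ} (β : ℝ) (c : Mom d) (u : Mom d → ℂ) (k : Mom d) : ℝ :=
  ‖k - c‖ ^ (-2 - 2 * β) * ‖u k‖ ^ 2 + ‖k - c‖ ^ (-2 * β) * ‖fderiv ℝ u k‖ ^ 2

/-- `∫ |u|² |k - c|^(-2 - 2β) + |Du|² |k - c|^(-2β)` over the ball of radius `r` around `c`. -/
noncomputable def localEnergy {d : ℕ} (β : ℝ) (c : Mom d) (r : ℝ) (u : Mom d → ℂ) : ℝ :=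
  ∫ k in Metric.ball c r, localDensity β c u k

theorem localDensity_nonneg {d : ℕ} (β : ℝ) (c : Mom d) (u : Mom d → ℂ) (k : Mom d) :
    0 ≤ localDensity β c u k := by unfold localDensity; positivity

theorem localEnergy_nonneg {d : ℕ} (β : ℝ) (c : Mom d) (r : ℝ) (u : Mom d → ℂ) :
    0 ≤ localEnergy β c r u := integral_nonneg fun k => localDensity_nonneg β c u k

theorem integrableOn_norm_sub_rpow_mul (c : Mom 3) (r : ℝ) {s : ℝ} (hs : -3 < s)
    {f : Mom 3 → ℝ} (hf : Continuous f) :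
    IntegrableOn (fun k : Mom 3 => ‖k - c‖ ^ s * f k) (Metric.ball c r) :=
  (integrableOn_norm_sub_rpow c r hs).mul_continuousOn_of_subset hf.continuousOn
    measurableSet_ball (isCompact_closedBall c r) Metric.ball_subset_closedBall

theorem integrableOn_localDensity {β : ℝ} (hβ0 : 0 < β) (hβ : β < 1 / 2) (c : Mom 3) (r : ℝ)
    {u : Mom 3 → ℂ} (hu : ContDiff ℝ 1 u) :
    IntegrableOn (localDensity β c u) (Metric.ball c r) :=
  (integrableOn_norm_sub_rpow_mul c r (by linarith) (hu.continuous.norm.pow 2)).add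
    (integrableOn_norm_sub_rpow_mul c r (by linarith)
      ((hu.continuous_fderiv one_ne_zero).norm.pow 2))

theorem IsSym.norm_sub_rpow {d : ℕ} (c : Mom d) (s : ℝ) :
    IsSym c s (fun k => ‖k - c‖ ^ s) := by
  have h1 : IsSym c 1 (fun k : Mom d => ‖k - c‖) := by
    refine ⟨1, ?_⟩
    filter_upwards [eventually_norm_sub_pos c] with k hk
    refine ⟨?_, by simp, ?_⟩
    · exact (contDiffAt_norm ℝ (norm_pos_iff.1 hk)).comp k (contDiffAt_id.sub contDiffAt_const)
    · have : LipschitzWith 1 fun k : Mom d => ‖k - c‖ :=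
        LipschitzWith.of_dist_le_mul fun x y => by
          simpa [Real.dist_eq, dist_eq_norm] using abs_norm_sub_norm_le (x - c) (y - c)
      simpa using norm_fderiv_le_of_lipschitz ℝ this (x₀ := k)
  have := h1.rpow one_pos (Eventually.of_forall fun k => by simp) s
  simpa using this

theorem eventually_nhdsNE_ball {d : ℕ} {c : Mom d} {P : Mom d → Prop}
    (h : ∀ᶠ k in 𝓝[≠] c, P k) : ∃ R > 0, ∀ k, 0 < ‖k - c‖ → ‖k - c‖ < R → P k := by
  rw [eventually_nhdsWithin_iff, Metric.eventually_nhds_iff] at h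
  obtain ⟨R, hR, h⟩ := h
  exact ⟨R, hR, fun k hk hkR => h (by simpa [dist_eq_norm] using hkR)
    (by simpa [sub_eq_zero] using norm_pos_iff.1 hk)⟩

/-- Here `N = ‖k - c‖`, `y = |Im z|` and `q = ‖(lam - z)⁻¹‖`. Since `β < 1/2` and `N² ≥ y/2`, one
has `N^{2β-1} ≤ 2 y^{β-1/2}`, hence `N⁻¹ ≤ 2 y^{β-1} · y^{1/2} N^{-2β}`. The factor `y^{1/2} q η
N^{-β} U` squares to the Poisson density, its partner squares to a term of the local energy, and the
arithmetic-geometric mean inequality separates them. -/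
theorem young_shell {N y β q η U V U' V' : ℝ} (hN : 0 < N) (hy : 0 < y) (hβ : β < 1 / 2)
    (hβ0 : 0 < β)
    (hNy : y / 2 ≤ N ^ 2) (hq : 0 ≤ q) (hη : 0 ≤ η) (hU : 0 ≤ U) (hV : 0 ≤ V) (hU' : 0 ≤ U')
    (hV' : 0 ≤ V') :
    q * (η * (N ^ ((-1 : ℝ) - 1) * (U * V) + N ^ (-1 : ℝ) * (U * V' + V * U'))) ≤
      y ^ (β - 1) * (2 * (y * q ^ 2 * η ^ 2 * N ^ (-2 * β) * U ^ 2 +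
        y * q ^ 2 * η ^ 2 * N ^ (-2 * β) * V ^ 2) +
        (N ^ (-2 - 2 * β) * U ^ 2 + N ^ (-2 * β) * U' ^ 2) +
        (N ^ (-2 - 2 * β) * V ^ 2 + N ^ (-2 * β) * V' ^ 2)) := by
  set P := N ^ (-β) with hP
  set Z := y ^ (1 / 2 : ℝ) with hZ
  set T := y ^ (β - 1) with hT
  have hP0 : 0 < P := Real.rpow_pos_of_pos hN _
  have hZ0 : 0 < Z := Real.rpow_pos_of_pos hy _
  have hT0 : 0 < T := Real.rpow_pos_of_pos hy _
  have e1 : N ^ (-2 * β) = P ^ 2 := by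
    rw [hP, ← Real.rpow_natCast, ← Real.rpow_mul hN.le]; congr 1; push_cast; ring
  have e2 : N ^ (-2 - 2 * β) = (P * N⁻¹) ^ 2 := by
    rw [show -2 - 2 * β = -2 * β + (-2 : ℝ) by ring, Real.rpow_add hN, e1, mul_pow, inv_pow,
      Real.rpow_neg hN.le]; norm_num
  have e3 : y = Z ^ 2 := by
    rw [hZ, ← Real.rpow_natCast, ← Real.rpow_mul hy.le]; norm_num
  set M := N ^ (2 * β - 1) with hM
  have hM0 : 0 < M := Real.rpow_pos_of_pos hN _
  have hMle : M ≤ 2 * (T * Z) := by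
    have h1 : M = (N ^ 2) ^ (β - 1 / 2) := by
      rw [hM, ← Real.rpow_natCast N 2, ← Real.rpow_mul hN.le]; congr 1; push_cast; ring
    have h2 : (N ^ 2) ^ (β - 1 / 2) ≤ (y / 2) ^ (β - 1 / 2) :=
      Real.rpow_le_rpow_of_nonpos (by positivity) hNy (by linarith)
    have h3 : (y / 2) ^ (β - 1 / 2) = (T * Z) * (2 : ℝ) ^ (1 / 2 - β) := by
      rw [Real.div_rpow hy.le (by norm_num), hT, hZ, ← Real.rpow_add hy, div_eq_mul_inv,
        ← Real.rpow_neg (by norm_num)]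
      congr 2 <;> ring
    have h4 : (2 : ℝ) ^ (1 / 2 - β) ≤ 2 := by
      calc (2 : ℝ) ^ (1 / 2 - β) ≤ 2 ^ (1 : ℝ) :=
            Real.rpow_le_rpow_of_exponent_le (by norm_num) (by linarith)
        _ = 2 := by norm_num
    rw [h1]
    refine h2.trans ?_
    rw [h3, mul_comm]
    gcongr
  have e4 : N ^ (-1 : ℝ) = P ^ 2 * M := by
    rw [← e1, hM, ← Real.rpow_add hN]; congr 1; ring
  have e5 : N ^ ((-1 : ℝ) - 1) = P * (P * N⁻¹) * M := by
    rw [Real.rpow_sub_one hN.ne', e4]; ring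
  rw [e1, e2, e4, e5]
  have hin : 0 ≤ N⁻¹ := by positivity
  set Q := P * N⁻¹ with hQ
  have hQ0 : 0 ≤ Q := by positivity
  have key : q * (η * (P * Q * M * (U * V) + P ^ 2 * M * (U * V' + V * U'))) ≤
      2 * (T * Z) * (q * η * P * V * (Q * U) + q * η * P * U * (P * V') + q * η * P * V * (P * U')) := by
    calc _ = M * (q * η * P * V * (Q * U) + q * η * P * U * (P * V') + q * η * P * V * (P * U')) := by ring
      _ ≤ _ := by gcongr
  refine key.trans ?_
  set A := q * η * P * V
  set B := q * η * P * U
  have h1 := sq_nonneg (Z * A - Q * U)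
  have h2 := sq_nonneg (Z * B - P * V')
  have h3 := sq_nonneg (Z * A - P * U')
  have hBn : 0 ≤ Z ^ 2 * B ^ 2 := by positivity
  have hQV : 0 ≤ (Q * V) ^ 2 := by positivity
  rw [show y * q ^ 2 * η ^ 2 * P ^ 2 * U ^ 2 = Z ^ 2 * B ^ 2 by rw [e3]; ring,
    show y * q ^ 2 * η ^ 2 * P ^ 2 * V ^ 2 = Z ^ 2 * A ^ 2 by rw [e3]; ring]
  rw [show 2 * (T * Z) * (A * (Q * U) + B * (P * V') + A * (P * U')) =
    T * (2 * Z * (A * (Q * U) + B * (P * V') + A * (P * U'))) by ring]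
  refine mul_le_mul_of_nonneg_left ?_ hT0.le
  nlinarith

end LAP

/-! ### The Poisson density of a band. -/

namespace LAP

/-- The Poisson smoothed spectral density of a band, weighted by `|k - c|^(-2β)`. -/
noncomputable def poissonDensity {d : ℕ} (β : ℝ) (c : Mom d) (lam η : Mom d → ℝ) (z : ℂ)
    (u : Mom d → ℂ) (k : Mom d) : ℝ :=
  |z.im| * ‖((lam k : ℂ) - z)⁻¹‖ ^ 2 * η k ^ 2 * ‖k - c‖ ^ (-2 * β) * ‖u k‖ ^ 2

theorem ofReal_sub_ne_zero {z : ℂ} (hz : z.im ≠ 0) (x : ℝ) : (x : ℂ) - z ≠ 0 := fun h => by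
  have := congrArg Complex.im h
  simp at this
  exact hz this

theorem continuousAt_ofReal_sub_inv {d : ℕ} {z : ℂ} (hz : z.im ≠ 0) {lam : Mom d → ℝ} {k : Mom d}
    (h : ContinuousAt lam k) : ContinuousAt (fun k => ((lam k : ℂ) - z)⁻¹) k := by
  have h1 : ContinuousAt (fun k => (lam k : ℂ) - z) k :=
    (Complex.continuous_ofReal.continuousAt.comp h).sub continuousAt_const
  exact h1.inv₀ (ofReal_sub_ne_zero hz _)

theorem norm_ofReal_sub_inv_sq (z : ℂ) (x : ℝ) :
    ‖((x : ℂ) - z)⁻¹‖ ^ 2 = ((x - z.re) ^ 2 + z.im ^ 2)⁻¹ := by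
  rw [norm_inv, inv_pow, ← Complex.normSq_eq_norm_sq, Complex.normSq_apply]
  congr 1
  simp
  ring

theorem norm_ofReal_sub_inv_le {z : ℂ} (hz : z.im ≠ 0) (x : ℝ) :
    ‖((x : ℂ) - z)⁻¹‖ ≤ |z.im|⁻¹ := by
  rw [norm_inv]
  have h := Complex.abs_im_le_norm ((x : ℂ) - z)
  simp only [Complex.sub_im, Complex.ofReal_im, zero_sub, abs_neg] at h
  exact inv_anti₀ (abs_pos.2 hz) h

theorem norm_fderiv_conj_mul_le {d : ℕ} {u : Mom d → ℂ} (hu : ContDiff ℝ 1 u) (k : Mom d) :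
    ‖fderiv ℝ (fun k => conj (u k) * u k) k‖ ≤ 2 * (‖u k‖ * ‖fderiv ℝ u k‖) := by
  have hd := hu.differentiable one_ne_zero k
  have h1 : HasFDerivAt (fun k => conj (u k))
      ((Complex.conjCLE : ℂ →L[ℝ] ℂ).comp (fderiv ℝ u k)) k :=
    (Complex.conjCLE : ℂ →L[ℝ] ℂ).hasFDerivAt.comp k hd.hasFDerivAt
  have h2 : ‖fderiv ℝ (fun k => conj (u k)) k‖ ≤ ‖fderiv ℝ u k‖ := by
    rw [h1.fderiv]
    refine (ContinuousLinearMap.opNorm_comp_le _ _).trans ?_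
    simp
  refine (norm_fderiv_mul_le h1.differentiableAt hd).trans ?_
  rw [RCLike.norm_conj]
  have := mul_le_mul_of_nonneg_left h2 (norm_nonneg (u k))
  linarith

/-- The kernel `y / ((x - Re z)² + y²)` is the derivative in `x` of `arctan ((x - Re z) / y)`, which
is bounded uniformly in `z`. One integration by parts along `W` therefore loses nothing in `Im z`;
the derivative falls on the weights and on `|u|²`, and the outcome is the local energy. -/
theorem poisson_bound {c : Mom 3} {r K β : ℝ} {lam : Mom 3 → ℝ} {W : Fin 3 → Mom 3 → ℝ}
    {η : Mom 3 → ℝ} (hK : 0 ≤ K) (hβ0 : 0 < β) (hβ : β < 1 / 2)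
    (hlam : ∀ k, 0 < ‖k - c‖ → ‖k - c‖ < r → ContDiffAt ℝ 1 lam k ∧
      ∑ i, W i k * fderiv ℝ lam k (momBasis i) = 1)
    (hκ : ∀ i k, 0 < ‖k - c‖ → ‖k - c‖ < r →
      ContDiffAt ℝ 1 (fun k => (W i k : ℂ) * ((‖k - c‖ ^ (-2 * β) : ℝ) : ℂ)) k ∧
      ‖(W i k : ℂ) * ((‖k - c‖ ^ (-2 * β) : ℝ) : ℂ)‖ ≤ K * ‖k - c‖ ^ (-1 - 2 * β) ∧
      ‖fderiv ℝ (fun k => (W i k : ℂ) * ((‖k - c‖ ^ (-2 * β) : ℝ) : ℂ)) k‖ ≤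
        K * ‖k - c‖ ^ (-1 - 2 * β - 1))
    (hη : ContDiff ℝ 1 η) (hηc : HasCompactSupport η)
    (hηs : ∀ k ∈ tsupport η, 0 < ‖k - c‖ ∧ ‖k - c‖ < r) (hη0 : ∀ k, 0 ≤ η k) (hη1 : ∀ k, η k ≤ 1)
    (hη' : ∀ k, ‖fderiv ℝ η k‖ * ‖k - c‖ ≤ K) {z : ℂ} (hz : z.im ≠ 0) {u : Mom 3 → ℂ}
    (hu : ContDiff ℝ 1 u) :
    Integrable (poissonDensity β c lam η z u) ∧
    ∫ k, poissonDensity β c lam η z u k ≤ 3 * (K + 2 * K ^ 2) * (4 * localEnergy β c r u) := by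
  have hy : 0 < |z.im| := abs_pos.2 hz
  set φ : ℝ → ℂ := fun x => ((Real.arctan ((x - z.re) / |z.im|) : ℝ) : ℂ) with hφdef
  set φ' : ℝ → ℂ := fun x => ((|z.im| * ‖((x : ℂ) - z)⁻¹‖ ^ 2 : ℝ) : ℂ) with hφ'def
  have hφ : ContDiff ℝ 1 φ := Complex.ofRealCLM.contDiff.comp
    (Real.contDiff_arctan.comp ((contDiff_id.sub contDiff_const).div_const _))
  have hφ' : ∀ x, HasDerivAt φ (φ' x) x := fun x => by
    have h1 : HasDerivAt (fun x : ℝ => (x - z.re) / |z.im|) (1 / |z.im|) x :=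
      ((hasDerivAt_id x).sub_const _).div_const _
    have h2 := h1.arctan.ofReal_comp
    refine h2.congr_deriv ?_
    simp only [hφ'def, norm_ofReal_sub_inv_sq]
    congr 1
    rw [← sq_abs z.im]
    field_simp
    ring
  set w : Mom 3 → ℂ := fun k => conj (u k) * u k with hwdef
  have hw : ContDiff ℝ 1 w := (Complex.conjCLE.contDiff.comp hu).mul hu
  have hT := transport_bound hK hlam hκ hη hηc hηs hη0 hη1 hη' hw hφ hφ'
  have hpt : ∀ k, (η k : ℂ) ^ 2 * ((‖k - c‖ ^ (-2 * β) : ℝ) : ℂ) * w k * φ' (lam k) =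
      ((poissonDensity β c lam η z u k : ℝ) : ℂ) := fun k => by
    simp only [hwdef, hφ'def, poissonDensity, Complex.conj_mul']
    push_cast
    ring
  have hηC : ContDiff ℝ 1 fun k => (η k : ℂ) := Complex.ofRealCLM.contDiff.comp hη
  have hηCc : HasCompactSupport fun k => (η k : ℂ) := hηc.comp_left (g := ((↑) : ℝ → ℂ)) (by simp)
  have hηs2 : ∀ k ∈ tsupport (fun k => (η k : ℂ)), 0 < ‖k - c‖ ∧ ‖k - c‖ < r := fun k hk =>
    hηs k (tsupport_comp_subset (g := ((↑) : ℝ → ℂ)) (by simp) η hk)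
  have hint : Integrable (poissonDensity β c lam η z u) := by
    have : Integrable fun k => (η k : ℂ) *
        ((|z.im| * ‖((lam k : ℂ) - z)⁻¹‖ ^ 2 * η k * ‖k - c‖ ^ (-2 * β) * ‖u k‖ ^ 2 : ℝ) : ℂ) := by
      refine integrable_mul_of_tsupport hηC.continuous hηCc fun k hk => ?_
      obtain ⟨h1, h2⟩ := hηs2 k hk
      refine Complex.continuous_ofReal.continuousAt.comp ?_
      refine ContinuousAt.mul (ContinuousAt.mul (ContinuousAt.mul (continuousAt_const.mul ?_)
        hη.continuous.continuousAt) ?_) (hu.continuous.norm.pow 2).continuousAt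
      · exact (continuousAt_ofReal_sub_inv hz (hlam k h1 h2).1.continuousAt).norm.pow 2
      · exact ((continuous_id.sub continuous_const).norm.continuousAt).rpow_const (Or.inl h1.ne')
    refine this.re.congr (Eventually.of_forall fun k => ?_)
    simp only [poissonDensity, RCLike.re_eq_complex_re, Complex.re_ofReal_mul, Complex.ofReal_re]
    ring
  refine ⟨hint, ?_⟩
  have h1 : ∫ k, poissonDensity β c lam η z u k ≤
      ‖∫ k, (η k : ℂ) ^ 2 * ((‖k - c‖ ^ (-2 * β) : ℝ) : ℂ) * w k * φ' (lam k)‖ := by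
    simp only [hpt]
    rw [integral_complex_ofReal, Complex.norm_real]
    exact le_abs_self _
  refine h1.trans (hT.2.trans ?_)
  push_cast
  refine mul_le_mul_of_nonneg_left ?_ (by positivity)
  have h4 : 4 * localEnergy β c r u = ∫ k, (Metric.ball c r).indicator
      (fun k => 4 * localDensity β c u k) k := by
    rw [integral_indicator measurableSet_ball, integral_const_mul]; rfl
  rw [h4]
  refine integral_mono hT.1 ((integrable_indicator_iff measurableSet_ball).2
    ((integrableOn_localDensity hβ0 hβ c r hu).const_mul 4)) fun k => ?_
  by_cases hk : η k = 0
  · simp only [hk, zero_mul, mul_zero]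
    exact indicator_nonneg (fun k _ => mul_nonneg (by norm_num) (localDensity_nonneg _ _ _ _)) k
  · obtain ⟨k1, k2⟩ := hηs k (subset_tsupport _ hk)
    rw [indicator_of_mem (by simpa [dist_eq_norm] using k2)]
    have a1 : ‖φ (lam k)‖ ≤ 2 := by
      simp only [hφdef, Complex.norm_real, Real.norm_eq_abs]
      rw [abs_le]
      have := Real.neg_pi_div_two_lt_arctan ((lam k - z.re) / |z.im|)
      have := Real.arctan_lt_pi_div_two ((lam k - z.re) / |z.im|)
      have := Real.pi_le_four
      constructor <;> linarith
    have a2 : ‖w k‖ = ‖u k‖ ^ 2 := by simp [hwdef, pow_two]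
    have a3 := norm_fderiv_conj_mul_le hu k
    set P := ‖k - c‖ ^ (-β) with hP
    have hP0 : 0 < P := Real.rpow_pos_of_pos k1 _
    have e1 : ‖k - c‖ ^ (-2 * β) = P ^ 2 := by
      rw [hP, ← Real.rpow_natCast, ← Real.rpow_mul k1.le]; congr 1; push_cast; ring
    have e2 : ‖k - c‖ ^ (-1 - 2 * β) = P ^ 2 * ‖k - c‖⁻¹ := by
      rw [← e1, ← Real.rpow_neg_one, ← Real.rpow_add k1]; congr 1; ring
    have e3 : ‖k - c‖ ^ (-1 - 2 * β - 1) = (P * ‖k - c‖⁻¹) ^ 2 := by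
      rw [Real.rpow_sub_one k1.ne', e2]; ring
    have e4 : ‖k - c‖ ^ (-2 - 2 * β) = (P * ‖k - c‖⁻¹) ^ 2 := by rw [← e3]; congr 1; ring
    simp only [localDensity]
    rw [e1, e2, e3, e4, a2]
    set Q := P * ‖k - c‖⁻¹ with hQ
    have hQ0 : 0 ≤ Q := by positivity
    have e5 : P ^ 2 * ‖k - c‖⁻¹ = P * Q := by rw [hQ]; ring
    rw [e5]
    have b1 : η k * (Q ^ 2 * ‖u k‖ ^ 2 + P * Q * ‖fderiv ℝ w k‖) ≤
        1 * (Q ^ 2 * ‖u k‖ ^ 2 + P * Q * (2 * (‖u k‖ * ‖fderiv ℝ u k‖))) := by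
      gcongr
      exact hη1 k
    have b2 := sq_nonneg (Q * ‖u k‖ - P * ‖fderiv ℝ u k‖)
    have hb0 : 0 ≤ η k * (Q ^ 2 * ‖u k‖ ^ 2 + P * Q * ‖fderiv ℝ w k‖) :=
      mul_nonneg (hη0 k) (by positivity)
    -- The constant `4` is `2 · 2`: the arctangent is at most `π/2 ≤ 2`, and `2 Q P ‖u‖ ‖Du‖ ≤ Q²
    -- ‖u‖² + P² ‖Du‖²` doubles the first term.
    calc _ ≤ 2 * (η k * (Q ^ 2 * ‖u k‖ ^ 2 + P * Q * ‖fderiv ℝ w k‖)) := by gcongr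
      _ ≤ _ := by nlinarith [sq_nonneg (P * ‖fderiv ℝ u k‖)]

end LAP

/-! ### The estimate for a single band. -/

namespace LAP

theorem exists_bound_fderiv {d : ℕ} {g : Mom d → ℝ} (hg : ContDiff ℝ 1 g)
    (hgc : HasCompactSupport g) : ∃ K : ℝ, 0 ≤ K ∧ ∀ k, ‖g k‖ ≤ K ∧ ‖fderiv ℝ g k‖ ≤ K := by
  obtain ⟨K, hK⟩ := hgc.exists_bound_of_continuous hg.continuous
  obtain ⟨K', hK'⟩ := (hgc.fderiv (𝕜 := ℝ)).exists_bound_of_continuous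
    (hg.continuous_fderiv one_ne_zero)
  exact ⟨max K K', le_max_of_le_left ((norm_nonneg _).trans (hK 0)), fun k =>
    ⟨(hK k).trans (le_max_left _ _), (hK' k).trans (le_max_right _ _)⟩⟩

/-- A cutoff to the part `√t ≲ |k - c| < r` of the ball, as the square of a smooth function. -/
theorem exists_shell_cutoff (c : Mom 3) {r : ℝ} (hr : 0 < r) : ∃ K : ℝ, 0 ≤ K ∧ ∀ t : ℝ, 0 < t →
    ∃ η : Mom 3 → ℝ, ContDiff ℝ 1 η ∧ HasCompactSupport η ∧
      (∀ k ∈ tsupport η, 0 < ‖k - c‖ ∧ ‖k - c‖ < r) ∧ (∀ k, 0 ≤ η k) ∧ (∀ k, η k ≤ 1) ∧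
      (∀ k, ‖fderiv ℝ η k‖ * ‖k - c‖ ≤ K) ∧ (∀ k, ‖k - c‖ ^ 2 ≤ t / 2 → η k = 0) ∧
      (∀ k, ‖k - c‖ ≤ r / 2 → t ≤ ‖k - c‖ ^ 2 → η k = 1) := by
  -- The bump equals `1` on the ball of radius `r / 2`, where the localisation `g` will be
  -- supported. Hence `g (1 - η²)` lives only where `‖k - c‖² < t`.
  let b : ContDiffBump c := ⟨r / 2, 3 * r / 4, by linarith, by linarith⟩
  have hb : ContDiff ℝ 1 b := b.contDiff
  obtain ⟨Kb, hKb0, hKb⟩ := exists_bound_fderiv hb b.hasCompactSupport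
  obtain ⟨Kθ, hKθ0, hKθ⟩ := exists_cutoff c
  refine ⟨Kθ + Kb * r, by positivity, fun t ht => ?_⟩
  obtain ⟨θ, hθ, hθ0, hθ1, hθz, hθo, hθd⟩ := hKθ t ht
  have hbs : tsupport b = Metric.closedBall c (3 * r / 4) := b.tsupport_eq
  have hsb : tsupport (fun k => b k * θ k) ⊆ Metric.closedBall c (3 * r / 4) :=
    tsupport_mul_subset_left.trans hbs.subset
  refine ⟨fun k => b k * θ k, hb.mul hθ, b.hasCompactSupport.mul_right, fun k hk => ⟨?_, ?_⟩,
    fun k => mul_nonneg b.nonneg (hθ0 k), fun k => mul_le_one₀ b.le_one (hθ0 k) (hθ1 k),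
    fun k => ?_, fun k hk => by simp [hθz k hk], fun k hk hk' => ?_⟩
  · have h1 : tsupport θ ⊆ {k | t / 2 ≤ ‖k - c‖ ^ 2} := by
      refine closure_minimal (fun k hk => ?_)
        (isClosed_le continuous_const ((continuous_id.sub continuous_const).norm.pow 2))
      by_contra h
      exact hk (hθz k (not_le.1 h).le)
    have h2 : t / 2 ≤ ‖k - c‖ ^ 2 := h1 (tsupport_mul_subset_right hk)
    by_contra h3
    have h4 : ‖k - c‖ = 0 := le_antisymm (not_lt.1 h3) (norm_nonneg _)
    rw [h4] at h2
    norm_num at h2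
    linarith
  · have := hsb hk
    rw [Metric.mem_closedBall, dist_eq_norm] at this
    linarith
  · by_cases hk : k ∈ Metric.closedBall c (3 * r / 4)
    · rw [Metric.mem_closedBall, dist_eq_norm] at hk
      have h1 := norm_fderiv_mul_le (hb.differentiable one_ne_zero k)
        (hθ.differentiable one_ne_zero k)
      have h2 : ‖b k‖ ≤ 1 := by rw [Real.norm_of_nonneg b.nonneg]; exact b.le_one
      have h3 : ‖θ k‖ ≤ 1 := by rw [Real.norm_of_nonneg (hθ0 k)]; exact hθ1 k
      calc _ ≤ (‖b k‖ * ‖fderiv ℝ θ k‖ + ‖θ k‖ * ‖fderiv ℝ b k‖) * ‖k - c‖ := by gcongr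
        _ ≤ (1 * ‖fderiv ℝ θ k‖ + 1 * Kb) * ‖k - c‖ := by gcongr; exact (hKb k).2
        _ = ‖fderiv ℝ θ k‖ * ‖k - c‖ + Kb * ‖k - c‖ := by ring
        _ ≤ _ := by gcongr; exacts [hθd k, by linarith]
    · have : fderiv ℝ (fun k => b k * θ k) k = 0 := by
        by_contra h
        exact hk (hsb (tsupport_fderiv_subset ℝ (subset_tsupport _ h)))
      rw [this, norm_zero, zero_mul]; positivity
  · have : b k = 1 := b.one_of_mem_closedBall (by simpa [dist_eq_norm] using hk)
    simp [this, hθo k hk']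

/-- For `N² ≤ y` one has `1 ≤ y^{1+β} N^{-2-2β}`. This converts the trivial resolvent bound `y⁻²`
into `y^{β-1}` times the weight of the local energy. -/
theorem inner_shell_bound {N y β U V : ℝ} (hN : 0 < N) (hy : 0 < y) (hβ0 : 0 < β)
    (hNy : N ^ 2 ≤ y) :
    (y⁻¹) ^ 2 * (U * V) ≤ y ^ (β - 1) * (N ^ (-2 - 2 * β) * U ^ 2 + N ^ (-2 - 2 * β) * V ^ 2) := by
  have h1 : 1 ≤ y ^ (1 + β) * N ^ (-2 - 2 * β) := by
    have h2 : (N ^ 2) ^ (1 + β) = N ^ (2 + 2 * β) := by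
      rw [← Real.rpow_natCast N 2, ← Real.rpow_mul hN.le]; congr 1; push_cast; ring
    have h3 : (N ^ 2) ^ (1 + β) ≤ y ^ (1 + β) :=
      Real.rpow_le_rpow (by positivity) hNy (by linarith)
    have h4 : N ^ (-2 - 2 * β) = (N ^ (2 + 2 * β))⁻¹ := by
      rw [← Real.rpow_neg hN.le]; congr 1; ring
    rw [h4, ← div_eq_mul_inv, le_div_iff₀ (by positivity), one_mul, ← h2]
    exact h3
  have h2 : y ^ (β - 1) = (y⁻¹) ^ 2 * y ^ (1 + β) := by
    rw [show β - 1 = -2 + (1 + β) by ring, Real.rpow_add hy, Real.rpow_neg hy.le]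
    norm_num
  have h3 : U * V ≤ U ^ 2 + V ^ 2 := by nlinarith [sq_nonneg (U - V), sq_nonneg (U + V)]
  rw [h2, mul_assoc]
  refine mul_le_mul_of_nonneg_left ?_ (by positivity)
  calc U * V ≤ 1 * (U ^ 2 + V ^ 2) := by linarith
    _ ≤ (y ^ (1 + β) * N ^ (-2 - 2 * β)) * (U ^ 2 + V ^ 2) := by gcongr
    _ = _ := by ring

set_option maxHeartbeats 1000000 in
/-- The contribution of one band near `c` to the derivative of the damped resolvent. -/
theorem band_estimate {c : Mom 3} {lam : Mom 3 → ℝ} (hlam : IsLocalBand c lam) {p : Mom 3 → ℂ}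
    (hp : IsSym c 0 p) {β : ℝ} (hβ0 : 0 < β) (hβ : β < 1 / 2) :
    ∃ R > 0, ∀ r, 0 < r → r ≤ R → ∀ g : Mom 3 → ℝ, ContDiff ℝ 1 g →
      tsupport g ⊆ Metric.ball c (r / 2) → ∃ C, 0 ≤ C ∧ ∀ z : ℂ, z.im ≠ 0 → ∀ u v : Mom 3 → ℂ,
        ContDiff ℝ 1 u → ContDiff ℝ 1 v →
        Integrable (fun k => (g k : ℂ) * p k * (u k * v k) * (((lam k : ℂ) - z)⁻¹) ^ 2) ∧
        ‖∫ k, (g k : ℂ) * p k * (u k * v k) * (((lam k : ℂ) - z)⁻¹) ^ 2‖ ≤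
          C * |z.im| ^ (β - 1) * (localEnergy β c r u + localEnergy β c r v) := by
  obtain ⟨W, hW, hlamW⟩ := hlam
  -- Two integrations by parts use two coefficients: `W ‖k - c‖^{-2β}` for the Poisson density and
  -- `W p` for the main term.
  have hA : ∀ i, IsSym c (-1 - 2 * β) (fun k => (W i k : ℂ) * ((‖k - c‖ ^ (-2 * β) : ℝ) : ℂ)) :=
    fun i => ((hW i).ofReal.mul (IsSym.norm_sub_rpow c (-2 * β)).ofReal).mono (by linarith)
  have hB : ∀ i, IsSym c (-1) (fun k => (W i k : ℂ) * p k) :=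
    fun i => ((hW i).ofReal.mul hp).mono (by linarith)
  choose KA hKA0 hKA using fun i => (hA i).exists_nonneg
  choose KB hKB0 hKB using fun i => (hB i).exists_nonneg
  obtain ⟨Kp, hKp0, hKp⟩ := hp.exists_nonneg
  obtain ⟨R, hR, hall⟩ := eventually_nhdsNE_ball (hlamW.and ((eventually_all.2 hKA).and
    ((eventually_all.2 hKB).and hKp)))
  refine ⟨R, hR, fun r hr hrR g hg hgs => ?_⟩
  have hgc : HasCompactSupport g := (isCompact_closedBall c (r / 2)).of_isClosed_subset
    (isClosed_tsupport g) (hgs.trans Metric.ball_subset_closedBall)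
  obtain ⟨Kg, hKg0, hKg⟩ := exists_bound_fderiv hg hgc
  obtain ⟨Kη, hKη0, hKη⟩ := exists_shell_cutoff c hr
  -- One constant for the cutoff and for both families. The factor `1 + r` accounts for the
  -- derivative falling on `g`: that term is only of order `-1`, which is at most `r` times order
  -- `-2` inside the ball.
  set K : ℝ := Kη + ∑ i, KA i + Kg * (∑ i, KB i) * (1 + r) with hKdef
  have hsA : ∀ i, KA i ≤ ∑ i, KA i := fun i =>
    Finset.single_le_sum (fun j _ => hKA0 j) (Finset.mem_univ i)
  have hsB : ∀ i, KB i ≤ ∑ i, KB i := fun i =>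
    Finset.single_le_sum (fun j _ => hKB0 j) (Finset.mem_univ i)
  have hSA0 : 0 ≤ ∑ i, KA i := Finset.sum_nonneg fun i _ => hKA0 i
  have hSB0 : 0 ≤ ∑ i, KB i := Finset.sum_nonneg fun i _ => hKB0 i
  have hT0 : 0 ≤ Kg * (∑ i, KB i) * (1 + r) := by positivity
  have hK0 : 0 ≤ K := by positivity
  have hlam' : ∀ k, 0 < ‖k - c‖ → ‖k - c‖ < r → ContDiffAt ℝ 1 lam k ∧
      ∑ i, W i k * fderiv ℝ lam k (momBasis i) = 1 := fun k h1 h2 =>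
    (hall k h1 (h2.trans_le hrR)).1
  have hA' : ∀ i k, 0 < ‖k - c‖ → ‖k - c‖ < r →
      ContDiffAt ℝ 1 (fun k => (W i k : ℂ) * ((‖k - c‖ ^ (-2 * β) : ℝ) : ℂ)) k ∧
      ‖(W i k : ℂ) * ((‖k - c‖ ^ (-2 * β) : ℝ) : ℂ)‖ ≤ K * ‖k - c‖ ^ (-1 - 2 * β) ∧
      ‖fderiv ℝ (fun k => (W i k : ℂ) * ((‖k - c‖ ^ (-2 * β) : ℝ) : ℂ)) k‖ ≤
        K * ‖k - c‖ ^ (-1 - 2 * β - 1) := fun i k h1 h2 => by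
    obtain ⟨a1, a2, a3⟩ := (hall k h1 (h2.trans_le hrR)).2.1 i
    have : KA i ≤ K := by have := hsA i; linarith
    exact ⟨a1, a2.trans (by gcongr), a3.trans (by gcongr)⟩
  have hB' : ∀ i k, 0 < ‖k - c‖ → ‖k - c‖ < r →
      ContDiffAt ℝ 1 (fun k => (W i k : ℂ) * ((g k : ℂ) * p k)) k ∧
      ‖(W i k : ℂ) * ((g k : ℂ) * p k)‖ ≤ K * ‖k - c‖ ^ (-1 : ℝ) ∧
      ‖fderiv ℝ (fun k => (W i k : ℂ) * ((g k : ℂ) * p k)) k‖ ≤ K * ‖k - c‖ ^ ((-1 : ℝ) - 1) :=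
      fun i k h1 h2 => by
    obtain ⟨a1, a2, a3⟩ := (hall k h1 (h2.trans_le hrR)).2.2.1 i
    have hgC : ContDiff ℝ 1 fun k => (g k : ℂ) := Complex.ofRealCLM.contDiff.comp hg
    have hfun : (fun k => (W i k : ℂ) * ((g k : ℂ) * p k)) =
        fun k => (g k : ℂ) * ((W i k : ℂ) * p k) := by funext k; ring
    have hg1 : ‖(g k : ℂ)‖ ≤ Kg := by rw [Complex.norm_real]; exact (hKg k).1
    have hg2 : ‖fderiv ℝ (fun k => (g k : ℂ)) k‖ ≤ Kg := by
      have : fderiv ℝ (fun k => (g k : ℂ)) k = Complex.ofRealCLM.comp (fderiv ℝ g k) :=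
        (Complex.ofRealCLM.hasFDerivAt.comp k
          (hg.differentiable one_ne_zero k).hasFDerivAt).fderiv
      rw [this]
      refine (Complex.ofRealCLM.opNorm_comp_le _).trans ?_
      simpa using (hKg k).2
    have hKgB : Kg * KB i * (1 + r) ≤ K := by
      have h5 : Kg * KB i * (1 + r) ≤ Kg * (∑ i, KB i) * (1 + r) := by gcongr; exact hsB i
      linarith
    have hKgB' : Kg * KB i ≤ Kg * KB i * (1 + r) :=
      le_mul_of_one_le_right (mul_nonneg hKg0 (hKB0 i)) (by linarith)
    refine ⟨hfun ▸ hgC.contDiffAt.mul a1, ?_, ?_⟩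
    · rw [show (W i k : ℂ) * ((g k : ℂ) * p k) = (g k : ℂ) * ((W i k : ℂ) * p k) by ring, norm_mul]
      calc _ ≤ Kg * (KB i * ‖k - c‖ ^ (-1 : ℝ)) := by gcongr
        _ = (Kg * KB i) * ‖k - c‖ ^ (-1 : ℝ) := by ring
        _ ≤ _ := by gcongr; linarith
    · rw [hfun]
      have h6 := norm_fderiv_mul_le (hgC.differentiable one_ne_zero k)
        (a1.differentiableAt one_ne_zero)
      have h7 : ‖k - c‖ ^ (-1 : ℝ) = ‖k - c‖ * ‖k - c‖ ^ ((-1 : ℝ) - 1) := by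
        rw [Real.rpow_sub_one h1.ne']; field_simp
      calc _ ≤ _ := h6
        _ ≤ Kg * (KB i * ‖k - c‖ ^ ((-1 : ℝ) - 1)) + (KB i * ‖k - c‖ ^ (-1 : ℝ)) * Kg := by
          gcongr
          exact mul_nonneg (hKB0 i) (by positivity)
        _ = Kg * KB i * (1 + ‖k - c‖) * ‖k - c‖ ^ ((-1 : ℝ) - 1) := by rw [h7]; ring
        _ ≤ Kg * KB i * (1 + r) * ‖k - c‖ ^ ((-1 : ℝ) - 1) := by
          gcongr
          exact mul_nonneg hKg0 (hKB0 i)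
        _ ≤ _ := by gcongr
  set D : ℝ := 3 * (K + 2 * K ^ 2) with hD
  have hD0 : 0 ≤ D := by positivity
  -- `D` is the constant of `transport_bound` in dimension three. The outer part uses it once for
  -- the main term, and `8 * D` comes from twice the Poisson bound `D * 4`; the summand `1` is the
  -- energy left by Young's inequality. `Kg * Kp` belongs to the inner part.
  refine ⟨D * (8 * D + 1) + Kg * Kp, by positivity, fun z hz u v hu hv => ?_⟩
  have hy : 0 < |z.im| := abs_pos.2 hz
  obtain ⟨η, hη, hηc, hηs, hη0, hη1, hηd, hηz, hηo⟩ := hKη |z.im| hy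
  have hηK : ∀ k, ‖fderiv ℝ η k‖ * ‖k - c‖ ≤ K := fun k => (hηd k).trans (by linarith)
  obtain ⟨hSu, hSu'⟩ := poisson_bound hK0 hβ0 hβ hlam' hA' hη hηc hηs hη0 hη1 hηK hz hu
  obtain ⟨hSv, hSv'⟩ := poisson_bound hK0 hβ0 hβ hlam' hA' hη hηc hηs hη0 hη1 hηK hz hv
  set T := |z.im| ^ (β - 1) with hT
  have hTpos : 0 < T := Real.rpow_pos_of_pos hy _
  set Eu : Mom 3 → ℝ := (Metric.ball c r).indicator (localDensity β c u) with hEu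
  set Ev : Mom 3 → ℝ := (Metric.ball c r).indicator (localDensity β c v) with hEv
  have hEui : Integrable Eu :=
    (integrable_indicator_iff measurableSet_ball).2 (integrableOn_localDensity hβ0 hβ c r hu)
  have hEvi : Integrable Ev :=
    (integrable_indicator_iff measurableSet_ball).2 (integrableOn_localDensity hβ0 hβ c r hv)
  have hEuI : ∫ k, Eu k = localEnergy β c r u := integral_indicator measurableSet_ball
  have hEvI : ∫ k, Ev k = localEnergy β c r v := integral_indicator measurableSet_ball
  have hlc : ∀ k, 0 < ‖k - c‖ → ‖k - c‖ < r → ContinuousAt (fun k => ((lam k : ℂ) - z)⁻¹) k :=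
    fun k h1 h2 => continuousAt_ofReal_sub_inv hz (hlam' k h1 h2).1.continuousAt
  have hpc : ∀ k, 0 < ‖k - c‖ → ‖k - c‖ < r → ContinuousAt p k :=
    fun k h1 h2 => (hall k h1 (h2.trans_le hrR)).2.2.2.1.continuousAt
  have hgC : Continuous fun k => (g k : ℂ) := Complex.continuous_ofReal.comp hg.continuous
  have hηC : Continuous fun k => (η k : ℂ) := Complex.continuous_ofReal.comp hη.continuous
  -- the outer part
  set O : Mom 3 → ℂ := fun k => (η k : ℂ) ^ 2 * ((g k : ℂ) * p k) * (u k * v k) *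
    (-(((lam k : ℂ) - z)⁻¹) ^ 2) with hO
  have hOi : Integrable O := by
    have : Integrable fun k => (η k : ℂ) * ((η k : ℂ) * ((g k : ℂ) * p k) * (u k * v k) *
        (-(((lam k : ℂ) - z)⁻¹) ^ 2)) := by
      refine integrable_mul_of_tsupport hηC (hηc.comp_left (g := ((↑) : ℝ → ℂ)) (by simp))
        fun k hk => ?_
      obtain ⟨h1, h2⟩ := hηs k (tsupport_comp_subset (g := ((↑) : ℝ → ℂ)) (by simp) η hk)
      exact ((hηC.continuousAt.mul (hgC.continuousAt.mul (hpc k h1 h2))).mul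
        (hu.continuous.mul hv.continuous).continuousAt).mul ((hlc k h1 h2).pow 2).neg
    refine this.congr (Eventually.of_forall fun k => ?_)
    simp only [hO]; ring
  have hφ : ContDiff ℝ 1 fun x : ℝ => ((x : ℂ) - z)⁻¹ :=
    (Complex.ofRealCLM.contDiff.sub contDiff_const).inv fun x => ofReal_sub_ne_zero hz x
  have hφ' : ∀ x : ℝ, HasDerivAt (fun x : ℝ => ((x : ℂ) - z)⁻¹) (-(((x : ℂ) - z)⁻¹) ^ 2) x :=
    fun x => by
    have h1 : HasDerivAt (fun x : ℝ => (x : ℂ) - z) 1 x :=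
      ((hasDerivAt_id x).ofReal_comp).sub_const z
    refine (h1.inv (ofReal_sub_ne_zero hz x)).congr_deriv ?_
    rw [inv_pow]; ring
  -- Integration by parts with `φ x = (x - z)⁻¹` replaces the squared resolvent by its first power;
  -- `young_shell` then trades this power for the Poisson densities of `u` and `v`.
  have hOb : ‖∫ k, O k‖ ≤ D * (T * (8 * D + 1) *
      (localEnergy β c r u + localEnergy β c r v)) := by
    obtain ⟨hTi, hTb⟩ := transport_bound hK0 hlam' hB' hη hηc hηs hη0 hη1 hηK (hu.mul hv) hφ hφ'
    refine hTb.trans ?_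
    rw [hD]
    push_cast
    refine mul_le_mul_of_nonneg_left ?_ hD0
    have hpt : ∀ k, ‖((lam k : ℂ) - z)⁻¹‖ * (η k * (‖k - c‖ ^ ((-1 : ℝ) - 1) * ‖u k * v k‖ +
        ‖k - c‖ ^ (-1 : ℝ) * ‖fderiv ℝ (fun k => u k * v k) k‖)) ≤
        T * (2 * (poissonDensity β c lam η z u k + poissonDensity β c lam η z v k) +
          Eu k + Ev k) := fun k => by
      have hu0 : 0 ≤ Eu k := indicator_nonneg (fun k _ => localDensity_nonneg _ _ _ k) k
      have hv0 : 0 ≤ Ev k := indicator_nonneg (fun k _ => localDensity_nonneg _ _ _ k) k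
      by_cases hk : η k = 0
      · simp only [hk, poissonDensity]
        norm_num
        positivity
      · obtain ⟨h1, h2⟩ := hηs k (subset_tsupport _ hk)
        have h3 : |z.im| / 2 ≤ ‖k - c‖ ^ 2 := by
          by_contra h
          exact hk (hηz k (not_le.1 h).le)
        have h4 := young_shell h1 hy hβ hβ0 h3 (norm_nonneg ((lam k : ℂ) - z)⁻¹) (hη0 k)
          (norm_nonneg (u k)) (norm_nonneg (v k)) (norm_nonneg (fderiv ℝ u k))
          (norm_nonneg (fderiv ℝ v k))
        have h5 := norm_fderiv_mul_le (hu.differentiable one_ne_zero k)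
          (hv.differentiable one_ne_zero k)
        have hmem : k ∈ Metric.ball c r := by simpa [dist_eq_norm] using h2
        refine le_trans ?_ (h4.trans (le_of_eq ?_))
        · rw [norm_mul]
          have := hη0 k
          gcongr
        · simp only [hEu, hEv, indicator_of_mem hmem, poissonDensity, localDensity]
          ring
    have i1 : Integrable fun k => poissonDensity β c lam η z u k + poissonDensity β c lam η z v k :=
      hSu.add hSv
    have i2 : Integrable fun k => 2 * (poissonDensity β c lam η z u k +
        poissonDensity β c lam η z v k) := i1.const_mul 2
    have i3 : Integrable fun k => 2 * (poissonDensity β c lam η z u k +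
        poissonDensity β c lam η z v k) + Eu k := i2.add hEui
    have hRi : Integrable fun k => T * (2 * (poissonDensity β c lam η z u k +
        poissonDensity β c lam η z v k) + Eu k + Ev k) :=
      (i3.add hEvi).const_mul T
    refine (integral_mono hTi hRi hpt).trans ?_
    rw [integral_const_mul, integral_add i3 hEvi, integral_add i2 hEui, integral_const_mul, integral_add hSu hSv,
      hEuI, hEvI]
    have : 2 * ((∫ k, poissonDensity β c lam η z u k) + ∫ k, poissonDensity β c lam η z v k) +
        localEnergy β c r u + localEnergy β c r v ≤
        (8 * D + 1) * (localEnergy β c r u + localEnergy β c r v) := by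
      have h1 : ∫ k, poissonDensity β c lam η z u k ≤ D * (4 * localEnergy β c r u) := hSu'
      have h2 : ∫ k, poissonDensity β c lam η z v k ≤ D * (4 * localEnergy β c r v) := hSv'
      nlinarith
    rw [mul_assoc]
    exact mul_le_mul_of_nonneg_left this hTpos.le
  -- the inner part
  set I : Mom 3 → ℂ := fun k => (((g k * (1 - η k ^ 2) : ℝ) : ℂ)) * (p k * (u k * v k) *
    (((lam k : ℂ) - z)⁻¹) ^ 2) with hI
  have hIm : AEStronglyMeasurable I volume := by
    refine aestronglyMeasurable_mul_of_tsupport (c := c) ?_ fun k hk hkc => ?_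
    · exact Complex.continuous_ofReal.comp
        (hg.continuous.mul (continuous_const.sub (hη.continuous.pow 2)))
    · have h0 : k ∈ tsupport g := tsupport_mul_subset_left
        (tsupport_comp_subset (g := ((↑) : ℝ → ℂ)) (by simp) (fun k => g k * (1 - η k ^ 2)) hk)
      have h1 : 0 < ‖k - c‖ := norm_pos_iff.2 (sub_ne_zero.2 hkc)
      have h2 : ‖k - c‖ < r / 2 := by simpa [dist_eq_norm] using hgs h0
      have h3 : ‖k - c‖ < r := by linarith
      exact ((hpc k h1 h3).mul (hu.continuous.mul hv.continuous).continuousAt).mul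
        ((hlc k h1 h3).pow 2)
  have hIb : ∀ᵐ k, ‖I k‖ ≤ Kg * Kp * (T * (Eu k + Ev k)) := by
    have hne : ∀ᵐ k : Mom 3, k ≠ c := by simp [ae_iff]
    filter_upwards [hne] with k hkc
    have hu0 : 0 ≤ Eu k := indicator_nonneg (fun k _ => localDensity_nonneg _ _ _ k) k
    have hv0 : 0 ≤ Ev k := indicator_nonneg (fun k _ => localDensity_nonneg _ _ _ k) k
    by_cases hk : g k * (1 - η k ^ 2) = 0
    · simp only [hI, hk]
      norm_num
      positivity
    · have h0 : k ∈ tsupport g := subset_tsupport _ (left_ne_zero_of_mul hk)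
      have h1 : 0 < ‖k - c‖ := norm_pos_iff.2 (sub_ne_zero.2 hkc)
      have h2 : ‖k - c‖ < r / 2 := by simpa [dist_eq_norm] using hgs h0
      have h3 : ‖k - c‖ < r := by linarith
      have hmem : k ∈ Metric.ball c r := by simpa [dist_eq_norm] using h3
      have h4 : ‖k - c‖ ^ 2 ≤ |z.im| := by
        by_contra h
        exact right_ne_zero_of_mul hk (by simp [hηo k h2.le (not_le.1 h).le])
      have h5 : ‖p k‖ ≤ Kp := by simpa using (hall k h1 (h3.trans_le hrR)).2.2.2.2.1
      have h6 : ‖((g k * (1 - η k ^ 2) : ℝ) : ℂ)‖ ≤ Kg := by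
        rw [Complex.norm_real, norm_mul]
        have : ‖1 - η k ^ 2‖ ≤ 1 := by
          rw [Real.norm_eq_abs, abs_le]
          have h5 : η k ^ 2 ≤ 1 := pow_le_one₀ (hη0 k) (hη1 k)
          have h6 := sq_nonneg (η k)
          constructor <;> linarith
        calc _ ≤ Kg * 1 := by gcongr; exact (hKg k).1
          _ = Kg := mul_one _
      have h7 := inner_shell_bound (U := ‖u k‖) (V := ‖v k‖) h1 hy hβ0 h4
      have h8 : ‖I k‖ ≤ Kg * (Kp * (‖u k‖ * ‖v k‖) * (|z.im|⁻¹) ^ 2) := by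
        simp only [hI]
        rw [norm_mul, norm_mul, norm_mul (p k), norm_mul (u k), norm_pow]
        gcongr
        exact norm_ofReal_sub_inv_le hz _
      calc ‖I k‖ ≤ Kg * (Kp * (‖u k‖ * ‖v k‖) * (|z.im|⁻¹) ^ 2) := h8
        _ = Kg * Kp * ((|z.im|⁻¹) ^ 2 * (‖u k‖ * ‖v k‖)) := by ring
        _ ≤ Kg * Kp * (T * (‖k - c‖ ^ (-2 - 2 * β) * ‖u k‖ ^ 2 +
            ‖k - c‖ ^ (-2 - 2 * β) * ‖v k‖ ^ 2)) := by gcongr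
        _ ≤ _ := by
          gcongr
          · simp only [hEu, indicator_of_mem hmem, localDensity]
            exact le_add_of_nonneg_right (by positivity)
          · simp only [hEv, indicator_of_mem hmem, localDensity]
            exact le_add_of_nonneg_right (by positivity)
  have hIR : Integrable fun k => Kg * Kp * (T * (Eu k + Ev k)) :=
    ((hEui.add hEvi).const_mul T).const_mul (Kg * Kp)
  have hIi : Integrable I := hIR.mono' hIm hIb
  have hII : ‖∫ k, I k‖ ≤ Kg * Kp * (T * (localEnergy β c r u + localEnergy β c r v)) := by
    refine (norm_integral_le_of_norm_le hIR hIb).trans (le_of_eq ?_)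
    rw [integral_const_mul, integral_const_mul, integral_add hEui hEvi, hEuI, hEvI]
  -- This is `1 = (1 - η²) + η²`; the minus sign occurs because `O` contains the derivative of `(x -
  -- z)⁻¹`, which is `-(x - z)⁻²`.
  have hsplit : ∀ k, (g k : ℂ) * p k * (u k * v k) * (((lam k : ℂ) - z)⁻¹) ^ 2 = I k - O k :=
    fun k => by simp only [hI, hO]; push_cast; ring
  simp only [hsplit]
  refine ⟨hIi.sub hOi, ?_⟩
  rw [integral_sub hIi hOi]
  refine (norm_sub_le _ _).trans ((add_le_add hII hOb).trans (le_of_eq ?_))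
  ring

end LAP

/-! ### Plane waves, cells of the reciprocal lattice and the unfolding weight. -/

namespace LAP

/-- The plane wave `e^{-i k·n}`. -/
noncomputable def planeWave {d : ℕ} (n : Fin d → ℤ) (k : Mom d) : ℂ :=
  Complex.exp (-Complex.I * ((∑ i, k i * (n i : ℝ) : ℝ) : ℂ))

section planeWave

variable {d : ℕ}

theorem norm_planeWave (n : Fin d → ℤ) (k : Mom d) : ‖planeWave n k‖ = 1 := by
  rw [planeWave, Complex.norm_exp]
  simp

theorem planeWave_add (n m : Fin d → ℤ) (k : Mom d) :
    planeWave (n + m) k = planeWave n k * planeWave m k := by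
  rw [planeWave, planeWave, planeWave, ← Complex.exp_add, ← mul_add, ← Complex.ofReal_add,
    ← Finset.sum_add_distrib]
  simp [mul_add]

theorem conj_planeWave (n : Fin d → ℤ) (k : Mom d) : conj (planeWave n k) = planeWave (-n) k := by
  rw [planeWave, planeWave, ← Complex.exp_conj]
  simp

theorem planeWave_eq_prod (n : Fin d → ℤ) (k : Mom d) :
    planeWave n k = ∏ i, Complex.exp (-Complex.I * ((k i * (n i : ℝ) : ℝ) : ℂ)) := by
  rw [planeWave, ← Complex.exp_sum, Complex.ofReal_sum, Finset.mul_sum]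

theorem hasFDerivAt_planeWave (n : Fin d → ℤ) (k : Mom d) :
    HasFDerivAt (planeWave n) (planeWave n k • (-Complex.I) •
      Complex.ofRealCLM.comp (∑ i, (n i : ℝ) • EuclideanSpace.proj (𝕜 := ℝ) i)) k := by
  have h1 : HasFDerivAt (fun k : Mom d => ∑ i, k i * (n i : ℝ))
      (∑ i, (n i : ℝ) • (EuclideanSpace.proj i : Mom d →L[ℝ] ℝ)) k := by
    refine HasFDerivAt.fun_sum fun i _ => ?_
    exact (EuclideanSpace.proj i : Mom d →L[ℝ] ℝ).hasFDerivAt.mul_const _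
  have h2 := (Complex.ofRealCLM.hasFDerivAt.comp k h1).const_mul (-Complex.I)
  exact h2.cexp

theorem contDiff_planeWave (n : Fin d → ℤ) {m : WithTop ℕ∞} : ContDiff ℝ m (planeWave n) := by
  have h1 : ContDiff ℝ m fun k : Mom d => ∑ i, k i * (n i : ℝ) :=
    ContDiff.sum fun i _ => ((EuclideanSpace.proj i : Mom d →L[ℝ] ℝ).contDiff).mul contDiff_const
  exact (contDiff_const.mul (Complex.ofRealCLM.contDiff.comp h1)).cexp

theorem fderiv_planeWave_momBasis (n : Fin d → ℤ) (k : Mom d) (i : Fin d) :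
    fderiv ℝ (planeWave n) k (momBasis i) = -Complex.I * n i * planeWave n k := by
  rw [(hasFDerivAt_planeWave n k).fderiv]
  simp
  ring

theorem planeWave_add_recipVector (n m : Fin d → ℤ) (k : Mom d) :
    planeWave n (k + recipVector m) = planeWave n k := by
  have hsum : ∑ i, (k + recipVector m) i * (n i : ℝ) =
      ∑ i, k i * (n i : ℝ) + 2 * Real.pi * ((∑ i, m i * n i : ℤ) : ℝ) := by
    push_cast
    rw [Finset.mul_sum, ← Finset.sum_add_distrib]
    refine Finset.sum_congr rfl fun i _ => ?_
    simp only [recipVector, PiLp.add_apply]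
    ring
  rw [planeWave, planeWave, hsum, Complex.exp_eq_exp_iff_exists_int]
  exact ⟨-∑ i, m i * n i, by push_cast; ring⟩

theorem eq_sum_momBasis (k : Mom d) : k = ∑ i, k i • momBasis i := by
  ext j
  simp [Pi.single_apply]

end planeWave

theorem integral_prod_coord {d : ℕ} (f : Fin d → ℝ → ℂ) :
    ∫ k : Mom d, ∏ i, f i (k i) = ∏ i, ∫ x, f i x := by
  rw [← integral_fintype_prod_volume_eq_prod f]
  exact ((EuclideanSpace.volume_preserving_symm_measurableEquiv_toLp (Fin d)).symm).integral_comp'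
    (fun k : Mom d => ∏ i, f i (k i)) |>.symm

/-- The translated cell `c + (-π, π]^d`. -/
def shiftedCell {d : ℕ} (c : Mom d) : Set (Mom d) :=
  {k | ∀ i, k i ∈ Ioc (c i - Real.pi) (c i + Real.pi)}

theorem measurableSet_shiftedCell {d : ℕ} (c : Mom d) : MeasurableSet (shiftedCell c) := by
  have : shiftedCell c = ⋂ i, (fun k : Mom d => k i) ⁻¹' Ioc (c i - Real.pi) (c i + Real.pi) := by
    ext k; simp [shiftedCell]
  rw [this]
  exact MeasurableSet.iInter fun i =>
    (EuclideanSpace.proj (𝕜 := ℝ) i).continuous.measurable measurableSet_Ioc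

theorem shiftedCell_zero {d : ℕ} : shiftedCell (0 : Mom d) = brillouinCell d := by
  ext k; simp [shiftedCell, brillouinCell]

theorem ball_subset_shiftedCell {d : ℕ} (c : Mom d) {r : ℝ} (hr : r ≤ Real.pi) :
    Metric.ball c r ⊆ shiftedCell c := fun k hk i => by
  rw [Metric.mem_ball, dist_eq_norm] at hk
  have h1 : |k i - c i| < Real.pi := by
    have := PiLp.norm_apply_le (k - c) i
    simp only [PiLp.sub_apply, Real.norm_eq_abs] at this
    linarith
  rw [abs_lt] at h1
  constructor <;> linarith [h1.1, h1.2]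

theorem shiftedCell_subset_closedBall {d : ℕ} (c : Mom d) :
    shiftedCell c ⊆ Metric.closedBall c (d * Real.pi) := fun k hk => by
  rw [Metric.mem_closedBall, dist_eq_norm]
  have h1 : ‖k - c‖ ≤ ∑ i, |k i - c i| := by
    have h2 : k - c = ∑ i, (k i - c i) • momBasis i := eq_sum_momBasis (k - c)
    calc ‖k - c‖ = ‖∑ i, (k i - c i) • momBasis i‖ := by rw [← h2]
      _ ≤ ∑ i, ‖(k i - c i) • momBasis i‖ := norm_sum_le _ _
      _ = _ := by simp [norm_smul]
  refine h1.trans ?_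
  calc ∑ i, |k i - c i| ≤ ∑ i : Fin d, Real.pi := by
        refine Finset.sum_le_sum fun i _ => ?_
        have := hk i
        rw [abs_le]
        constructor <;> linarith [this.1, this.2]
    _ = _ := by simp

theorem integrableOn_shiftedCell {d : ℕ} (c : Mom d) {F : Type*} [NormedAddCommGroup F]
    {f : Mom d → F} (hf : Continuous f) : IntegrableOn f (shiftedCell c) :=
  (hf.continuousOn.integrableOn_compact (isCompact_closedBall c (d * Real.pi))).mono_set
    (shiftedCell_subset_closedBall c)

theorem intervalIntegral_exp_int (a : ℝ) (m : ℤ) :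
    ∫ x in Ioc (a - Real.pi) (a + Real.pi), Complex.exp (-Complex.I * ((x * (m : ℝ) : ℝ) : ℂ)) =
      if m = 0 then 2 * (Real.pi : ℂ) else 0 := by
  rw [← intervalIntegral.integral_of_le (by linarith [Real.pi_pos])]
  split_ifs with h
  · subst h
    simp
    ring
  · have hc : (-Complex.I * (m : ℂ)) ≠ 0 := by
      simp [h]
    have h1 : ∀ x : ℝ, Complex.exp (-Complex.I * ((x * (m : ℝ) : ℝ) : ℂ)) =
        Complex.exp ((-Complex.I * (m : ℂ)) * x) := fun x => by
      congr 1; push_cast; ring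
    simp only [h1]
    rw [integral_exp_mul_complex hc]
    have h2 : Complex.exp (-Complex.I * (m : ℂ) * ((a + Real.pi : ℝ) : ℂ)) =
        Complex.exp (-Complex.I * (m : ℂ) * ((a - Real.pi : ℝ) : ℂ)) := by
      rw [Complex.exp_eq_exp_iff_exists_int]
      exact ⟨-m, by push_cast; ring⟩
    rw [h2, sub_self, zero_div]

theorem prod_ite_eq_zero {d : ℕ} (n : Fin d → ℤ) (x : ℂ) :
    ∏ i, (if n i = 0 then x else 0) = if n = 0 then x ^ d else 0 := by
  split_ifs with h
  · simp [h]
  · obtain ⟨i, hi⟩ := Function.ne_iff.1 h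
    exact Finset.prod_eq_zero (Finset.mem_univ i) (if_neg (by simpa using hi))

theorem setIntegral_planeWave {d : ℕ} (c : Mom d) (n : Fin d → ℤ) :
    ∫ k in shiftedCell c, planeWave n k = if n = 0 then (2 * (Real.pi : ℂ)) ^ d else 0 := by
  rw [← integral_indicator (measurableSet_shiftedCell c)]
  have h1 : ∀ k, (shiftedCell c).indicator (planeWave n) k =
      ∏ i, (Ioc (c i - Real.pi) (c i + Real.pi)).indicator
        (fun x : ℝ => Complex.exp (-Complex.I * ((x * (n i : ℝ) : ℝ) : ℂ))) (k i) := fun k => by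
    by_cases hk : k ∈ shiftedCell c
    · rw [indicator_of_mem hk, planeWave_eq_prod]
      exact Finset.prod_congr rfl fun i _ => by rw [indicator_of_mem (hk i)]
    · rw [indicator_of_notMem hk]
      simp only [shiftedCell, mem_ofPred_eq, not_forall] at hk
      obtain ⟨i, hi⟩ := hk
      exact (Finset.prod_eq_zero (Finset.mem_univ i) (indicator_of_notMem hi _)).symm
  simp only [h1]
  rw [integral_prod_coord]
  simp only [integral_indicator measurableSet_Ioc, intervalIntegral_exp_int]
  exact prod_ite_eq_zero n _

/-- A smooth compactly supported function on the line whose `2π`-translates sum up to `1`. -/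
noncomputable def unfold (x : ℝ) : ℝ :=
  Real.smoothTransition (x / (2 * Real.pi) + 1) - Real.smoothTransition (x / (2 * Real.pi))

theorem contDiff_unfold {m : ℕ∞} : ContDiff ℝ m unfold := by
  have h : ContDiff ℝ m fun x : ℝ => x / (2 * Real.pi) := contDiff_id.div_const _
  exact (Real.smoothTransition.contDiff.comp (h.add contDiff_const)).sub
    (Real.smoothTransition.contDiff.comp h)

theorem unfold_eq_zero {x : ℝ} (hx : 2 * Real.pi ≤ |x|) : unfold x = 0 := by
  have hp : 0 < 2 * Real.pi := by positivity
  rcases le_abs.1 hx with h | h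
  · have h1 : 1 ≤ x / (2 * Real.pi) := by rwa [le_div_iff₀ hp, one_mul]
    rw [unfold, Real.smoothTransition.one_of_one_le h1,
      Real.smoothTransition.one_of_one_le (by linarith), sub_self]
  · have h1 : x / (2 * Real.pi) ≤ -1 := by rw [div_le_iff₀ hp]; linarith
    rw [unfold, Real.smoothTransition.zero_of_nonpos (by linarith),
      Real.smoothTransition.zero_of_nonpos (by linarith), sub_self]

theorem unfold_add_unfold {x : ℝ} (h0 : 0 ≤ x) (h1 : x ≤ 2 * Real.pi) :
    unfold x + unfold (x - 2 * Real.pi) = 1 := by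
  have hp : 0 < 2 * Real.pi := by positivity
  have h2 : 0 ≤ x / (2 * Real.pi) := by positivity
  have h3 : x / (2 * Real.pi) ≤ 1 := by rwa [div_le_iff₀ hp, one_mul]
  have h4 : (x - 2 * Real.pi) / (2 * Real.pi) = x / (2 * Real.pi) - 1 := by field_simp
  rw [unfold, unfold, h4, Real.smoothTransition.one_of_one_le (x := x / (2 * Real.pi) + 1)
    (by linarith), Real.smoothTransition.zero_of_nonpos (x := x / (2 * Real.pi) - 1) (by linarith)]
  simp

/-- The two overlapping translates of `unfold` sum to `1` on a period because they are differences
of successive shifts of one smooth step. The sharp indicator of the cell is thus replaced by a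
smooth weight, which permits integration by parts on the whole space. -/
theorem integral_unfold_mul {f : ℝ → ℂ} (hf : Continuous f)
    (hper : ∀ x, f (x - 2 * Real.pi) = f x) :
    ∫ x, (unfold x : ℂ) * f x = ∫ x in Ioc (-Real.pi) Real.pi, f x := by
  have hp : 0 < Real.pi := Real.pi_pos
  have hu : Continuous fun x => (unfold x : ℂ) :=
    Complex.continuous_ofReal.comp (contDiff_unfold (m := 0)).continuous
  have hc : Continuous fun x => (unfold x : ℂ) * f x := hu.mul hf
  have h1 : ∫ x, (unfold x : ℂ) * f x =
      ∫ x in (-(2 * Real.pi))..(2 * Real.pi), (unfold x : ℂ) * f x := by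
    rw [intervalIntegral.integral_of_le (by linarith), setIntegral_eq_integral_of_forall_compl_eq_zero]
    intro x hx
    have : 2 * Real.pi ≤ |x| := by
      by_contra h
      rw [not_le, abs_lt] at h
      exact hx ⟨h.1, h.2.le⟩
    simp [unfold_eq_zero this]
  have h2 : ∫ x in (-(2 * Real.pi))..0, (unfold x : ℂ) * f x =
      ∫ x in (0 : ℝ)..(2 * Real.pi), (unfold (x - 2 * Real.pi) : ℂ) * f x := by
    have := intervalIntegral.integral_comp_sub_right (a := 0) (b := 2 * Real.pi)
      (fun x => (unfold x : ℂ) * f x) (2 * Real.pi)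
    simp only [hper, zero_sub, sub_self] at this
    exact this.symm
  have hc2 : Continuous fun x => (unfold (x - 2 * Real.pi) : ℂ) * f x :=
    (hu.comp (continuous_id.sub continuous_const)).mul hf
  rw [h1, ← intervalIntegral.integral_add_adjacent_intervals (b := 0)
    (hc.intervalIntegrable _ _) (hc.intervalIntegrable _ _), h2,
    ← intervalIntegral.integral_add (hc2.intervalIntegrable _ _) (hc.intervalIntegrable _ _)]
  have h3 : ∫ x in (0 : ℝ)..(2 * Real.pi), ((unfold (x - 2 * Real.pi) : ℂ) * f x +
      (unfold x : ℂ) * f x) = ∫ x in (0 : ℝ)..(2 * Real.pi), f x := by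
    refine intervalIntegral.integral_congr fun x hx => ?_
    rw [uIcc_of_le (by linarith)] at hx
    have := unfold_add_unfold hx.1 hx.2
    have h' : (unfold x : ℂ) + (unfold (x - 2 * Real.pi) : ℂ) = 1 := by exact_mod_cast this
    rw [← add_mul, add_comm, h', one_mul]
  rw [h3, ← intervalIntegral.integral_of_le (by linarith)]
  have hP : Function.Periodic f (2 * Real.pi) := fun x => by
    rw [← hper (x + 2 * Real.pi), add_sub_cancel_right]
  have := hP.intervalIntegral_add_eq 0 (-Real.pi)
  rw [zero_add] at this
  rw [this]
  congr 1
  ring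

/-- A smooth compactly supported function whose translates by the reciprocal lattice sum up to
`1`. -/
noncomputable def unfoldMom {d : ℕ} (k : Mom d) : ℝ := ∏ i, unfold (k i)

theorem contDiff_unfoldMom {d : ℕ} {m : ℕ∞} : ContDiff ℝ m (unfoldMom (d := d)) :=
  contDiff_prod fun i _ => contDiff_unfold.comp (EuclideanSpace.proj (𝕜 := ℝ) i).contDiff

theorem unfoldMom_eq_zero {d : ℕ} {k : Mom d} (hk : 2 * d * Real.pi < ‖k‖) : unfoldMom k = 0 := by
  by_contra h
  have h0 := Finset.prod_ne_zero_iff.1 h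
  have h1 : ∀ i, |k i| ≤ 2 * Real.pi := fun i => by
    by_contra h2
    exact h0 i (Finset.mem_univ i) (unfold_eq_zero (not_le.1 h2).le)
  have h2 : k = ∑ i, k i • momBasis i := eq_sum_momBasis k
  have h3 : ‖k‖ ≤ ∑ i : Fin d, 2 * Real.pi := by
    calc ‖k‖ = ‖∑ i, k i • momBasis i‖ := by rw [← h2]
      _ ≤ ∑ i, ‖k i • momBasis i‖ := norm_sum_le _ _
      _ ≤ _ := Finset.sum_le_sum fun i _ => by simpa [norm_smul] using h1 i
  simp at h3
  linarith

theorem integral_unfoldMom_mul_planeWave {d : ℕ} (n : Fin d → ℤ) :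
    ∫ k, (unfoldMom k : ℂ) * planeWave n k = ∫ k in brillouinCell d, planeWave n k := by
  have h1 : ∀ k : Mom d, (unfoldMom k : ℂ) * planeWave n k =
      ∏ i, ((unfold (k i) : ℂ) * Complex.exp (-Complex.I * ((k i * (n i : ℝ) : ℝ) : ℂ))) :=
    fun k => by
      rw [planeWave_eq_prod, unfoldMom, Complex.ofReal_prod, Finset.prod_mul_distrib]
  simp only [h1]
  rw [integral_prod_coord (fun i x => (unfold x : ℂ) *
    Complex.exp (-Complex.I * ((x * (n i : ℝ) : ℝ) : ℂ))), ← shiftedCell_zero,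
    setIntegral_planeWave, ← prod_ite_eq_zero]
  refine Finset.prod_congr rfl fun i _ => ?_
  rw [integral_unfold_mul (f := fun x => Complex.exp (-Complex.I * ((x * (n i : ℝ) : ℝ) : ℂ)))
    (by fun_prop)]
  · have := intervalIntegral_exp_int 0 (n i)
    simpa using this
  · intro x
    rw [Complex.exp_eq_exp_iff_exists_int]
    exact ⟨n i, by push_cast; ring⟩

end LAP

/-! ### Hardy's inequality for trigonometric polynomials. -/

namespace LAP

/-- The trigonometric polynomial `∑_{n ∈ s} aₙ e^{-i k·n}`. -/
noncomputable def trigPoly {d : ℕ} (s : Finset (Fin d → ℤ)) (a : (Fin d → ℤ) → ℂ) (k : Mom d) : ℂ :=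
  ∑ n ∈ s, a n * planeWave n k

section trigPoly

variable {d : ℕ} (s : Finset (Fin d → ℤ)) (a : (Fin d → ℤ) → ℂ)

theorem contDiff_trigPoly {m : WithTop ℕ∞} : ContDiff ℝ m (trigPoly s a) :=
  ContDiff.sum fun n _ => contDiff_const.mul (contDiff_planeWave n)

theorem fderiv_trigPoly_momBasis (k : Mom d) (i : Fin d) :
    fderiv ℝ (trigPoly s a) k (momBasis i) = trigPoly s (fun n => -Complex.I * n i * a n) k := by
  have h : HasFDerivAt (trigPoly s a) (∑ n ∈ s, a n • fderiv ℝ (planeWave n) k) k :=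
    HasFDerivAt.fun_sum fun n _ =>
      (((contDiff_planeWave n (m := 1)).differentiable one_ne_zero k).hasFDerivAt).const_mul (a n)
  rw [h.fderiv]
  simp only [FunLike.coe_sum, Finset.sum_apply, smul_apply,
    fderiv_planeWave_momBasis, smul_eq_mul, trigPoly]
  exact Finset.sum_congr rfl fun n _ => by ring

theorem setIntegral_conj_trigPoly_mul (t : Finset (Fin d → ℤ)) (b : (Fin d → ℤ) → ℂ) (c : Mom d) :
    ∫ k in shiftedCell c, conj (trigPoly s a k) * trigPoly t b k =
      (2 * (Real.pi : ℂ)) ^ d * ∑ n ∈ s, if n ∈ t then conj (a n) * b n else 0 := by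
  have h1 : ∀ k, conj (trigPoly s a k) * trigPoly t b k =
      ∑ n ∈ s, ∑ m ∈ t, conj (a n) * b m * planeWave (m - n) k := fun k => by
    rw [trigPoly, trigPoly, map_sum, Finset.sum_mul_sum]
    refine Finset.sum_congr rfl fun n _ => Finset.sum_congr rfl fun m _ => ?_
    rw [map_mul, conj_planeWave, sub_eq_add_neg, planeWave_add]
    ring
  simp only [h1]
  have hi : ∀ n m : Fin d → ℤ, IntegrableOn (fun k => conj (a n) * b m * planeWave (m - n) k)
      (shiftedCell c) := fun n m => integrableOn_shiftedCell c
        (continuous_const.mul (contDiff_planeWave (m := 0) (m - n)).continuous)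
  rw [integral_finsetSum _ fun n _ => integrable_finsetSum _ fun m _ => hi n m, Finset.mul_sum]
  refine Finset.sum_congr rfl fun n _ => ?_
  rw [integral_finsetSum _ fun m _ => hi n m]
  simp only [integral_const_mul, setIntegral_planeWave, sub_eq_zero]
  simp only [mul_ite, mul_zero, Finset.sum_ite_eq']
  split_ifs <;> ring

theorem setIntegral_norm_trigPoly_sq (c : Mom d) :
    ∫ k in shiftedCell c, ‖trigPoly s a k‖ ^ 2 = (2 * Real.pi) ^ d * ∑ n ∈ s, ‖a n‖ ^ 2 := by
  have h1 := setIntegral_conj_trigPoly_mul s a s a c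
  simp only [Complex.conj_mul'] at h1
  have h2 : ∫ k in shiftedCell c, ((‖trigPoly s a k‖ : ℂ)) ^ 2 =
      ((∫ k in shiftedCell c, ‖trigPoly s a k‖ ^ 2 : ℝ) : ℂ) := by
    rw [← integral_complex_ofReal]; push_cast; rfl
  rw [h2] at h1
  have h3 : ∀ n ∈ s, (if n ∈ s then ((‖a n‖ : ℂ)) ^ 2 else 0) = ((‖a n‖ : ℂ)) ^ 2 :=
    fun n hn => if_pos hn
  rw [Finset.sum_congr rfl h3] at h1
  exact_mod_cast h1

theorem setIntegral_norm_trigPoly_sq_ball_le (c : Mom d) {r : ℝ} (hr : r ≤ Real.pi) :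
    ∫ k in Metric.ball c r, ‖trigPoly s a k‖ ^ 2 ≤ (2 * Real.pi) ^ d * ∑ n ∈ s, ‖a n‖ ^ 2 := by
  rw [← setIntegral_norm_trigPoly_sq s a c]
  exact setIntegral_mono_set (integrableOn_shiftedCell c
    ((contDiff_trigPoly (m := 0) s a).continuous.norm.pow 2))
    (Eventually.of_forall fun k => by positivity) (ball_subset_shiftedCell c hr).eventuallyLE

theorem norm_trigPoly_sq_le (k : Mom d) :
    ‖trigPoly s a k‖ ^ 2 ≤ s.card * ∑ n ∈ s, ‖a n‖ ^ 2 := by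
  have h1 : ‖trigPoly s a k‖ ≤ ∑ n ∈ s, ‖a n‖ :=
    norm_sum_le_of_le _ fun n _ => by rw [norm_mul, norm_planeWave, mul_one]
  exact (pow_le_pow_left₀ (norm_nonneg _) h1 2).trans sq_sum_le_card_mul_sum_sq

end trigPoly

theorem abs_coord_le_bracket {d : ℕ} (n : Fin d → ℤ) (i : Fin d) : |(n i : ℝ)| ≤ bracket n := by
  refine Real.abs_le_sqrt ?_
  have := Finset.single_le_sum (f := fun i => (n i : ℝ) ^ 2) (fun j _ => sq_nonneg _)
    (Finset.mem_univ i)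
  linarith

theorem card_le_of_bracket_le {s : Finset (Fin 3 → ℤ)} {N : ℝ} (hN : 1 ≤ N)
    (hs : ∀ n ∈ s, bracket n ≤ N) : (s.card : ℝ) ≤ 27 * N ^ 3 := by
  have hsub : s ⊆ Fintype.piFinset fun _ : Fin 3 => Finset.Icc (-⌊N⌋) ⌊N⌋ := fun n hn => by
    rw [Fintype.mem_piFinset]
    intro i
    have h1 := (abs_coord_le_bracket n i).trans (hs n hn)
    rw [abs_le] at h1
    rw [Finset.mem_Icc]
    refine ⟨?_, Int.le_floor.2 h1.2⟩
    rw [neg_le]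
    exact Int.le_floor.2 (by push_cast; linarith [h1.1])
  have h1 := Finset.card_le_card hsub
  rw [Fintype.card_piFinset] at h1
  simp only [Int.card_Icc, Finset.prod_const, Finset.card_univ, Fintype.card_fin] at h1
  have h2 : ((⌊N⌋ + 1 - -⌊N⌋).toNat : ℝ) ≤ 3 * N := by
    have h0 : 0 ≤ ⌊N⌋ := Int.floor_nonneg.2 (by linarith)
    have h3 : (((⌊N⌋ + 1 - -⌊N⌋).toNat : ℤ) : ℝ) = 2 * (⌊N⌋ : ℝ) + 1 := by
      rw [Int.toNat_of_nonneg (by omega)]; push_cast; ring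
    have h4 := Int.floor_le N
    have h5 : ((⌊N⌋ + 1 - -⌊N⌋).toNat : ℝ) = 2 * (⌊N⌋ : ℝ) + 1 := by exact_mod_cast h3
    rw [h5]; linarith
  calc (s.card : ℝ) ≤ ((⌊N⌋ + 1 - -⌊N⌋).toNat : ℝ) ^ 3 := by exact_mod_cast h1
    _ ≤ (3 * N) ^ 3 := by gcongr
    _ = _ := by ring

theorem setIntegral_norm_sub_rpow_ball (c : Mom 3) {ρ : ℝ} (hρ : 0 < ρ) (σ : ℝ) :
    ∫ k in Metric.ball c ρ, ‖k - c‖ ^ σ = ρ ^ (3 + σ) * ∫ k in Metric.ball (0 : Mom 3) 1, ‖k‖ ^ σ := by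
  have h2 := (measurePreserving_sub_right volume c).setIntegral_preimage_emb
    (MeasurableEquiv.subRight c).measurableEmbedding (fun k : Mom 3 => ‖k‖ ^ σ) (Metric.ball 0 ρ)
  have h3 : (fun x : Mom 3 => x - c) ⁻¹' Metric.ball 0 ρ = Metric.ball c ρ := by
    ext x; simp [dist_eq_norm]
  rw [h3] at h2
  rw [h2]
  have h4 := Measure.setIntegral_comp_smul_of_pos volume (fun k : Mom 3 => ‖k‖ ^ σ)
    (Metric.ball 0 1) hρ
  rw [smul_unitBall_of_pos hρ] at h4
  simp only [norm_smul, Real.norm_of_nonneg hρ.le, finrank_euclideanSpace, Fintype.card_fin,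
    smul_eq_mul] at h4
  have h5 : ∀ k : Mom 3, (ρ * ‖k‖) ^ σ = ρ ^ σ * ‖k‖ ^ σ := fun k =>
    Real.mul_rpow hρ.le (norm_nonneg _)
  simp only [h5, integral_const_mul] at h4
  rw [Real.rpow_add hρ, mul_assoc, h4]
  norm_num
  field_simp

/-- Hardy's inequality for trigonometric polynomials of degree at most `N`. -/
theorem hardy_block {σ : ℝ} (hσ0 : 0 ≤ σ) (hσ : σ < 3 / 2) : ∃ C : ℝ, 0 ≤ C ∧
    ∀ (c : Mom 3) (r : ℝ), r ≤ Real.pi → ∀ (s : Finset (Fin 3 → ℤ)) (a : (Fin 3 → ℤ) → ℂ) (N : ℝ),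
      1 ≤ N → (∀ n ∈ s, bracket n ≤ N) →
      ∫ k in Metric.ball c r, ‖k - c‖ ^ (-2 * σ) * ‖trigPoly s a k‖ ^ 2 ≤
        C * N ^ (2 * σ) * ∑ n ∈ s, ‖a n‖ ^ 2 := by
  set J := ∫ k in Metric.ball (0 : Mom 3) 1, ‖k‖ ^ (-2 * σ) with hJ
  have hJ0 : 0 ≤ J := integral_nonneg fun k => by positivity
  refine ⟨27 * J + (2 * Real.pi) ^ 3, by positivity, fun c r hr s a N hN hs => ?_⟩
  have hN0 : 0 < N := by linarith
  set A := ∑ n ∈ s, ‖a n‖ ^ 2 with hA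
  have hA0 : 0 ≤ A := Finset.sum_nonneg fun n _ => by positivity
  have hu : Continuous fun k => ‖trigPoly s a k‖ ^ 2 :=
    (contDiff_trigPoly (m := 0) s a).continuous.norm.pow 2
  have i1 : Integrable ((Metric.ball c N⁻¹).indicator fun k => ‖k - c‖ ^ (-2 * σ)) :=
    (integrable_indicator_iff measurableSet_ball).2
      (integrableOn_norm_sub_rpow c _ (by linarith))
  have i2 : IntegrableOn (fun k => ‖trigPoly s a k‖ ^ 2) (Metric.ball c r) :=
    (integrableOn_shiftedCell c hu).mono_set (ball_subset_shiftedCell c hr)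
  -- The cut is at `‖k - c‖ = N⁻¹`. Inside, Cauchy–Schwarz over at most `27 N³` frequencies bounds
  -- the polynomial pointwise, and the weight integrates to `N^{2σ-3} J`, finite as `σ < 3/2`.
  -- Outside, the weight is at most `N^{2σ}` and Parseval applies.
  have hpt : ∀ k, ‖k - c‖ ^ (-2 * σ) * ‖trigPoly s a k‖ ^ 2 ≤
      27 * N ^ 3 * A * (Metric.ball c N⁻¹).indicator (fun k => ‖k - c‖ ^ (-2 * σ)) k +
        N ^ (2 * σ) * ‖trigPoly s a k‖ ^ 2 := fun k => by
    by_cases hk : k ∈ Metric.ball c N⁻¹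
    · rw [indicator_of_mem hk]
      have h1 : ‖trigPoly s a k‖ ^ 2 ≤ 27 * N ^ 3 * A :=
        (norm_trigPoly_sq_le s a k).trans (by
          gcongr; exact card_le_of_bracket_le hN hs)
      have h2 : ‖k - c‖ ^ (-2 * σ) * ‖trigPoly s a k‖ ^ 2 ≤
          27 * N ^ 3 * A * ‖k - c‖ ^ (-2 * σ) := by
        rw [mul_comm]; gcongr
      have : 0 ≤ N ^ (2 * σ) * ‖trigPoly s a k‖ ^ 2 := by positivity
      linarith
    · rw [indicator_of_notMem hk, mul_zero, zero_add]
      rw [Metric.mem_ball, dist_eq_norm, not_lt] at hk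
      gcongr
      calc ‖k - c‖ ^ (-2 * σ) ≤ N⁻¹ ^ (-2 * σ) :=
            Real.rpow_le_rpow_of_nonpos (by positivity) hk (by linarith)
        _ = N ^ (2 * σ) := by
          rw [Real.inv_rpow hN0.le, ← Real.rpow_neg hN0.le]; congr 1; ring
  have i3 : IntegrableOn (fun k => 27 * N ^ 3 * A *
      (Metric.ball c N⁻¹).indicator (fun k => ‖k - c‖ ^ (-2 * σ)) k) (Metric.ball c r) :=
    (i1.const_mul _).integrableOn
  have i4 : IntegrableOn (fun k => N ^ (2 * σ) * ‖trigPoly s a k‖ ^ 2) (Metric.ball c r) :=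
    i2.const_mul _
  calc ∫ k in Metric.ball c r, ‖k - c‖ ^ (-2 * σ) * ‖trigPoly s a k‖ ^ 2
      ≤ ∫ k in Metric.ball c r, (27 * N ^ 3 * A *
          (Metric.ball c N⁻¹).indicator (fun k => ‖k - c‖ ^ (-2 * σ)) k +
          N ^ (2 * σ) * ‖trigPoly s a k‖ ^ 2) :=
        integral_mono (integrableOn_norm_sub_rpow_mul c r (by linarith) hu) (Integrable.add i3 i4) hpt
    _ = (∫ k in Metric.ball c r, 27 * N ^ 3 * A *
          (Metric.ball c N⁻¹).indicator (fun k => ‖k - c‖ ^ (-2 * σ)) k) +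
        ∫ k in Metric.ball c r, N ^ (2 * σ) * ‖trigPoly s a k‖ ^ 2 := integral_add i3 i4
    _ ≤ 27 * N ^ 3 * A * (N⁻¹ ^ (3 + -2 * σ) * J) +
        N ^ (2 * σ) * ((2 * Real.pi) ^ 3 * A) := by
      rw [integral_const_mul, integral_const_mul]
      gcongr
      · rw [← setIntegral_norm_sub_rpow_ball c (by positivity)]
        refine (setIntegral_le_integral i1 (Eventually.of_forall fun k =>
          indicator_nonneg (fun k _ => by positivity) k)).trans (le_of_eq ?_)
        exact integral_indicator measurableSet_ball
      · exact setIntegral_norm_trigPoly_sq_ball_le s a c hr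
    _ = _ := by
      have : N ^ 3 * N⁻¹ ^ (3 + -2 * σ) = N ^ (2 * σ) := by
        rw [Real.inv_rpow hN0.le, ← Real.rpow_neg hN0.le, ← Real.rpow_natCast N 3,
          ← Real.rpow_add hN0]
        congr 1; push_cast; ring
      linear_combination 27 * A * J * this

theorem exists_dyadic {d : ℕ} (n : Fin d → ℤ) :
    ∃ j : ℕ, (2 : ℝ) ^ j ≤ bracket n ∧ bracket n ≤ (2 : ℝ) ^ (j + 1) := by
  obtain ⟨j, h1, h2⟩ := exists_nat_pow_near (one_le_bracket n) (one_lt_two (α := ℝ))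
  exact ⟨j, h1, h2.le⟩

/-- Cauchy–Schwarz with weights `q^{-j}`. Dyadic blocks are not orthogonal in a singular weighted
norm, so they are summed with the loss `q ^ j`, which the strict inequality `σ < α` pays for. -/
theorem sq_sum_le_geometric (J : Finset ℕ) {q : ℝ} (hq : 1 < q) (x : ℕ → ℝ) :
    (∑ j ∈ J, x j) ^ 2 ≤ (1 - q⁻¹)⁻¹ * ∑ j ∈ J, q ^ j * x j ^ 2 := by
  have hq0 : 0 < q := by linarith
  have h1 : (∑ j ∈ J, x j) ^ 2 ≤ (∑ j ∈ J, q⁻¹ ^ j) * ∑ j ∈ J, q ^ j * x j ^ 2 :=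
    Finset.sum_sq_le_sum_mul_sum_of_sq_le_mul _ (fun j _ => by positivity)
      (fun j _ => by positivity) fun j _ => by
        rw [← mul_assoc, ← mul_pow, inv_mul_cancel₀ hq0.ne', one_pow, one_mul]
  refine h1.trans ?_
  gcongr
  have h2 : q⁻¹ < 1 := inv_lt_one_of_one_lt₀ hq
  rw [← tsum_geometric_of_lt_one (by positivity) h2]
  exact (summable_geometric_of_lt_one (by positivity) h2).sum_le_tsum _ fun j _ => by positivity

/-- Hardy's inequality for trigonometric polynomials, with a small loss of regularity. -/
theorem hardy_trigPoly {σ α : ℝ} (hσ0 : 0 ≤ σ) (hσ : σ < 3 / 2) (hα : σ < α) : ∃ C : ℝ, 0 ≤ C ∧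
    ∀ (c : Mom 3) (r : ℝ), r ≤ Real.pi → ∀ (s : Finset (Fin 3 → ℤ)) (a : (Fin 3 → ℤ) → ℂ),
      ∫ k in Metric.ball c r, ‖k - c‖ ^ (-2 * σ) * ‖trigPoly s a k‖ ^ 2 ≤
        C * ∑ n ∈ s, bracket n ^ (2 * α) * ‖a n‖ ^ 2 := by
  obtain ⟨C, hC0, hC⟩ := hardy_block hσ0 hσ
  choose j hj1 hj2 using fun n : Fin 3 → ℤ => exists_dyadic n
  -- This is the largest loss available: `q ^ j` times the block bound `(2 ^ j)^{2σ}` is exactly `(2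
  -- ^ j)^{2α}`.
  set q : ℝ := 2 ^ (2 * (α - σ)) with hq
  have hq1 : 1 < q := Real.one_lt_rpow (by norm_num) (by linarith)
  have hG0 : 0 ≤ (1 - q⁻¹)⁻¹ := by
    have : q⁻¹ < 1 := inv_lt_one_of_one_lt₀ hq1
    exact inv_nonneg.2 (by linarith)
  refine ⟨(1 - q⁻¹)⁻¹ * (C * 2 ^ (2 * σ)), by positivity, fun c r hr s a => ?_⟩
  set S : ℕ → Finset (Fin 3 → ℤ) := fun i => s.filter fun n => j n = i with hS
  have hsplit : ∀ k, trigPoly s a k = ∑ i ∈ s.image j, trigPoly (S i) a k := fun k =>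
    (Finset.sum_fiberwise_of_maps_to (fun n hn => Finset.mem_image_of_mem j hn) _).symm
  have hpt : ∀ k, ‖k - c‖ ^ (-2 * σ) * ‖trigPoly s a k‖ ^ 2 ≤ ∑ i ∈ s.image j,
      (1 - q⁻¹)⁻¹ * q ^ i * (‖k - c‖ ^ (-2 * σ) * ‖trigPoly (S i) a k‖ ^ 2) := fun k => by
    have h1 : ‖trigPoly s a k‖ ^ 2 ≤ (1 - q⁻¹)⁻¹ *
        ∑ i ∈ s.image j, q ^ i * ‖trigPoly (S i) a k‖ ^ 2 := by
      rw [hsplit k]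
      exact (pow_le_pow_left₀ (norm_nonneg _) (norm_sum_le _ _) 2).trans
        (sq_sum_le_geometric _ hq1 _)
    calc _ ≤ ‖k - c‖ ^ (-2 * σ) * ((1 - q⁻¹)⁻¹ *
        ∑ i ∈ s.image j, q ^ i * ‖trigPoly (S i) a k‖ ^ 2) := by gcongr
      _ = _ := by
        rw [Finset.mul_sum, Finset.mul_sum]
        exact Finset.sum_congr rfl fun i _ => by ring
  have hcont : ∀ t : Finset (Fin 3 → ℤ), Continuous fun k => ‖trigPoly t a k‖ ^ 2 := fun t =>
    (contDiff_trigPoly (m := 0) t a).continuous.norm.pow 2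
  have hint : ∀ t : Finset (Fin 3 → ℤ), IntegrableOn
      (fun k => ‖k - c‖ ^ (-2 * σ) * ‖trigPoly t a k‖ ^ 2) (Metric.ball c r) := fun t =>
    integrableOn_norm_sub_rpow_mul c r (by linarith) (hcont t)
  calc _ ≤ ∫ k in Metric.ball c r, ∑ i ∈ s.image j,
        (1 - q⁻¹)⁻¹ * q ^ i * (‖k - c‖ ^ (-2 * σ) * ‖trigPoly (S i) a k‖ ^ 2) :=
        integral_mono (hint s) (integrable_finsetSum _ fun i _ => (hint (S i)).const_mul _) hpt
    _ = ∑ i ∈ s.image j, (1 - q⁻¹)⁻¹ * q ^ i *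
        ∫ k in Metric.ball c r, ‖k - c‖ ^ (-2 * σ) * ‖trigPoly (S i) a k‖ ^ 2 := by
        rw [integral_finsetSum _ fun i _ => (hint (S i)).const_mul _]
        simp only [integral_const_mul]
    _ ≤ ∑ i ∈ s.image j, (1 - q⁻¹)⁻¹ * q ^ i *
        (C * ((2 : ℝ) ^ (i + 1)) ^ (2 * σ) * ∑ n ∈ S i, ‖a n‖ ^ 2) := by
        gcongr with i hi
        refine hC c r hr (S i) a _ (one_le_pow₀ (by norm_num)) fun n hn => ?_
        rw [← (Finset.mem_filter.1 hn).2]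
        exact hj2 n
    _ ≤ ∑ i ∈ s.image j, (1 - q⁻¹)⁻¹ * (C * 2 ^ (2 * σ)) *
        ∑ n ∈ S i, bracket n ^ (2 * α) * ‖a n‖ ^ 2 := by
        refine Finset.sum_le_sum fun i _ => ?_
        have e1 : q ^ i * ((2 : ℝ) ^ (i + 1)) ^ (2 * σ) = 2 ^ (2 * σ) * ((2 : ℝ) ^ i) ^ (2 * α) := by
          rw [hq]
          simp only [← Real.rpow_natCast, ← Real.rpow_mul (show (0 : ℝ) ≤ 2 by norm_num),
            ← Real.rpow_add (show (0 : ℝ) < 2 by norm_num)]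
          congr 1; push_cast; ring
        have e2 : ((2 : ℝ) ^ i) ^ (2 * α) * ∑ n ∈ S i, ‖a n‖ ^ 2 ≤
            ∑ n ∈ S i, bracket n ^ (2 * α) * ‖a n‖ ^ 2 := by
          rw [Finset.mul_sum]
          refine Finset.sum_le_sum fun n hn => ?_
          have : (2 : ℝ) ^ i ≤ bracket n := by rw [← (Finset.mem_filter.1 hn).2]; exact hj1 n
          gcongr
          linarith
        calc _ = (1 - q⁻¹)⁻¹ * C * (q ^ i * ((2 : ℝ) ^ (i + 1)) ^ (2 * σ)) *
              ∑ n ∈ S i, ‖a n‖ ^ 2 := by ring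
          _ = (1 - q⁻¹)⁻¹ * (C * 2 ^ (2 * σ)) *
              (((2 : ℝ) ^ i) ^ (2 * α) * ∑ n ∈ S i, ‖a n‖ ^ 2) := by rw [e1]; ring
          _ ≤ _ := by gcongr
    _ = _ := by
        rw [← Finset.mul_sum]
        congr 1
        exact Finset.sum_fiberwise_of_maps_to (fun n hn => Finset.mem_image_of_mem j hn) _

theorem norm_sq_le_sum_momBasis {d : ℕ} (A : Mom d →L[ℝ] ℂ) :
    ‖A‖ ^ 2 ≤ d * ∑ i, ‖A (momBasis i)‖ ^ 2 := by
  have h1 : ‖A‖ ≤ ∑ i, ‖A (momBasis i)‖ := by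
    refine A.opNorm_le_bound (Finset.sum_nonneg fun i _ => norm_nonneg _) fun x => ?_
    conv_lhs => rw [eq_sum_momBasis x]
    rw [map_sum, Finset.sum_mul]
    refine norm_sum_le_of_le _ fun i _ => ?_
    rw [map_smul, norm_smul, mul_comm]
    gcongr
    exact PiLp.norm_apply_le x i
  refine (pow_le_pow_left₀ (norm_nonneg _) h1 2).trans ?_
  simpa using sq_sum_le_card_mul_sum_sq (s := Finset.univ) (f := fun i => ‖A (momBasis i)‖)

/-- Hardy's inequality is used with `σ = 1 + β` and exponent `α` for the function, and with `σ = β`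
and exponent `α - 1` for the derivatives, whose coefficients carry one factor `nᵢ`. The bound `β <
1/2` is the restriction `1 + β < 3/2` of dimension three. -/
theorem localEnergy_trigPoly_le {β α : ℝ} (hβ0 : 0 < β) (hβ : β < 1 / 2) (hα : 1 + β < α) :
    ∃ C : ℝ, 0 ≤ C ∧ ∀ (c : Mom 3) (r : ℝ), r ≤ Real.pi →
      ∀ (s : Finset (Fin 3 → ℤ)) (a : (Fin 3 → ℤ) → ℂ),
        localEnergy β c r (trigPoly s a) ≤ C * ∑ n ∈ s, bracket n ^ (2 * α) * ‖a n‖ ^ 2 := by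
  obtain ⟨C₁, hC₁0, hC₁⟩ := hardy_trigPoly (σ := 1 + β) (α := α) (by linarith) (by linarith) hα
  obtain ⟨C₂, hC₂0, hC₂⟩ := hardy_trigPoly (σ := β) (α := α - 1) hβ0.le (by linarith) (by linarith)
  refine ⟨C₁ + 9 * C₂, by positivity, fun c r hr s a => ?_⟩
  set S := ∑ n ∈ s, bracket n ^ (2 * α) * ‖a n‖ ^ 2 with hS
  have hD : ∀ k, ‖fderiv ℝ (trigPoly s a) k‖ ^ 2 ≤
      3 * ∑ i, ‖trigPoly s (fun n => -Complex.I * n i * a n) k‖ ^ 2 := fun k => by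
    have := norm_sq_le_sum_momBasis (fderiv ℝ (trigPoly s a) k)
    simpa only [fderiv_trigPoly_momBasis, Nat.cast_ofNat] using this
  have hcont : ∀ a : (Fin 3 → ℤ) → ℂ, Continuous fun k => ‖trigPoly s a k‖ ^ 2 := fun a =>
    (contDiff_trigPoly (m := 0) s a).continuous.norm.pow 2
  have i1 : IntegrableOn (fun k => ‖k - c‖ ^ (-2 * (1 + β)) * ‖trigPoly s a k‖ ^ 2)
      (Metric.ball c r) := integrableOn_norm_sub_rpow_mul c r (by linarith) (hcont a)
  have i2 : ∀ i : Fin 3, IntegrableOn (fun k => ‖k - c‖ ^ (-2 * β) *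
      ‖trigPoly s (fun n => -Complex.I * n i * a n) k‖ ^ 2) (Metric.ball c r) := fun i =>
    integrableOn_norm_sub_rpow_mul c r (by linarith) (hcont _)
  have i3 : IntegrableOn (fun k => 3 * ∑ i : Fin 3, ‖k - c‖ ^ (-2 * β) *
      ‖trigPoly s (fun n => -Complex.I * n i * a n) k‖ ^ 2) (Metric.ball c r) :=
    (integrable_finsetSum _ fun i _ => i2 i).const_mul 3
  calc localEnergy β c r (trigPoly s a)
      ≤ ∫ k in Metric.ball c r, (‖k - c‖ ^ (-2 * (1 + β)) * ‖trigPoly s a k‖ ^ 2 +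
        3 * ∑ i : Fin 3, ‖k - c‖ ^ (-2 * β) *
          ‖trigPoly s (fun n => -Complex.I * n i * a n) k‖ ^ 2) := by
        refine integral_mono (integrableOn_localDensity hβ0 hβ c r (contDiff_trigPoly s a))
          (i1.add i3) fun k => ?_
        simp only [localDensity]
        rw [show -2 - 2 * β = -2 * (1 + β) by ring, ← Finset.mul_sum]
        refine add_le_add le_rfl ?_
        calc _ ≤ ‖k - c‖ ^ (-2 * β) *
              (3 * ∑ i, ‖trigPoly s (fun n => -Complex.I * n i * a n) k‖ ^ 2) := by
              gcongr; exact hD k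
          _ = _ := by ring
    _ = (∫ k in Metric.ball c r, ‖k - c‖ ^ (-2 * (1 + β)) * ‖trigPoly s a k‖ ^ 2) +
        3 * ∑ i : Fin 3, ∫ k in Metric.ball c r, ‖k - c‖ ^ (-2 * β) *
          ‖trigPoly s (fun n => -Complex.I * n i * a n) k‖ ^ 2 := by
        rw [integral_add i1 i3, integral_const_mul, integral_finsetSum _ fun i _ => i2 i]
    _ ≤ C₁ * S + 3 * ∑ i : Fin 3, C₂ * S := by
        gcongr with i _
        · exact hC₁ c r hr s a
        · refine (hC₂ c r hr s _).trans ?_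
          refine mul_le_mul_of_nonneg_left (Finset.sum_le_sum fun n hn => ?_) hC₂0
          rw [norm_mul, mul_pow]
          have h1 : ‖-Complex.I * (n i : ℂ)‖ ^ 2 ≤ bracket n ^ (2 : ℝ) := by
            rw [norm_mul, norm_neg, Complex.norm_I, one_mul]
            have := abs_coord_le_bracket n i
            have h2 : ‖(n i : ℂ)‖ = |(n i : ℝ)| := by
              rw [show (n i : ℂ) = ((n i : ℝ) : ℂ) by push_cast; rfl, Complex.norm_real,
                Real.norm_eq_abs]
            rw [h2]
            norm_num
            exact sq_le_sq' (by linarith [abs_nonneg (n i : ℝ), neg_abs_le (n i : ℝ)])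
              ((le_abs_self _).trans this)
          have hb : 0 < bracket n := by linarith [one_le_bracket n]
          have h3 : bracket n ^ (2 * α) = bracket n ^ (2 * (α - 1)) * bracket n ^ (2 : ℝ) := by
            rw [← Real.rpow_add hb]; congr 1; ring
          rw [h3, mul_assoc]
          gcongr
    _ = _ := by
        rw [Finset.sum_const, Finset.card_univ, Fintype.card_fin, nsmul_eq_mul]
        push_cast
        ring

end LAP

/-! ### Density of trigonometric polynomials and of finitely supported states. -/

namespace LAP

/-- `f` is periodic with respect to the reciprocal lattice. -/
def RecipPeriodic {d : ℕ} {X : Type*} (f : Mom d → X) : Prop :=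
  ∀ (k : Mom d) (n : Fin d → ℤ), f (k + recipVector n) = f k

/-- After rescaling by `2π` the function descends to the unit torus, where the span of the Fourier
monomials is dense. Frequencies change sign because plane waves are `e^{-i k·n}`. The vanishing of
`a` off `s` allows the index set to be enlarged when several components are approximated together.
-/
theorem exists_trigPoly_near {d : ℕ} {f : Mom d → ℂ} (hf : Continuous f) (hper : RecipPeriodic f)
    {ε : ℝ} (hε : 0 < ε) : ∃ (s : Finset (Fin d → ℤ)) (a : (Fin d → ℤ) → ℂ),
      (∀ n ∉ s, a n = 0) ∧ ∀ k, ‖f k - trigPoly s a k‖ ≤ ε := by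
  let p : C(Fin d → ℝ, UnitAddTorus (Fin d)) :=
    ⟨fun x i => (x i : UnitAddCircle), by
      exact continuous_pi fun i => (AddCircle.continuous_mk' 1).comp (continuous_apply i)⟩
  have hp : Topology.IsQuotientMap p := by
    have : IsOpenQuotientMap p := IsOpenQuotientMap.piMap (f := fun (_ : Fin d) (x : ℝ) =>
      (x : UnitAddCircle)) fun i => QuotientAddGroup.isOpenQuotientMap_mk
    exact this.isQuotientMap
  let F : C(Fin d → ℝ, ℂ) := ⟨fun x => f (WithLp.toLp 2 fun i => 2 * Real.pi * x i),
    hf.comp ((PiLp.continuous_toLp 2 _).comp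
      (continuous_pi fun i => continuous_const.mul (continuous_apply i)))⟩
  have hfac : Function.FactorsThrough F p := fun x y hxy => by
    have h1 : ∀ i, ∃ m : ℤ, y i + m = x i := fun i => by
      have := congrFun hxy i
      simp only [p, ContinuousMap.coe_mk] at this
      obtain ⟨m, hm⟩ := AddSubgroup.mem_zmultiples_iff.1 (QuotientAddGroup.eq.1 this.symm)
      refine ⟨m, ?_⟩
      rw [zsmul_eq_mul, mul_one] at hm
      linarith
    choose m hm using h1
    have h2 : (WithLp.toLp 2 fun i => 2 * Real.pi * x i : Mom d) =
        (WithLp.toLp 2 fun i => 2 * Real.pi * y i) + recipVector m := by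
      ext i
      simp [recipVector, ← hm i]
      ring
    simp only [F, ContinuousMap.coe_mk]
    rw [h2, hper]
  let g : C(UnitAddTorus (Fin d), ℂ) := hp.lift F hfac
  have hg : ∀ x, g (p x) = F x := fun x => congrFun (congrArg DFunLike.coe (hp.lift_comp F hfac)) x
  have hmem : g ∈ (Submodule.span ℂ (range (UnitAddTorus.mFourier (d := Fin d)))).topologicalClosure := by
    rw [UnitAddTorus.span_mFourier_closure_eq_top]; trivial
  rw [← SetLike.mem_coe, Submodule.topologicalClosure_coe, Metric.mem_closure_iff] at hmem
  obtain ⟨h, hh, hgh⟩ := hmem ε hε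
  obtain ⟨c, rfl⟩ := Finsupp.mem_span_range_iff_exists_finsupp.1 hh
  classical
  refine ⟨c.support.image fun n => -n, fun n => c (-n), fun n hn => ?_, fun k => ?_⟩
  · by_contra h
    exact hn (Finset.mem_image.2 ⟨-n, Finsupp.mem_support_iff.2 h, neg_neg n⟩)
  · set x : Fin d → ℝ := fun i => k i / (2 * Real.pi) with hx
    have hk : F x = f k := by
      simp only [F, ContinuousMap.coe_mk]
      congr 1
      ext i
      simp only [hx]
      field_simp
    have h1 : (c.sum fun i a => a • UnitAddTorus.mFourier i) (p x) =
        trigPoly (c.support.image fun n => -n) (fun n => c (-n)) k := by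
      rw [trigPoly, Finset.sum_image fun a _ b _ hab => neg_injective hab, Finsupp.sum,
        ContinuousMap.sum_apply]
      refine Finset.sum_congr rfl fun n _ => ?_
      rw [neg_neg, ContinuousMap.smul_apply, smul_eq_mul, planeWave_eq_prod]
      congr 1
      simp only [UnitAddTorus.mFourier, ContinuousMap.coe_mk, p]
      refine Finset.prod_congr rfl fun i _ => ?_
      rw [fourier_coe_apply]
      congr 1
      simp only [hx]
      push_cast
      field_simp
      simp [mul_comm]
    rw [← hk, ← hg, ← h1, ← ContinuousMap.sub_apply]
    refine (ContinuousMap.norm_coe_le_norm _ _).trans ?_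
    rw [← dist_eq_norm]
    exact hgh.le

theorem recipPeriodic_trigPoly {d : ℕ} (s : Finset (Fin d → ℤ)) (a : (Fin d → ℤ) → ℂ) :
    RecipPeriodic (trigPoly s a) := fun k m => by
  simp only [trigPoly, planeWave_add_recipVector]

theorem hasCompactSupport_unfoldMom {d : ℕ} : HasCompactSupport (unfoldMom (d := d)) :=
  HasCompactSupport.intro (isCompact_closedBall 0 (2 * d * Real.pi)) fun k hk =>
    unfoldMom_eq_zero (by simpa using hk)

/-- Both sides agree on plane waves, hence on trigonometric polynomials, and both are continuous in
the uniform norm: the weight is integrable and the cell has finite volume. -/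
theorem integral_unfoldMom_mul {d : ℕ} {f : Mom d → ℂ} (hf : Continuous f)
    (hper : RecipPeriodic f) :
    ∫ k, (unfoldMom k : ℂ) * f k = ∫ k in brillouinCell d, f k := by
  have hχ : Continuous fun k : Mom d => (unfoldMom k : ℂ) :=
    Complex.continuous_ofReal.comp (contDiff_unfoldMom (m := 0)).continuous
  have hχc : HasCompactSupport fun k : Mom d => (unfoldMom k : ℂ) :=
    hasCompactSupport_unfoldMom.comp_left (g := ((↑) : ℝ → ℂ)) (by simp)
  have hi : ∀ g : Mom d → ℂ, Continuous g → Integrable fun k => (unfoldMom k : ℂ) * g k :=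
    fun g hg => (hχ.mul hg).integrable_of_hasCompactSupport hχc.mul_right
  have hci : ∀ g : Mom d → ℂ, Continuous g → IntegrableOn g (brillouinCell d) := fun g hg => by
    rw [← shiftedCell_zero]; exact integrableOn_shiftedCell 0 hg
  have htrig : ∀ s a, ∫ k, (unfoldMom k : ℂ) * trigPoly s a k =
      ∫ k in brillouinCell d, trigPoly s a k := fun s a => by
    have h1 : ∀ k : Mom d, (unfoldMom k : ℂ) * trigPoly s a k =
        ∑ n ∈ s, a n * ((unfoldMom k : ℂ) * planeWave n k) := fun k => by
      rw [trigPoly, Finset.mul_sum]; exact Finset.sum_congr rfl fun n _ => by ring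
    simp only [h1]
    simp only [trigPoly]
    have hc : ∀ n : Fin d → ℤ, Continuous (planeWave n) := fun n =>
      (contDiff_planeWave (m := 0) n).continuous
    rw [integral_finsetSum _ fun n _ => (hi _ (hc n)).const_mul (a n),
      integral_finsetSum _ fun n _ => (hci _ (hc n)).const_mul (a n)]
    simp only [integral_const_mul, integral_unfoldMom_mul_planeWave]
  set A := ∫ k : Mom d, ‖(unfoldMom k : ℂ)‖ with hA
  set B := volume.real (brillouinCell d) with hB
  have hfin : volume (brillouinCell d) < ⊤ := by
    rw [← shiftedCell_zero]
    exact (measure_mono (shiftedCell_subset_closedBall 0)).trans_lt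
      (isCompact_closedBall _ _).measure_lt_top
  have hA0 : 0 ≤ A := integral_nonneg fun k => norm_nonneg _
  have key : ∀ ε : ℝ, 0 < ε → ‖(∫ k, (unfoldMom k : ℂ) * f k) - ∫ k in brillouinCell d, f k‖ ≤
      ε * (A + B) := fun ε hε => by
    obtain ⟨s, a, -, hsa⟩ := exists_trigPoly_near hf hper hε
    have hc : Continuous (trigPoly s a) := (contDiff_trigPoly (m := 0) s a).continuous
    have h1 : (∫ k, (unfoldMom k : ℂ) * f k) - ∫ k in brillouinCell d, f k =
        (∫ k, (unfoldMom k : ℂ) * (f k - trigPoly s a k)) -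
          ∫ k in brillouinCell d, (f k - trigPoly s a k) := by
      simp only [mul_sub]
      rw [integral_sub (hi _ hf) (hi _ hc), integral_sub (hci _ hf) (hci _ hc), htrig]
      ring
    rw [h1]
    have h2 : ‖∫ k, (unfoldMom k : ℂ) * (f k - trigPoly s a k)‖ ≤ ε * A := by
      rw [hA, ← integral_const_mul]
      refine norm_integral_le_of_norm_le ((hχ.integrable_of_hasCompactSupport hχc).norm.const_mul ε)
        (Eventually.of_forall fun k => ?_)
      rw [norm_mul, mul_comm]
      gcongr
      exact hsa k
    have h3 : ‖∫ k in brillouinCell d, (f k - trigPoly s a k)‖ ≤ ε * B :=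
      norm_setIntegral_le_of_norm_le_const hfin fun k _ => hsa k
    calc _ ≤ _ := norm_sub_le _ _
      _ ≤ ε * A + ε * B := add_le_add h2 h3
      _ = _ := by ring
  have hB0 : 0 ≤ B := measureReal_nonneg
  rw [← sub_eq_zero, ← norm_le_zero_iff]
  refine le_of_forall_pos_le_add fun δ hδ => ?_
  have := key (δ / (A + B + 1)) (by positivity)
  refine this.trans ?_
  rw [zero_add, div_mul_eq_mul_div, div_le_iff₀ (by positivity)]
  nlinarith

section finState

variable {d L : ℕ}

/-- The finitely supported state with value `a n` at the sites `n ∈ s`. -/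
noncomputable def finState (s : Finset (Fin d → ℤ)) (a : (Fin d → ℤ) → EuclideanSpace ℂ (Fin L)) :
    LatticeHilbert d L := ∑ n ∈ s, lp.single 2 n (a n)

theorem finState_apply (s : Finset (Fin d → ℤ)) (a : (Fin d → ℤ) → EuclideanSpace ℂ (Fin L))
    (m : Fin d → ℤ) : finState s a m = if m ∈ s then a m else 0 := by
  classical
  induction s using Finset.induction_on with
  | empty => simp [finState]
  | insert n s hn ih =>
    have h : finState (insert n s) a = lp.single 2 n (a n) + finState s a := Finset.sum_insert hn
    rw [h, lp.coeFn_add, Pi.add_apply, ih, lp.single_apply]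
    by_cases hm : m = n
    · subst hm; simp [hn]
    · simp [hm]

theorem inner_finState_left (s : Finset (Fin d → ℤ)) (a : (Fin d → ℤ) → EuclideanSpace ℂ (Fin L))
    (φ : LatticeHilbert d L) : ⟪finState s a, φ⟫_ℂ = ∑ n ∈ s, ⟪a n, φ n⟫_ℂ := by
  simp [finState, sum_inner, lp.inner_single_left]

theorem norm_finState_sq (s : Finset (Fin d → ℤ)) (a : (Fin d → ℤ) → EuclideanSpace ℂ (Fin L)) :
    ‖finState s a‖ ^ 2 = ∑ n ∈ s, ‖a n‖ ^ 2 := by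
  have h := inner_finState_left s a (finState s a)
  rw [inner_self_eq_norm_sq_to_K] at h
  have h2 : ∑ n ∈ s, ⟪a n, finState s a n⟫_ℂ = ∑ n ∈ s, ((‖a n‖ : ℂ)) ^ 2 :=
    Finset.sum_congr rfl fun n hn => by
      rw [finState_apply, if_pos hn, inner_self_eq_norm_sq_to_K]; rfl
  rw [h2] at h
  exact Complex.ofReal_injective (by push_cast; exact h)

theorem tendsto_finState (φ : LatticeHilbert d L) :
    Tendsto (fun s : Finset (Fin d → ℤ) => finState s φ) atTop (𝓝 φ) :=
  lp.hasSum_single (by norm_num) φ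

theorem smul_finState (c : ℂ) (s : Finset (Fin d → ℤ))
    (a : (Fin d → ℤ) → EuclideanSpace ℂ (Fin L)) :
    c • finState s a = finState s fun n => c • a n := by
  simp [finState, Finset.smul_sum, lp.single_smul]

theorem norm_le_of_forall_finState {x : LatticeHilbert d L} {B : ℝ} (hB : 0 ≤ B)
    (h : ∀ s a, ‖finState s a‖ ≤ 1 → ‖⟪x, finState s a⟫_ℂ‖ ≤ B) : ‖x‖ ≤ B := by
  refine le_of_tendsto (tendsto_finState x).norm (Eventually.of_forall fun s => ?_)
  rcases (norm_nonneg (finState s x)).eq_or_lt with h0 | h0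
  · rw [← h0]; exact hB
  · have h1 : ‖((‖finState s x‖⁻¹ : ℝ) : ℂ) • finState s x‖ = 1 := by
      rw [norm_smul, Complex.norm_real, norm_inv, norm_norm, inv_mul_cancel₀ h0.ne']
    have h2 := h s (fun n => ((‖finState s x‖⁻¹ : ℝ) : ℂ) • x n) (by
      rw [← smul_finState, h1])
    rw [← smul_finState, inner_smul_right, norm_mul, Complex.norm_real, norm_inv, norm_norm] at h2
    have h3 : ⟪finState s x, x⟫_ℂ = ((‖finState s x‖ : ℂ)) ^ 2 := by
      rw [inner_finState_left, ← Complex.ofReal_pow, norm_finState_sq]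
      push_cast
      exact Finset.sum_congr rfl fun n _ => by rw [inner_self_eq_norm_sq_to_K]; rfl
    rw [← inner_conj_symm, h3, RCLike.norm_conj, norm_pow, Complex.norm_real, norm_norm, pow_two,
      ← mul_assoc, inv_mul_cancel₀ h0.ne', one_mul] at h2
    exact h2

/-- Operator norms need only be tested on finitely supported states, whose Fourier transforms are
trigonometric polynomials and in particular smooth. -/
theorem opNorm_le_of_forall_finState {T : BoundedOp d L} {B : ℝ} (hB : 0 ≤ B)
    (h : ∀ s a t b, ‖finState s a‖ ≤ 1 → ‖finState t b‖ ≤ 1 →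
      ‖⟪finState s a, T (finState t b)⟫_ℂ‖ ≤ B) : ‖T‖ ≤ B := by
  have h1 : ∀ t b, ‖finState t b‖ ≤ 1 → ‖T (finState t b)‖ ≤ B := fun t b hb =>
    norm_le_of_forall_finState hB fun s a ha => by
      rw [norm_inner_symm]; exact h s a t b ha hb
  refine T.opNorm_le_bound hB fun x => ?_
  have h2 : Tendsto (fun s => ‖T (finState s x)‖) atTop (𝓝 ‖T x‖) :=
    ((T.continuous.tendsto x).comp (tendsto_finState x)).norm
  refine le_of_tendsto_of_tendsto h2 ((tendsto_finState x).norm.const_mul B)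
    (Eventually.of_forall fun s => ?_)
  rcases (norm_nonneg (finState s x)).eq_or_lt with h0 | h0
  · have : finState s x = 0 := norm_eq_zero.1 h0.symm
    simp [this]
  · have h3 : ‖((‖finState s x‖⁻¹ : ℝ) : ℂ) • finState s x‖ = 1 := by
      rw [norm_smul, Complex.norm_real, norm_inv, norm_norm, inv_mul_cancel₀ h0.ne']
    have h4 := h1 s (fun n => ((‖finState s x‖⁻¹ : ℝ) : ℂ) • x n) (by
      rw [← smul_finState, h3])
    rw [← smul_finState, map_smul, norm_smul, Complex.norm_real, norm_inv, norm_norm] at h4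
    rwa [inv_mul_le_iff₀ h0, mul_comm] at h4

end finState

end LAP

/-! ### Symbols of operators; the symbol of the squared resolvent. -/

namespace LAP

variable {d L : ℕ}

theorem latticeFourier_finState (s : Finset (Fin d → ℤ))
    (a : (Fin d → ℤ) → EuclideanSpace ℂ (Fin L)) (k : Mom d) (i : Fin L) :
    latticeFourier (finState s a) k i =
      (((2 * Real.pi) ^ (-(d : ℝ) / 2) : ℝ) : ℂ) * trigPoly s (fun n => a n i) k := by
  have h : ∑' n : Fin d → ℤ, Complex.exp (-Complex.I * ((∑ i, k i * (n i : ℝ) : ℝ) : ℂ)) •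
      finState s a n = ∑ n ∈ s, planeWave n k • a n := by
    rw [tsum_eq_sum (s := s) fun n hn => by rw [finState_apply, if_neg hn, smul_zero]]
    exact Finset.sum_congr rfl fun n hn => by rw [finState_apply, if_pos hn, planeWave]
  rw [latticeFourier, h]
  simp [trigPoly, mul_comm]

theorem summable_norm_finState (s : Finset (Fin d → ℤ))
    (a : (Fin d → ℤ) → EuclideanSpace ℂ (Fin L)) : Summable fun n => ‖finState s a n‖ :=
  summable_of_ne_finset_zero (s := s) fun n hn => by rw [finState_apply, if_neg hn, norm_zero]

theorem continuous_latticeFourier_finState (s : Finset (Fin d → ℤ))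
    (a : (Fin d → ℤ) → EuclideanSpace ℂ (Fin L)) : Continuous (latticeFourier (finState s a)) := by
  have h : Continuous fun k i => latticeFourier (finState s a) k i := continuous_pi fun i => by
    simp only [latticeFourier_finState]
    exact continuous_const.mul (contDiff_trigPoly (m := 0) s _).continuous
  exact (PiLp.continuous_toLp 2 _).comp h

theorem recipPeriodic_latticeFourier_finState (s : Finset (Fin d → ℤ))
    (a : (Fin d → ℤ) → EuclideanSpace ℂ (Fin L)) :
    RecipPeriodic (latticeFourier (finState s a)) := fun k m => by
  ext i
  rw [latticeFourier_finState, latticeFourier_finState, recipPeriodic_trigPoly]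

theorem fourier_constant_sq (d : ℕ) : ((2 * Real.pi) ^ (-(d : ℝ) / 2)) ^ 2 * (2 * Real.pi) ^ d = 1 := by
  have h : 0 < 2 * Real.pi := by positivity
  rw [← Real.rpow_natCast, ← Real.rpow_mul h.le, ← Real.rpow_natCast, ← Real.rpow_add h]
  simp

theorem inner_finState_eq_integral (s t : Finset (Fin d → ℤ))
    (a b : (Fin d → ℤ) → EuclideanSpace ℂ (Fin L)) :
    ⟪finState s a, finState t b⟫_ℂ =
      ∫ k in brillouinCell d, ⟪latticeFourier (finState s a) k, latticeFourier (finState t b) k⟫_ℂ := by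
  set γ : ℝ := (2 * Real.pi) ^ (-(d : ℝ) / 2) with hγ
  have h1 : ∀ k, ⟪latticeFourier (finState s a) k, latticeFourier (finState t b) k⟫_ℂ =
      ∑ i, (γ : ℂ) ^ 2 *
        (conj (trigPoly s (fun n => a n i) k) * trigPoly t (fun n => b n i) k) := fun k => by
    rw [PiLp.inner_apply]
    refine Finset.sum_congr rfl fun i _ => ?_
    rw [latticeFourier_finState, latticeFourier_finState, RCLike.inner_apply, map_mul,
      Complex.conj_ofReal]
    ring
  have hi : ∀ i : Fin L, IntegrableOn (fun k => (γ : ℂ) ^ 2 *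
        (conj (trigPoly s (fun n => a n i) k) * trigPoly t (fun n => b n i) k)) (brillouinCell d) :=
    fun i => by
      rw [← shiftedCell_zero]
      exact integrableOn_shiftedCell 0 (continuous_const.mul ((Complex.continuous_conj.comp
        (contDiff_trigPoly (m := 0) s _).continuous).mul
        (contDiff_trigPoly (m := 0) t _).continuous))
  simp only [h1]
  rw [integral_finsetSum _ fun i _ => hi i]
  simp only [integral_const_mul]
  simp only [← shiftedCell_zero, setIntegral_conj_trigPoly_mul]
  have h2 : (γ : ℂ) ^ 2 * (2 * (Real.pi : ℂ)) ^ d = 1 := by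
    have h3 : ((γ ^ 2 * (2 * Real.pi) ^ d : ℝ) : ℂ) = ((1 : ℝ) : ℂ) :=
      congrArg _ (fourier_constant_sq d)
    push_cast at h3
    exact h3
  simp only [← mul_assoc, h2, one_mul]
  rw [inner_finState_left, Finset.sum_comm]
  refine Finset.sum_congr rfl fun n _ => ?_
  rw [finState_apply, PiLp.inner_apply]
  refine Finset.sum_congr rfl fun i _ => ?_
  split_ifs
  · rw [RCLike.inner_apply, mul_comm]
  · simp

theorem integral_norm_latticeFourier_sq (s : Finset (Fin d → ℤ))
    (a : (Fin d → ℤ) → EuclideanSpace ℂ (Fin L)) :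
    ∫ k in brillouinCell d, ‖latticeFourier (finState s a) k‖ ^ 2 = ‖finState s a‖ ^ 2 := by
  have h := inner_finState_eq_integral s s a a
  simp only [inner_self_eq_norm_sq_to_K] at h
  have h2 : ∫ k in brillouinCell d, ((‖latticeFourier (finState s a) k‖ : ℂ)) ^ 2 =
      ((∫ k in brillouinCell d, ‖latticeFourier (finState s a) k‖ ^ 2 : ℝ) : ℂ) := by
    rw [← integral_complex_ofReal]; push_cast; rfl
  refine (Complex.ofReal_injective ?_).symm
  rw [← h2, Complex.ofReal_pow]
  exact h

theorem exists_finState_near {w : Mom d → EuclideanSpace ℂ (Fin L)} (hw : Continuous w)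
    (hper : RecipPeriodic w) {ε : ℝ} (hε : 0 < ε) :
    ∃ s a, ∀ k, ‖w k - latticeFourier (finState s a) k‖ ≤ ε := by
  set γ : ℝ := (2 * Real.pi) ^ (-(d : ℝ) / 2) with hγ
  have hγ0 : 0 < γ := Real.rpow_pos_of_pos (by positivity) _
  have hγ1 : (γ : ℂ) ≠ 0 := Complex.ofReal_ne_zero.2 hγ0.ne'
  have h1 : ∀ i : Fin L, ∃ (s : Finset (Fin d → ℤ)) (a : (Fin d → ℤ) → ℂ),
      (∀ n ∉ s, a n = 0) ∧ ∀ k, ‖w k i - trigPoly s a k‖ ≤ ε / (L + 1) := fun i =>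
    exists_trigPoly_near ((EuclideanSpace.proj (𝕜 := ℂ) i).continuous.comp hw)
      (fun k n => by rw [Function.comp_apply, Function.comp_apply, hper]) (by positivity)
  choose s a hs ha using h1
  classical
  refine ⟨Finset.univ.biUnion s, fun n => WithLp.toLp 2 fun i => (γ : ℂ)⁻¹ * a i n, fun k => ?_⟩
  have h2 : ∀ i, latticeFourier (finState (Finset.univ.biUnion s)
      fun n => (WithLp.toLp 2 fun i => (γ : ℂ)⁻¹ * a i n : EuclideanSpace ℂ (Fin L))) k i =
      trigPoly (s i) (a i) k := fun i => by
    rw [latticeFourier_finState, trigPoly, trigPoly, Finset.mul_sum]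
    symm
    have hsub : s i ⊆ Finset.univ.biUnion s := Finset.subset_biUnion_of_mem s (Finset.mem_univ i)
    rw [Finset.sum_subset hsub fun n _ hn => by rw [hs i n hn, zero_mul]]
    refine Finset.sum_congr rfl fun n _ => ?_
    simp only [← hγ]
    field_simp
  have h3 : ∀ v : EuclideanSpace ℂ (Fin L), ‖v‖ ≤ ∑ i, ‖v i‖ := fun v => by
    rw [EuclideanSpace.norm_eq]
    refine Real.sqrt_le_iff.2 ⟨Finset.sum_nonneg fun i _ => norm_nonneg _, ?_⟩
    exact Finset.sum_sq_le_sq_sum_of_nonneg fun i _ => norm_nonneg _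
  refine (h3 _).trans ?_
  calc _ ≤ ∑ i : Fin L, ε / (L + 1) := Finset.sum_le_sum fun i _ => by
        rw [PiLp.sub_apply, h2]; exact ha i k
    _ = L * (ε / (L + 1)) := by simp
    _ ≤ ε := by
      rw [← mul_div_assoc, div_le_iff₀ (by positivity)]
      nlinarith

theorem norm_toEuclideanLin_le (A : Matrix (Fin L) (Fin L) ℂ) (v : EuclideanSpace ℂ (Fin L)) :
    ‖Matrix.toEuclideanLin A v‖ ≤ (∑ i, ∑ j, ‖A i j‖) * ‖v‖ := by
  have h3 : ∀ v : EuclideanSpace ℂ (Fin L), ‖v‖ ≤ ∑ i, ‖v i‖ := fun v => by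
    rw [EuclideanSpace.norm_eq]
    refine Real.sqrt_le_iff.2 ⟨Finset.sum_nonneg fun i _ => norm_nonneg _, ?_⟩
    exact Finset.sum_sq_le_sq_sum_of_nonneg fun i _ => norm_nonneg _
  refine (h3 _).trans ?_
  rw [Finset.sum_mul]
  refine Finset.sum_le_sum fun i _ => ?_
  rw [Matrix.toLpLin_apply, Finset.sum_mul]
  simp only [Matrix.mulVec, dotProduct]
  refine (norm_sum_le _ _).trans (Finset.sum_le_sum fun j _ => ?_)
  rw [norm_mul]
  exact mul_le_mul_of_nonneg_left (PiLp.norm_apply_le v j) (norm_nonneg _)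

theorem continuous_toEuclideanLin {K : Mom d → Matrix (Fin L) (Fin L) ℂ} (hK : Continuous K)
    {u : Mom d → EuclideanSpace ℂ (Fin L)} (hu : Continuous u) :
    Continuous fun k => Matrix.toEuclideanLin (K k) (u k) := by
  simp only [Matrix.toLpLin_apply]
  exact (PiLp.continuous_toLp 2 _).comp (hK.matrix_mulVec ((PiLp.continuous_ofLp 2 _).comp hu))

theorem exists_bound_toEuclideanLin {K : Mom d → Matrix (Fin L) (Fin L) ℂ} (hK : Continuous K) :
    ∃ M, 0 ≤ M ∧ ∀ k ∈ brillouinCell d, ∀ v, ‖Matrix.toEuclideanLin (K k) v‖ ≤ M * ‖v‖ := by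
  have hc : Continuous fun k => ∑ i, ∑ j, ‖K k i j‖ :=
    continuous_finsetSum _ fun i _ => continuous_finsetSum _ fun j _ => (hK.matrix_elem i j).norm
  obtain ⟨M, hM⟩ := (isCompact_closedBall (0 : Mom d) (d * Real.pi)).exists_bound_of_continuousOn
    hc.continuousOn
  refine ⟨max M 0, le_max_right _ _, fun k hk v => (norm_toEuclideanLin_le _ v).trans ?_⟩
  rw [← shiftedCell_zero] at hk
  exact mul_le_mul_of_nonneg_right (((le_abs_self _).trans
    (hM k (shiftedCell_subset_closedBall 0 hk))).trans (le_max_left _ _)) (norm_nonneg v)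

/-- The Fourier transform conjugates `T` to multiplication by `K`, on finitely supported states. -/
def HasSymbol (T : BoundedOp d L) (K : Mom d → Matrix (Fin L) (Fin L) ℂ) : Prop :=
  ∀ s a t b, ⟪finState s a, T (finState t b)⟫_ℂ = ∫ k in brillouinCell d,
    ⟪latticeFourier (finState s a) k,
      Matrix.toEuclideanLin (K k) (latticeFourier (finState t b) k)⟫_ℂ

theorem hasSymbol_one : HasSymbol (1 : BoundedOp d L) fun _ => 1 := fun s a t b => by
  simpa [Matrix.toLpLin_one] using inner_finState_eq_integral s t a b

theorem IsAnalyticSymbol.hasSymbol {H : BoundedOp d L} {𝓔 : Mom d → Matrix (Fin L) (Fin L) ℂ}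
    (h : IsAnalyticSymbol H 𝓔) : HasSymbol H 𝓔 := fun s a t b =>
  h.fourier _ _ (summable_norm_finState t b) (summable_norm_finState s a)

theorem IsAnalyticSymbol.continuous {H : BoundedOp d L} {𝓔 : Mom d → Matrix (Fin L) (Fin L) ℂ}
    (h : IsAnalyticSymbol H 𝓔) : Continuous 𝓔 :=
  continuous_matrix fun i j => continuousOn_univ.1 (h.analytic i j).continuousOn

theorem det_sub_smul_one_ne_zero {A : Matrix (Fin L) (Fin L) ℂ} (hA : A.IsHermitian) {z : ℂ}
    (hz : z.im ≠ 0) : (A - z • 1).det ≠ 0 := fun h0 => by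
  obtain ⟨v, hv, hAv⟩ := Matrix.exists_mulVec_eq_zero_iff.2 h0
  have h1 : A *ᵥ v = z • v := by
    rw [Matrix.sub_mulVec, Matrix.smul_mulVec, Matrix.one_mulVec, sub_eq_zero] at hAv
    exact hAv
  have h2 := hA.im_star_dotProduct_mulVec_self v
  rw [h1, dotProduct_smul] at h2
  have h3 : star v ⬝ᵥ v = ((∑ i, ‖v i‖ ^ 2 : ℝ) : ℂ) := by
    simp [dotProduct, Complex.conj_mul']
  rw [h3, smul_eq_mul] at h2
  simp only [RCLike.im_to_complex, Complex.im_mul_ofReal] at h2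
  rcases mul_eq_zero.1 h2 with h | h
  · exact hz h
  · rw [Finset.sum_eq_zero_iff_of_nonneg fun i _ => by positivity] at h
    exact hv (funext fun i => by simpa using h i (Finset.mem_univ i))

theorem continuous_matrix_inv {X : Type*} [TopologicalSpace X] {K : X → Matrix (Fin L) (Fin L) ℂ}
    (hK : Continuous K) (h0 : ∀ k, (K k).det ≠ 0) : Continuous fun k => (K k)⁻¹ := by
  simp only [Matrix.inv_def, Ring.inverse_eq_inv']
  exact (hK.matrix_det.inv₀ h0).smul hK.matrix_adjugate

theorem inner_toEuclideanLin_conjTranspose (A : Matrix (Fin L) (Fin L) ℂ)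
    (v w : EuclideanSpace ℂ (Fin L)) :
    ⟪Matrix.toEuclideanLin Aᴴ v, w⟫_ℂ = ⟪v, Matrix.toEuclideanLin A w⟫_ℂ := by
  rw [Matrix.toEuclideanLin_conjTranspose_eq_adjoint, LinearMap.adjoint_inner_left]

theorem integrableOn_brillouinCell {F : Type*} [NormedAddCommGroup F] {f : Mom d → F}
    (hf : Continuous f) : IntegrableOn f (brillouinCell d) := by
  rw [← shiftedCell_zero]; exact integrableOn_shiftedCell 0 hf

/-- Left multiplication of an operator by the resolvent, on the level of symbols. -/
theorem HasSymbol.resolvent_mul {H T R : BoundedOp d L} {𝓔 K : Mom d → Matrix (Fin L) (Fin L) ℂ}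
    (hH : HasSymbol H 𝓔) (h𝓔 : Continuous 𝓔) (hper : RecipPeriodic 𝓔)
    (hT : HasSymbol T K) (hK : Continuous K) {z : ℂ} (hdet : ∀ k, (𝓔 k - z • 1).det ≠ 0)
    (hR : (H - algebraMap ℂ (BoundedOp d L) z) * R = 1) :
    HasSymbol (R * T) fun k => (𝓔 k - z • 1)⁻¹ * K k := fun s a t b => by
  set ψ := finState s a with hψ
  set φ := finState t b with hφ
  set A : Mom d → Matrix (Fin L) (Fin L) ℂ := fun k => 𝓔 k - z • 1 with hA
  have hAc : Continuous A := h𝓔.sub continuous_const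
  have hinv : Continuous fun k => (A k)⁻¹ := continuous_matrix_inv hAc hdet
  have hψc := continuous_latticeFourier_finState s a
  have hφc := continuous_latticeFourier_finState t b
  -- `R T φ` is not finitely supported, so the symbol of `H` cannot be tested on it. Instead the
  -- adjoint side is approximated: if the transform of a finite state `f` is uniformly close to `w`,
  -- then `g = (H - z)* f` is close to `ψ`, while `⟪g, R T φ⟫ = ⟪f, T φ⟫` involves only the symbol
  -- of `T`.
  set w : Mom d → EuclideanSpace ℂ (Fin L) := fun k =>
    Matrix.toEuclideanLin ((A k)⁻¹)ᴴ (latticeFourier ψ k) with hw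
  have hwc : Continuous w := continuous_toEuclideanLin hinv.matrix_conjTranspose hψc
  have hwper : RecipPeriodic w := fun k n => by
    simp only [hw, hA]
    rw [hper, hψ, recipPeriodic_latticeFourier_finState]
  obtain ⟨M, hM0, hM⟩ := exists_bound_toEuclideanLin hAc.matrix_conjTranspose
  set B := volume.real (brillouinCell d) with hB
  have hB0 : 0 ≤ B := measureReal_nonneg
  set Q := ∫ k in brillouinCell d, ‖Matrix.toEuclideanLin (K k) (latticeFourier φ k)‖ with hQ
  have hQ0 : 0 ≤ Q := integral_nonneg fun k => norm_nonneg _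
  have hi := @integrableOn_brillouinCell d
  have hmeas : MeasurableSet (brillouinCell d) := by
    rw [← shiftedCell_zero]; exact measurableSet_shiftedCell 0
  have hfin : volume (brillouinCell d) ≠ ⊤ := by
    rw [← shiftedCell_zero]
    exact ((measure_mono (shiftedCell_subset_closedBall 0)).trans_lt
      (isCompact_closedBall _ _).measure_lt_top).ne
  have hKφ := continuous_toEuclideanLin hK hφc
  have hsym : ∀ k, ⟪latticeFourier ψ k,
      Matrix.toEuclideanLin ((A k)⁻¹ * K k) (latticeFourier φ k)⟫_ℂ =
      ⟪w k, Matrix.toEuclideanLin (K k) (latticeFourier φ k)⟫_ℂ := fun k => by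
    rw [hw, inner_toEuclideanLin_conjTranspose]
    simp only [Matrix.toLpLin_apply, Matrix.mulVec_mulVec]
  have key : ∀ ε : ℝ, 0 < ε → ‖⟪ψ, (R * T) φ⟫_ℂ - ∫ k in brillouinCell d, ⟪latticeFourier ψ k,
      Matrix.toEuclideanLin ((A k)⁻¹ * K k) (latticeFourier φ k)⟫_ℂ‖ ≤
      ε * (M * ((B + 1) / 2) * ‖R (T φ)‖ + Q) := fun ε hε => by
    obtain ⟨s', a', hf⟩ := exists_finState_near hwc hwper hε
    set f := finState s' a' with hfdef
    have hfc := continuous_latticeFourier_finState s' a'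
    set g := ContinuousLinearMap.adjoint (H - algebraMap ℂ (BoundedOp d L) z) f with hg
    -- The factor `(B + 1) / 2` is the integral of `(1 + x²) / 2 ≥ x`, where `x` is the norm of the
    -- transform of a normalised test state and `B` the volume of the cell.
    have h1 : ‖ψ - g‖ ≤ M * ε * ((B + 1) / 2) := by
      refine norm_le_of_forall_finState (by positivity) fun s₂ a₂ h₂ => ?_
      have hc := continuous_latticeFourier_finState s₂ a₂
      have i1 : Integrable (fun k => ⟪latticeFourier f k, latticeFourier (finState s₂ a₂) k⟫_ℂ)
          (volume.restrict (brillouinCell d)) := hi (hfc.inner hc)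
      have i2 : Integrable (fun k => ⟪latticeFourier f k,
          Matrix.toEuclideanLin (𝓔 k) (latticeFourier (finState s₂ a₂) k)⟫_ℂ)
          (volume.restrict (brillouinCell d)) := hi (hfc.inner (continuous_toEuclideanLin h𝓔 hc))
      have i3 : Integrable (fun k => ⟪latticeFourier ψ k, latticeFourier (finState s₂ a₂) k⟫_ℂ)
          (volume.restrict (brillouinCell d)) := hi (hψc.inner hc)
      have i4 : Integrable (fun k => ⟪latticeFourier f k,
          Matrix.toEuclideanLin (𝓔 k) (latticeFourier (finState s₂ a₂) k)⟫_ℂ -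
          z * ⟪latticeFourier f k, latticeFourier (finState s₂ a₂) k⟫_ℂ)
          (volume.restrict (brillouinCell d)) := i2.sub (i1.const_mul z)
      have i5 : Integrable (fun k => ‖latticeFourier (finState s₂ a₂) k‖ ^ 2)
          (volume.restrict (brillouinCell d)) := hi (hc.norm.pow 2)
      have e1 : ⟪ψ - g, finState s₂ a₂⟫_ℂ = ∫ k in brillouinCell d,
          ⟪Matrix.toEuclideanLin (A k)ᴴ (w k - latticeFourier f k),
            latticeFourier (finState s₂ a₂) k⟫_ℂ := by
        rw [inner_sub_left, hg, ContinuousLinearMap.adjoint_inner_left, sub_apply, inner_sub_right,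
          hψ, inner_finState_eq_integral, hfdef, hH, ContinuousLinearMap.algebraMap_apply,
          inner_smul_right, inner_finState_eq_integral, ← integral_const_mul,
          ← integral_sub i2 (i1.const_mul z), ← integral_sub i3 i4]
        congr 1
        ext k
        have e2 : Matrix.toEuclideanLin (A k)ᴴ (w k) = latticeFourier ψ k := by
          simp only [hw, Matrix.toLpLin_apply, Matrix.mulVec_mulVec]
          rw [← Matrix.conjTranspose_mul, Matrix.nonsing_inv_mul _ (isUnit_iff_ne_zero.2 (hdet k))]
          simp
        rw [map_sub, e2, inner_sub_left, inner_toEuclideanLin_conjTranspose, hA]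
        simp only [map_sub, LinearMap.sub_apply, map_smul, LinearMap.smul_apply, Matrix.toLpLin_one,
          LinearMap.id_apply, inner_sub_right, inner_smul_right]
        rfl
      rw [e1]
      have hint : IntegrableOn (fun k => M * ε * ((1 + ‖latticeFourier (finState s₂ a₂) k‖ ^ 2) / 2))
          (brillouinCell d) :=
        hi (continuous_const.mul ((continuous_const.add (hc.norm.pow 2)).div_const 2))
      refine (norm_integral_le_of_norm_le hint ((ae_restrict_iff' hmeas).2
        (Eventually.of_forall fun k hk => ?_))).trans ?_
      · refine (norm_inner_le_norm _ _).trans ?_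
        have e3 : ‖Matrix.toEuclideanLin (A k)ᴴ (w k - latticeFourier f k)‖ ≤ M * ε :=
          (hM k hk _).trans (mul_le_mul_of_nonneg_left (hf k) hM0)
        refine mul_le_mul e3 ?_ (norm_nonneg _) (by positivity)
        nlinarith [sq_nonneg (‖latticeFourier (finState s₂ a₂) k‖ - 1)]
      · rw [integral_const_mul, integral_div, integral_add (hi continuous_const) i5, integral_norm_latticeFourier_sq, setIntegral_const, smul_eq_mul,
          mul_one]
        have : ‖finState s₂ a₂‖ ^ 2 ≤ 1 := pow_le_one₀ (norm_nonneg _) h₂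
        gcongr
    have h2 : ⟪g, R (T φ)⟫_ℂ = ⟪f, T φ⟫_ℂ := by
      rw [hg, ContinuousLinearMap.adjoint_inner_left, ← mul_apply_eq_comp, hR,
        one_apply_eq_self]
    have h3 : ‖⟪f, T φ⟫_ℂ - ∫ k in brillouinCell d,
        ⟪w k, Matrix.toEuclideanLin (K k) (latticeFourier φ k)⟫_ℂ‖ ≤ ε * Q := by
      rw [hfdef, hφ, hT, ← integral_sub (hi (hfc.inner hKφ)) (hi (hwc.inner hKφ)), hQ,
        ← integral_const_mul]
      refine norm_integral_le_of_norm_le (hi (continuous_const.mul hKφ.norm))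
        (Eventually.of_forall fun k => ?_)
      rw [← inner_sub_left]
      refine (norm_inner_le_norm _ _).trans ?_
      rw [norm_sub_rev]
      exact mul_le_mul_of_nonneg_right (hf k) (norm_nonneg _)
    have h4 : ⟪ψ, (R * T) φ⟫_ℂ = ⟪ψ - g, R (T φ)⟫_ℂ + ⟪f, T φ⟫_ℂ := by
      rw [← h2, ← inner_add_left, sub_add_cancel, mul_apply_eq_comp]
    simp only [hsym]
    rw [h4, add_sub_assoc]
    calc _ ≤ _ := norm_add_le _ _
      _ ≤ M * ε * ((B + 1) / 2) * ‖R (T φ)‖ + ε * Q := add_le_add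
        ((norm_inner_le_norm _ _).trans (mul_le_mul_of_nonneg_right h1 (norm_nonneg _))) h3
      _ = _ := by ring
  rw [← sub_eq_zero, ← norm_le_zero_iff]
  refine le_of_forall_pos_le_add fun δ hδ => ?_
  set N := M * ((B + 1) / 2) * ‖R (T φ)‖ + Q with hN
  have hN0 : 0 ≤ N := by positivity
  refine (key (δ / (N + 1)) (by positivity)).trans ?_
  rw [zero_add, div_mul_eq_mul_div, div_le_iff₀ (by positivity)]
  nlinarith

/-- The square of the resolvent has symbol `(𝓔 - z)⁻²`. -/
theorem IsAnalyticSymbol.hasSymbol_resolvent_sq {H R : BoundedOp d L}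
    {𝓔 : Mom d → Matrix (Fin L) (Fin L) ℂ} (h : IsAnalyticSymbol H 𝓔) {z : ℂ} (hz : z.im ≠ 0)
    (hR : (H - algebraMap ℂ (BoundedOp d L) z) * R = 1) :
    HasSymbol (R * R) fun k => (𝓔 k - z • 1)⁻¹ * (𝓔 k - z • 1)⁻¹ := by
  have hdet : ∀ k, (𝓔 k - z • 1).det ≠ 0 := fun k => det_sub_smul_one_ne_zero (h.isHermitian k) hz
  have h1 := h.hasSymbol.resolvent_mul h.continuous h.periodic hasSymbol_one continuous_const hdet hR
  simp only [mul_one] at h1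
  exact h.hasSymbol.resolvent_mul h.continuous h.periodic h1
    (continuous_matrix_inv (h.continuous.sub continuous_const) hdet) hdet hR

end LAP

/-! ### From a derivative bound to boundary values. -/

namespace LAP

section boundary

variable {X : Type*} [NormedAddCommGroup X] [NormedSpace ℂ X] {F G : ℂ → X} {C β : ℝ}

theorem norm_sub_le_of_deriv_bound (hβ : 0 < β)
    (hF : ∀ z : ℂ, 0 < z.im → HasDerivAt F (G z) z)
    (hG : ∀ z : ℂ, 0 < z.im → z.im ≤ 1 → ‖G z‖ ≤ C * z.im ^ (β - 1)) (E : ℝ) {δ ε : ℝ}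
    (hδ : 0 < δ) (hδε : δ ≤ ε) (hε : ε ≤ 1) :
    ‖F (E + Complex.I * ε) - F (E + Complex.I * δ)‖ ≤ C / β * (ε ^ β - δ ^ β) := by
  have him : ∀ t : ℝ, ((E : ℂ) + Complex.I * t).im = t := fun t => by simp
  have hd : ∀ t : ℝ, 0 < t → HasDerivAt (fun t : ℝ => F (E + Complex.I * t) - F (E + Complex.I * δ))
      (Complex.I • G (E + Complex.I * t)) t := fun t ht => by
    have h1 : HasDerivAt (fun t : ℝ => (E : ℂ) + Complex.I * t) Complex.I t := by
      simpa using ((Complex.ofRealCLM.hasDerivAt (x := t)).const_mul Complex.I).const_add (E : ℂ)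
    exact ((hF _ (by rw [him]; exact ht)).scomp t h1).sub_const _
  have hB : ∀ t : ℝ, 0 < t → HasDerivAt (fun t : ℝ => C / β * (t ^ β - δ ^ β))
      (C * t ^ (β - 1)) t := fun t ht => by
    have h1 := ((Real.hasDerivAt_rpow_const (x := t) (p := β) (Or.inl ht.ne')).sub_const
      (δ ^ β)).const_mul (C / β)
    have h2 : C * t ^ (β - 1) = C / β * (β * t ^ (β - 1)) := by field_simp
    rw [h2]
    exact h1
  refine image_norm_le_of_norm_deriv_right_le_deriv_boundary' (a := δ) (b := ε)
    (f' := fun t => Complex.I • G (E + Complex.I * t)) (B' := fun t => C * t ^ (β - 1))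
    (fun t ht => (hd t (hδ.trans_le ht.1)).continuousAt.continuousWithinAt)
    (fun t ht => (hd t (hδ.trans_le ht.1)).hasDerivWithinAt) (by simp)
    (fun t ht => (hB t (hδ.trans_le ht.1)).continuousAt.continuousWithinAt)
    (fun t ht => (hB t (hδ.trans_le ht.1)).hasDerivWithinAt) (fun t ht => ?_)
    ⟨hδε, le_rfl⟩
  rw [norm_smul, Complex.norm_I, one_mul]
  have := hG (E + Complex.I * t) (by rw [him]; exact hδ.trans_le ht.1)
    (by rw [him]; exact ht.2.le.trans hε)
  rwa [him] at this

theorem exists_tendsto_of_deriv_bound [CompleteSpace X] (hC : 0 ≤ C) (hβ : 0 < β)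
    (hF : ∀ z : ℂ, 0 < z.im → HasDerivAt F (G z) z)
    (hG : ∀ z : ℂ, 0 < z.im → z.im ≤ 1 → ‖G z‖ ≤ C * z.im ^ (β - 1)) (E : ℝ) :
    ∃ x, Tendsto (fun ε : ℝ => F (E + Complex.I * ε)) (𝓝[>] 0) (𝓝 x) := by
  refine cauchy_map_iff_exists_tendsto.1 (Metric.cauchy_iff.2 ⟨inferInstance, fun ε hε => ?_⟩)
  have hlim : Tendsto (fun t : ℝ => C / β * t ^ β) (𝓝[>] 0) (𝓝 0) := by
    have h1 : Tendsto (fun t : ℝ => C / β * t ^ β) (𝓝 0) (𝓝 (C / β * 0 ^ β)) :=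
      ((Real.continuousAt_rpow_const 0 β (Or.inr hβ.le)).tendsto).const_mul _
    rw [Real.zero_rpow hβ.ne', mul_zero] at h1
    exact h1.mono_left nhdsWithin_le_nhds
  have hev : ∀ᶠ t : ℝ in 𝓝[>] 0, C / β * t ^ β < ε ∧ 0 < t ∧ t ≤ 1 :=
    (hlim.eventually (gt_mem_nhds hε)).and (eventually_mem_nhdsWithin.and
      (mem_nhdsWithin_of_mem_nhds (Iic_mem_nhds one_pos)))
  have hC' : 0 ≤ C / β := by positivity
  have key : ∀ s t : ℝ, 0 < s → s ≤ t → t ≤ 1 → C / β * t ^ β < ε →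
      dist (F (E + Complex.I * s)) (F (E + Complex.I * t)) < ε := fun s t hs hst ht h => by
    rw [dist_comm, dist_eq_norm]
    refine ((norm_sub_le_of_deriv_bound hβ hF hG E hs hst ht).trans ?_).trans_lt h
    exact mul_le_mul_of_nonneg_left (sub_le_self _ (Real.rpow_nonneg hs.le _)) hC'
  refine ⟨_, image_mem_map hev, ?_⟩
  rintro _ ⟨s, hs, rfl⟩ _ ⟨t, ht, rfl⟩
  rcases le_total s t with h | h
  · exact key s t hs.2.1 h ht.2.2 ht.1
  · rw [dist_comm]; exact key t s ht.2.1 h hs.2.2 hs.1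

/-- With `h = |E - E'| ≤ 1`, the path goes from `E` up to height `h`, horizontally, and down to
`E'`. The vertical legs cost `C / β * h ^ β` each and the horizontal one `C h^{β-1} · h`. For `h >
1` the boundary values are bounded through the bound at height `1`. -/
theorem exists_holder_of_deriv_bound (hC : 0 ≤ C) (hβ : 0 < β)
    (hF : ∀ z : ℂ, 0 < z.im → HasDerivAt F (G z) z)
    (hG : ∀ z : ℂ, 0 < z.im → z.im ≤ 1 → ‖G z‖ ≤ C * z.im ^ (β - 1)) {M : ℝ}
    (hM : ∀ z : ℂ, z.im = 1 → ‖F z‖ ≤ M) {F₀ : ℝ → X}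
    (hF₀ : ∀ E : ℝ, Tendsto (fun ε : ℝ => F (E + Complex.I * ε)) (𝓝[>] 0) (𝓝 (F₀ E))) :
    ∃ C' : ℝ, ∀ E E' : ℝ, ‖F₀ E - F₀ E'‖ ≤ C' * |E - E'| ^ β := by
  have hC' : 0 ≤ C / β := by positivity
  have h1 : ∀ (E : ℝ) {h : ℝ}, 0 < h → h ≤ 1 → ‖F (E + Complex.I * h) - F₀ E‖ ≤ C / β * h ^ β :=
    fun E h h0 h1 => by
      refine le_of_tendsto ((tendsto_const_nhds.sub (hF₀ E)).norm) ?_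
      filter_upwards [eventually_mem_nhdsWithin, mem_nhdsWithin_of_mem_nhds (Iic_mem_nhds h0)]
        with δ hδ hδh
      exact (norm_sub_le_of_deriv_bound hβ hF hG E hδ hδh h1).trans
        (mul_le_mul_of_nonneg_left (sub_le_self _ (Real.rpow_nonneg (le_of_lt hδ) _)) hC')
  have hM0 : 0 ≤ M := (norm_nonneg _).trans (hM Complex.I (by simp))
  refine ⟨2 * (C / β) + C + 2 * M, fun E E' => ?_⟩
  set h := |E - E'| with hh
  rcases (abs_nonneg (E - E')).eq_or_lt with h0 | h0
  · have : E = E' := sub_eq_zero.1 (abs_eq_zero.1 h0.symm)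
    subst this
    rw [sub_self, norm_zero]
    positivity
  rcases le_or_gt h 1 with hle | hlt
  · have h2 : ‖F (E + Complex.I * h) - F (E' + Complex.I * h)‖ ≤ C * h ^ (β - 1) * h := by
      have him : ∀ x : ℝ, ((x : ℂ) + Complex.I * h).im = h := fun x => by simp
      have hconv : Convex ℝ {z : ℂ | z.im = h} :=
        (convex_singleton h).linear_preimage Complex.imLm
      have h3 := hconv.norm_image_sub_le_of_norm_hasDerivWithin_le (f := F) (f' := G)
        (C := C * h ^ (β - 1)) (x := E' + Complex.I * h) (y := E + Complex.I * h)
        (fun z hz => (hF z (by rw [show z.im = h from hz]; exact h0)).hasDerivWithinAt)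
        (fun z hz => by
          have hz' : z.im = h := hz
          have := hG z (by rw [hz']; exact h0) (by rw [hz']; exact hle)
          rwa [hz'] at this) (him E') (him E)
      have h4 : ‖(E : ℂ) + Complex.I * h - (E' + Complex.I * h)‖ = h := by
        rw [add_sub_add_right_eq_sub, ← Complex.ofReal_sub, Complex.norm_real, Real.norm_eq_abs]
      rwa [h4] at h3
    have h3 : h ^ (β - 1) * h = h ^ β := by
      rw [Real.rpow_sub_one h0.ne', div_mul_cancel₀ _ h0.ne']
    rw [mul_assoc, h3] at h2
    have h4 : F₀ E - F₀ E' = -(F (E + Complex.I * h) - F₀ E) +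
        (F (E + Complex.I * h) - F (E' + Complex.I * h)) + (F (E' + Complex.I * h) - F₀ E') := by
      abel
    have hp : 0 ≤ h ^ β := Real.rpow_nonneg h0.le _
    calc _ ≤ C / β * h ^ β + C * h ^ β + C / β * h ^ β := by
          rw [h4]
          refine (norm_add₃_le).trans ?_
          rw [norm_neg]
          exact add_le_add (add_le_add (h1 E h0 hle) h2) (h1 E' h0 hle)
      _ ≤ _ := by nlinarith
  · have h2 : ∀ E, ‖F₀ E‖ ≤ M + C / β := fun E => by
      have h3 := h1 E one_pos le_rfl
      rw [Real.one_rpow, mul_one] at h3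
      have h4 := hM (E + Complex.I * (1 : ℝ)) (by simp)
      calc ‖F₀ E‖ = ‖F (E + Complex.I * (1 : ℝ)) - (F (E + Complex.I * (1 : ℝ)) - F₀ E)‖ := by
            rw [sub_sub_cancel]
        _ ≤ _ := (norm_sub_le _ _).trans (add_le_add h4 h3)
    have hp : 1 ≤ h ^ β := Real.one_le_rpow hlt.le hβ.le
    calc _ ≤ (M + C / β) + (M + C / β) := (norm_sub_le _ _).trans (add_le_add (h2 E) (h2 E'))
      _ ≤ (2 * (C / β) + C + 2 * M) * 1 := by linarith
      _ ≤ _ := mul_le_mul_of_nonneg_left hp (by positivity)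

end boundary

section resolvent

variable {d L : ℕ} {H : BoundedOp d L}

theorem isUnit_sub_algebraMap (hsa : IsSelfAdjoint H) {z : ℂ} (hz : z.im ≠ 0) :
    IsUnit (H - algebraMap ℂ (BoundedOp d L) z) := by
  have h : z ∉ spectrum ℂ H := fun h => hz (hsa.mem_spectrum_eq_re h ▸ Complex.ofReal_im _)
  have := (spectrum.notMem_iff.1 h).neg
  rwa [neg_sub] at this

theorem norm_ringInverse_le {T : BoundedOp d L} (hT : IsUnit T) {a : ℝ} (ha : 0 < a)
    (h : ∀ x, a * ‖x‖ ≤ ‖T x‖) : ‖Ring.inverse T‖ ≤ a⁻¹ := by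
  refine ContinuousLinearMap.opNorm_le_bound _ (by positivity) fun x => ?_
  have h1 := h (Ring.inverse T x)
  rw [← mul_apply_eq_comp, Ring.mul_inverse_cancel _ hT, one_apply_eq_self] at h1
  rwa [le_inv_mul_iff₀ ha]

theorem abs_im_mul_norm_le (hsa : IsSelfAdjoint H) (z : ℂ) (x : LatticeHilbert d L) :
    |z.im| * ‖x‖ ≤ ‖(H - algebraMap ℂ (BoundedOp d L) z) x‖ := by
  rcases (norm_nonneg x).eq_or_lt with h0 | h0
  · rw [← h0, mul_zero]; exact norm_nonneg _
  have h1 : (⟪x, (H - algebraMap ℂ (BoundedOp d L) z) x⟫_ℂ).im = -z.im * ‖x‖ ^ 2 := by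
    have h2 : (⟪x, H x⟫_ℂ).im = 0 := by
      exact hsa.isSymmetric.im_inner_self_apply x
    rw [sub_apply, ContinuousLinearMap.algebraMap_apply, inner_sub_right, inner_smul_right,
      inner_self_eq_norm_sq_to_K, Complex.sub_im, h2]
    have : ((‖x‖ : ℂ)) ^ 2 = ((‖x‖ ^ 2 : ℝ) : ℂ) := by push_cast; rfl
    erw [this]
    rw [Complex.im_mul_ofReal]
    ring
  have h3 := (Complex.abs_im_le_norm _).trans (norm_inner_le_norm (𝕜 := ℂ) x
    ((H - algebraMap ℂ (BoundedOp d L) z) x))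
  rw [h1, abs_mul, abs_neg, abs_of_nonneg (sq_nonneg ‖x‖)] at h3
  nlinarith

theorem abs_re_sub_mul_norm_le (z : ℂ) (x : LatticeHilbert d L) :
    (|z.re| - ‖H‖) * ‖x‖ ≤ ‖(H - algebraMap ℂ (BoundedOp d L) z) x‖ := by
  rw [sub_apply, ContinuousLinearMap.algebraMap_apply, norm_sub_rev]
  calc _ ≤ ‖z‖ * ‖x‖ - ‖H‖ * ‖x‖ := by
        rw [sub_mul]
        gcongr
        exact Complex.abs_re_le_norm z
    _ ≤ ‖z • x‖ - ‖H x‖ := by rw [norm_smul]; gcongr; exact H.le_opNorm x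
    _ ≤ _ := norm_sub_norm_le _ _

theorem hasDerivAt_resolvent (hsa : IsSelfAdjoint H) {z : ℂ} (hz : z.im ≠ 0) :
    HasDerivAt (fun z : ℂ => Ring.inverse (H - algebraMap ℂ (BoundedOp d L) z))
      (Ring.inverse (H - algebraMap ℂ (BoundedOp d L) z) *
        Ring.inverse (H - algebraMap ℂ (BoundedOp d L) z)) z := by
  obtain ⟨u, hu⟩ := isUnit_sub_algebraMap hsa hz
  have h1 := hasFDerivAt_ringInverse (𝕜 := ℂ) u
  rw [hu] at h1
  have h2 : HasDerivAt (fun z : ℂ => H - algebraMap ℂ (BoundedOp d L) z) (-1) z := by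
    simpa [Algebra.algebraMap_eq_smul_one] using
      (((hasDerivAt_id z).smul_const (1 : BoundedOp d L)).const_sub H)
  have h3 := h1.comp_hasDerivAt z h2
  refine h3.congr_deriv ?_
  rw [← hu, Ring.inverse_unit]
  simp

theorem hasDerivAt_dampedResolvent (hsa : IsSelfAdjoint H) {α : ℝ} (hα : 0 ≤ α) {z : ℂ}
    (hz : z.im ≠ 0) :
    HasDerivAt (dampedResolvent H α hα) (damping d L α hα *
      (Ring.inverse (H - algebraMap ℂ (BoundedOp d L) z) *
        Ring.inverse (H - algebraMap ℂ (BoundedOp d L) z)) * damping d L α hα) z :=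
  ((hasDerivAt_resolvent hsa hz).const_mul (damping d L α hα)).mul_const (damping d L α hα)

theorem norm_damping_le {α : ℝ} (hα : 0 ≤ α) : ‖damping d L α hα‖ ≤ 1 :=
  LinearMap.mkContinuous_norm_le _ zero_le_one _

theorem norm_damping_mul_mul_le {α : ℝ} (hα : 0 ≤ α) (T : BoundedOp d L) :
    ‖damping d L α hα * T * damping d L α hα‖ ≤ ‖T‖ := by
  calc _ ≤ ‖damping d L α hα‖ * ‖T‖ * ‖damping d L α hα‖ :=
        (norm_mul_le _ _).trans (mul_le_mul_of_nonneg_right (norm_mul_le _ _) (norm_nonneg _))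
    _ ≤ 1 * ‖T‖ * 1 := by gcongr <;> exact norm_damping_le hα
    _ = _ := by ring

/-- A bound on the derivative of the damped resolvent, integrable at the real axis, gives the
boundary values and their Hölder continuity. -/
theorem boundary_values (hsa : IsSelfAdjoint H) {α : ℝ} (hα : 0 ≤ α)
    {S : Set ℝ} (hS : S.Nonempty) (hS0 : ∀ β ∈ S, 0 < β)
    (hbound : ∀ β ∈ S, ∃ C, 0 ≤ C ∧ ∀ z : ℂ, z.im ≠ 0 → |z.im| ≤ 1 → ‖damping d L α hα *
      (Ring.inverse (H - algebraMap ℂ (BoundedOp d L) z) *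
        Ring.inverse (H - algebraMap ℂ (BoundedOp d L) z)) * damping d L α hα‖ ≤
          C * |z.im| ^ (β - 1)) :
    ∃ Rplus Rminus : ℝ → BoundedOp d L,
      (∀ E : ℝ,
        Tendsto (fun ε : ℝ => dampedResolvent H α hα (E + Complex.I * ε))
          (𝓝[>] 0) (𝓝 (Rplus E)) ∧
        Tendsto (fun ε : ℝ => dampedResolvent H α hα (E - Complex.I * ε))
          (𝓝[>] 0) (𝓝 (Rminus E))) ∧
      ∀ β ∈ S, ∃ C : ℝ, ∀ E E' : ℝ,
          ‖Rplus E - Rplus E'‖ ≤ C * |E - E'| ^ β ∧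
          ‖Rminus E - Rminus E'‖ ≤ C * |E - E'| ^ β := by
  set F := dampedResolvent H α hα with hFdef
  set G : ℂ → BoundedOp d L := fun z => damping d L α hα *
      (Ring.inverse (H - algebraMap ℂ (BoundedOp d L) z) *
        Ring.inverse (H - algebraMap ℂ (BoundedOp d L) z)) * damping d L α hα with hG
  have hF : ∀ z : ℂ, z.im ≠ 0 → HasDerivAt F (G z) z := fun z hz =>
    hasDerivAt_dampedResolvent hsa hα hz
  have hF1 : ∀ z : ℂ, 0 < z.im → HasDerivAt F (G z) z := fun z hz => hF z hz.ne'
  -- The lower half plane is reduced to the upper one by `z ↦ -z`; the lower boundary value at `E`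
  -- is then the reflected one at `-E`.
  have hF2 : ∀ z : ℂ, 0 < z.im → HasDerivAt (fun z => F (-z)) (-G (-z)) z := fun z hz => by
    have := (hF (-z) (by simpa using hz.ne')).scomp z (hasDerivAt_neg z)
    exact this.congr_deriv (neg_one_smul ℂ _)
  have hG1 : ∀ {C β : ℝ}, (∀ z : ℂ, z.im ≠ 0 → |z.im| ≤ 1 → ‖G z‖ ≤ C * |z.im| ^ (β - 1)) →
      ∀ z : ℂ, 0 < z.im → z.im ≤ 1 → ‖G z‖ ≤ C * z.im ^ (β - 1) := fun h z h0 h1 => by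
    have := h z h0.ne' (by rwa [abs_of_pos h0])
    rwa [abs_of_pos h0] at this
  have hG2 : ∀ {C β : ℝ}, (∀ z : ℂ, z.im ≠ 0 → |z.im| ≤ 1 → ‖G z‖ ≤ C * |z.im| ^ (β - 1)) →
      ∀ z : ℂ, 0 < z.im → z.im ≤ 1 → ‖-G (-z)‖ ≤ C * z.im ^ (β - 1) := fun h z h0 h1 => by
    have h2 : |(-z).im| = z.im := by rw [Complex.neg_im, abs_neg, abs_of_pos h0]
    have := h (-z) (by simpa using h0.ne') (by rwa [h2])
    rwa [h2, ← norm_neg] at this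
  have hM : ∀ z : ℂ, |z.im| = 1 → ‖F z‖ ≤ 1 := fun z hz => by
    have hz0 : z.im ≠ 0 := fun h => by rw [h, abs_zero] at hz; exact zero_ne_one hz
    refine (norm_damping_mul_mul_le hα _).trans ?_
    have := norm_ringInverse_le (isUnit_sub_algebraMap hsa hz0) one_pos
      (fun x => by rw [← hz]; exact abs_im_mul_norm_le hsa z x)
    rwa [inv_one] at this
  -- The limits are constructed from one exponent, so that the same boundary values serve for every
  -- `β` in `S`.
  obtain ⟨β₀, hβ₀⟩ := hS
  obtain ⟨C₀, hC₀, hb₀⟩ := hbound β₀ hβ₀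
  choose Rp hRp using exists_tendsto_of_deriv_bound hC₀ (hS0 β₀ hβ₀) hF1 (hG1 hb₀)
  choose Rm hRm using exists_tendsto_of_deriv_bound hC₀ (hS0 β₀ hβ₀) hF2 (hG2 hb₀)
  refine ⟨Rp, fun E => Rm (-E), fun E => ⟨hRp E, ?_⟩, fun β hβ => ?_⟩
  · refine (hRm (-E)).congr fun ε => ?_
    congr 1
    push_cast
    ring
  · obtain ⟨C, hC, hb⟩ := hbound β hβ
    obtain ⟨C₁, h₁⟩ := exists_holder_of_deriv_bound hC (hS0 β hβ) hF1 (hG1 hb)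
      (fun z hz => hM z (by rw [hz, abs_one])) hRp
    obtain ⟨C₂, h₂⟩ := exists_holder_of_deriv_bound hC (hS0 β hβ) hF2 (hG2 hb) (M := 1)
      (fun z hz => hM (-z) (by rw [Complex.neg_im, abs_neg, hz, abs_one])) hRm
    refine ⟨max C₁ C₂, fun E E' => ⟨(h₁ E E').trans ?_, (h₂ (-E) (-E')).trans ?_⟩⟩
    · exact mul_le_mul_of_nonneg_right (le_max_left _ _) (by positivity)
    · rw [neg_sub_neg, abs_sub_comm]
      exact mul_le_mul_of_nonneg_right (le_max_right _ _) (by positivity)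

end resolvent

end LAP

/-! ### Analytic orthonormal frames by the implicit function theorem. -/

namespace LAP

section MatAnalyticAt

variable {V : Type*} [NormedAddCommGroup V] [NormedSpace ℝ V] {l m n : ℕ}

/-- Real analyticity of a matrix valued function, entry by entry. -/
def MatAnalyticAt (M : V → Matrix (Fin m) (Fin n) ℂ) (x : V) : Prop :=
  ∀ i j, AnalyticAt ℝ (fun y => M y i j) x

variable {x : V}

theorem MatAnalyticAt.const (A : Matrix (Fin m) (Fin n) ℂ) : MatAnalyticAt (fun _ : V => A) x :=
  fun _ _ => analyticAt_const

theorem MatAnalyticAt.add {M N : V → Matrix (Fin m) (Fin n) ℂ} (hM : MatAnalyticAt M x)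
    (hN : MatAnalyticAt N x) : MatAnalyticAt (fun y => M y + N y) x :=
  fun i j => (hM i j).add (hN i j)

theorem MatAnalyticAt.sub {M N : V → Matrix (Fin m) (Fin n) ℂ} (hM : MatAnalyticAt M x)
    (hN : MatAnalyticAt N x) : MatAnalyticAt (fun y => M y - N y) x :=
  fun i j => (hM i j).sub (hN i j)

theorem MatAnalyticAt.mul {M : V → Matrix (Fin l) (Fin m) ℂ} {N : V → Matrix (Fin m) (Fin n) ℂ}
    (hM : MatAnalyticAt M x) (hN : MatAnalyticAt N x) : MatAnalyticAt (fun y => M y * N y) x :=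
  fun i j => by
    simp only [Matrix.mul_apply]
    exact Finset.analyticAt_fun_sum _ fun k _ => (hM i k).mul (hN k j)

theorem analyticAt_conj {f : V → ℂ} (hf : AnalyticAt ℝ f x) :
    AnalyticAt ℝ (fun y => conj (f y)) x :=
  (Complex.conjCLE.toContinuousLinearMap.analyticAt (f x)).comp hf

theorem analyticAt_re {f : V → ℂ} (hf : AnalyticAt ℝ f x) : AnalyticAt ℝ (fun y => (f y).re) x :=
  (Complex.reCLM.analyticAt (f x)).comp hf

theorem analyticAt_im {f : V → ℂ} (hf : AnalyticAt ℝ f x) : AnalyticAt ℝ (fun y => (f y).im) x :=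
  (Complex.imCLM.analyticAt (f x)).comp hf

theorem MatAnalyticAt.conjTranspose {M : V → Matrix (Fin m) (Fin n) ℂ} (hM : MatAnalyticAt M x) :
    MatAnalyticAt (fun y => (M y)ᴴ) x := fun i j => analyticAt_conj (hM j i)

theorem MatAnalyticAt.continuousAt {M : V → Matrix (Fin m) (Fin n) ℂ} (hM : MatAnalyticAt M x) :
    ContinuousAt M x :=
  continuousAt_pi.2 fun i => continuousAt_pi.2 fun j => (hM i j).continuousAt

theorem MatAnalyticAt.eventually_det_ne_zero {M : V → Matrix (Fin m) (Fin m) ℂ}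
    (hM : MatAnalyticAt M x) (h : (M x).det ≠ 0) : ∀ᶠ y in 𝓝 x, (M y).det ≠ 0 := by
  have h1 : ContinuousAt (fun y => (M y).det) x :=
    (Continuous.matrix_det continuous_id).continuousAt.comp hM.continuousAt
  exact h1.eventually_ne h

end MatAnalyticAt

theorem eq_zero_of_mul_eq_zero {m n : ℕ} {A : Matrix (Fin m) (Fin m) ℂ} (h : A.det ≠ 0)
    {X : Matrix (Fin m) (Fin n) ℂ} (hX : A * X = 0) : X = 0 := by
  have := congrArg (A⁻¹ * ·) hX
  simpa [← Matrix.mul_assoc, Matrix.nonsing_inv_mul _ (isUnit_iff_ne_zero.2 h)] using this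

variable {d L m : ℕ}

/-- The equation whose solutions are the orthonormal frames of invariant subspaces, in the gauge
where the overlap with the reference frame is Hermitian. -/
def frameEquation (N : Matrix (Fin L) (Fin L) ℂ) (Φ₀ Φ : Matrix (Fin L) (Fin m) ℂ) :
    Matrix (Fin L) (Fin m) ℂ :=
  (1 - Φ₀ * Φ₀ᴴ) * ((1 - Φ * Φᴴ) * (N * Φ)) + Φ₀ * ((Φᴴ * Φ - 1) + (Φ₀ᴴ * Φ - Φᴴ * Φ₀))

/-- This identifies the partial derivative at `Φ₀` as `X ↦ (N + 2 Φ₀ Φ₀ᴴ) X`: the invariance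
equation contributes `N` on the complement, and the normalisation together with the gauge condition
contributes `2` on the range of `Φ₀`. -/
theorem frameEquation_add_smul {N : Matrix (Fin L) (Fin L) ℂ} (hN : N.IsHermitian)
    {Φ₀ : Matrix (Fin L) (Fin m) ℂ} (h1 : Φ₀ᴴ * Φ₀ = 1) (h2 : N * Φ₀ = 0)
    (X : Matrix (Fin L) (Fin m) ℂ) :
    ∃ Y Z : Matrix (Fin L) (Fin m) ℂ, ∀ t : ℝ, frameEquation N Φ₀ (Φ₀ + t • X) =
      t • ((N + (2 : ℝ) • (Φ₀ * Φ₀ᴴ)) * X) + t ^ 2 • Y + t ^ 3 • Z := by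
  have h3 : Φ₀ᴴ * N = 0 := by
    have := congrArg Matrix.conjTranspose h2
    rwa [Matrix.conjTranspose_mul, hN.eq, Matrix.conjTranspose_zero] at this
  have h4 : (1 - Φ₀ * Φ₀ᴴ) * ((1 - Φ₀ * Φ₀ᴴ) * (N * X)) = N * X := by
    have : (1 - Φ₀ * Φ₀ᴴ) * (N * X) = N * X := by
      rw [Matrix.sub_mul, Matrix.one_mul, Matrix.mul_assoc, ← Matrix.mul_assoc Φ₀ᴴ, h3,
        Matrix.zero_mul, Matrix.mul_zero, sub_zero]
    rw [this, this]
  refine ⟨Φ₀ * (Xᴴ * X) - (1 - Φ₀ * Φ₀ᴴ) * ((Φ₀ * Xᴴ + X * Φ₀ᴴ) * (N * X)),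
    -((1 - Φ₀ * Φ₀ᴴ) * ((X * Xᴴ) * (N * X))), fun t => ?_⟩
  have h5 : N * (Φ₀ + t • X) = t • (N * X) := by rw [Matrix.mul_add, h2, zero_add, Matrix.mul_smul]
  have h6 : (Φ₀ + t • X)ᴴ = Φ₀ᴴ + t • Xᴴ := by simp
  have h7 : 1 - (Φ₀ + t • X) * (Φ₀ᴴ + t • Xᴴ) =
      (1 - Φ₀ * Φ₀ᴴ) - t • (Φ₀ * Xᴴ + X * Φ₀ᴴ) - t ^ 2 • (X * Xᴴ) := by
    simp only [Matrix.add_mul, Matrix.mul_add, Matrix.smul_mul, Matrix.mul_smul]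
    module
  have h8 : ((Φ₀ᴴ + t • Xᴴ) * (Φ₀ + t • X) - 1) + (Φ₀ᴴ * (Φ₀ + t • X) - (Φ₀ᴴ + t • Xᴴ) * Φ₀) =
      t • ((2 : ℝ) • (Φ₀ᴴ * X)) + t ^ 2 • (Xᴴ * X) := by
    simp only [Matrix.add_mul, Matrix.mul_add, Matrix.smul_mul, Matrix.mul_smul, h1]
    module
  rw [frameEquation, h5, h6, h7, h8]
  have h9 : ((1 - Φ₀ * Φ₀ᴴ) - t • (Φ₀ * Xᴴ + X * Φ₀ᴴ) - t ^ 2 • (X * Xᴴ)) * (t • (N * X)) =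
      t • ((1 - Φ₀ * Φ₀ᴴ) * (N * X)) - t ^ 2 • ((Φ₀ * Xᴴ + X * Φ₀ᴴ) * (N * X)) -
        t ^ 3 • ((X * Xᴴ) * (N * X)) := by
    rw [Matrix.sub_mul, Matrix.sub_mul]
    simp only [Matrix.smul_mul, Matrix.mul_smul]
    module
  rw [h9]
  set Q := 1 - Φ₀ * Φ₀ᴴ
  rw [Matrix.mul_sub, Matrix.mul_sub]
  simp only [Matrix.mul_smul, h4, Matrix.mul_add, Matrix.add_mul, Matrix.smul_mul, Matrix.mul_assoc]
  module

theorem frameEquation_self {N : Matrix (Fin L) (Fin L) ℂ}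
    {Φ₀ : Matrix (Fin L) (Fin m) ℂ} (h1 : Φ₀ᴴ * Φ₀ = 1) (h2 : N * Φ₀ = 0) :
    frameEquation N Φ₀ Φ₀ = 0 := by
  simp [frameEquation, h1, h2]

/-- Multiplying by `Φ₀ᴴ` isolates the sum of the Hermitian matrix `Φᴴ Φ - 1` and the anti-Hermitian
matrix `Φ₀ᴴ Φ - Φᴴ Φ₀`; a vanishing sum forces both to vanish. -/
theorem orthonormal_of_frameEquation_eq_zero {N : Matrix (Fin L) (Fin L) ℂ}
    {Φ₀ Φ : Matrix (Fin L) (Fin m) ℂ} (h1 : Φ₀ᴴ * Φ₀ = 1) (h : frameEquation N Φ₀ Φ = 0) :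
    Φᴴ * Φ = 1 ∧ (1 - Φ₀ * Φ₀ᴴ) * ((1 - Φ * Φᴴ) * (N * Φ)) = 0 := by
  have h2 : (Φᴴ * Φ - 1) + (Φ₀ᴴ * Φ - Φᴴ * Φ₀) = 0 := by
    have h3 := congrArg (Φ₀ᴴ * ·) h
    simp only [frameEquation, Matrix.mul_add Φ₀ᴴ, Matrix.mul_zero, ← Matrix.mul_assoc Φ₀ᴴ, h1,
      Matrix.one_mul] at h3
    have h4 : Φ₀ᴴ * (1 - Φ₀ * Φ₀ᴴ) = 0 := by
      rw [Matrix.mul_sub, ← Matrix.mul_assoc, h1]; simp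
    rwa [h4, Matrix.zero_mul, zero_add] at h3
  have h3 : (Φᴴ * Φ - 1) - (Φ₀ᴴ * Φ - Φᴴ * Φ₀) = 0 := by
    have := congrArg Matrix.conjTranspose h2
    simp only [Matrix.conjTranspose_add, Matrix.conjTranspose_sub, Matrix.conjTranspose_mul,
      Matrix.conjTranspose_conjTranspose, Matrix.conjTranspose_one, Matrix.conjTranspose_zero] at this
    rw [← this]; abel
  have h4 : (2 : ℂ) • (Φᴴ * Φ - 1) = 0 := by
    calc _ = ((Φᴴ * Φ - 1) + (Φ₀ᴴ * Φ - Φᴴ * Φ₀)) + ((Φᴴ * Φ - 1) - (Φ₀ᴴ * Φ - Φᴴ * Φ₀)) := by module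
      _ = 0 := by rw [h2, h3, add_zero]
  refine ⟨sub_eq_zero.1 ((smul_eq_zero.1 h4).resolve_left two_ne_zero), ?_⟩
  rwa [frameEquation, h2, Matrix.mul_zero, add_zero] at h

/-- The frame equation has as many real equations as unknowns, so injectivity of its linearisation
suffices for the implicit function theorem, and that is the determinant hypothesis. The equation is
only real analytic, since it contains adjoints. -/
theorem exists_analytic_frame {A : Mom d → Matrix (Fin L) (Fin L) ℂ} {c : Mom d}
    (hA : MatAnalyticAt A c) (hherm : (A c).IsHermitian) {E : ℝ}
    {Φ₀ : Matrix (Fin L) (Fin m) ℂ} (h1 : Φ₀ᴴ * Φ₀ = 1)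
    (h2 : (A c - (E : ℂ) • 1) * Φ₀ = 0)
    (h3 : (A c - (E : ℂ) • 1 + (2 : ℝ) • (Φ₀ * Φ₀ᴴ)).det ≠ 0) :
    ∃ Φ : Mom d → Matrix (Fin L) (Fin m) ℂ, MatAnalyticAt Φ c ∧ Φ c = Φ₀ ∧
      ∀ᶠ k in 𝓝 c, (Φ k)ᴴ * Φ k = 1 ∧ A k * Φ k = Φ k * ((Φ k)ᴴ * A k * Φ k) := by
  set N : Mom d → Matrix (Fin L) (Fin L) ℂ := fun k => A k - (E : ℂ) • 1 with hN
  have hNc : (N c).IsHermitian := hherm.sub (by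
    rw [Matrix.IsHermitian, Matrix.conjTranspose_smul, Matrix.conjTranspose_one]
    simp)
  let F : Mom d × (Fin L → Fin m → ℂ) → (Fin L → Fin m → ℂ) := fun u =>
    frameEquation (N u.1) Φ₀ u.2
  set u₀ : Mom d × (Fin L → Fin m → ℂ) := (c, Φ₀) with hu₀
  have hmat : MatAnalyticAt (fun u : Mom d × (Fin L → Fin m → ℂ) => frameEquation (N u.1) Φ₀ u.2)
      u₀ := by
    have hX : MatAnalyticAt (fun u : Mom d × (Fin L → Fin m → ℂ) =>
        (u.2 : Matrix (Fin L) (Fin m) ℂ)) u₀ := fun i j =>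
      (((ContinuousLinearMap.proj (R := ℝ) (φ := fun _ : Fin m => ℂ) j).comp
        (ContinuousLinearMap.proj (R := ℝ) (φ := fun _ : Fin L => Fin m → ℂ) i)).comp
        (ContinuousLinearMap.snd ℝ (Mom d) (Fin L → Fin m → ℂ))).analyticAt u₀
    have hNa : MatAnalyticAt (fun u : Mom d × (Fin L → Fin m → ℂ) => N u.1) u₀ := fun i j =>
      AnalyticAt.comp (g := fun k => N k i j) (f := Prod.fst) (x := u₀)
        ((hA i j).sub analyticAt_const) analyticAt_fst
    exact ((MatAnalyticAt.const _).mul (((MatAnalyticAt.const _).sub (hX.mul hX.conjTranspose)).mul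
      (hNa.mul hX))).add ((MatAnalyticAt.const _).mul (((hX.conjTranspose.mul hX).sub
      (MatAnalyticAt.const _)).add (((MatAnalyticAt.const _).mul hX).sub
      (hX.conjTranspose.mul (MatAnalyticAt.const _)))))
  -- Here `⊤` is the analytic smoothness class, so the implicit function is analytic too.
  have hF : ContDiffAt ℝ ⊤ F u₀ :=
    contDiffAt_pi.2 fun i => contDiffAt_pi.2 fun j => (hmat i j).contDiffAt
  have hinv : (fderiv ℝ F u₀ ∘L .inr ℝ (Mom d) (Fin L → Fin m → ℂ)).IsInvertible := by
    have hinj : Function.Injective (fderiv ℝ F u₀ ∘L .inr ℝ (Mom d) (Fin L → Fin m → ℂ)) := by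
      rw [injective_iff_map_eq_zero]
      intro X hX
      set W : Fin L → Fin m → ℂ := (N c + (2 : ℝ) • (Φ₀ * Φ₀ᴴ)) * Matrix.of X with hW
      -- The derivative in a direction `X` is read off from the cubic expansion along a line. `@id`
      -- only retypes `Φ₀` as an element of the normed function space.
      obtain ⟨Y, Z, hYZ⟩ : ∃ Y Z : Fin L → Fin m → ℂ, ∀ t : ℝ,
          F (c, @id (Fin L → Fin m → ℂ) Φ₀ + t • X) = t • W + t ^ 2 • Y + t ^ 3 • Z :=
        frameEquation_add_smul hNc h1 h2 X
      have hd1 : HasDerivAt (fun t : ℝ => t • W + t ^ 2 • Y +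
          t ^ 3 • Z) W 0 := by
        have := (((hasDerivAt_id (0 : ℝ)).smul_const W).add (((hasDerivAt_id (0 : ℝ)).pow 2).smul_const
          Y)).add (((hasDerivAt_id (0 : ℝ)).pow 3).smul_const
          Z)
        exact this.congr_deriv (by simp)
      have hline : HasDerivAt (fun t : ℝ => u₀ + t • ((0, X) : Mom d × (Fin L → Fin m → ℂ)))
          (0, X) 0 := by
        simpa using ((hasDerivAt_id (0 : ℝ)).smul_const
          ((0, X) : Mom d × (Fin L → Fin m → ℂ))).const_add u₀
      have hd2 := (hF.differentiableAt (by simp)).hasFDerivAt.comp_hasDerivAt_of_eq (0 : ℝ) hline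
        (by simp)
      have hfun : (F ∘ fun t : ℝ => u₀ + t • ((0, X) : Mom d × (Fin L → Fin m → ℂ))) =
          fun t : ℝ => t • W + t ^ 2 • Y +
            t ^ 3 • Z := by
        funext t
        have he : u₀ + t • ((0, X) : Mom d × (Fin L → Fin m → ℂ)) =
            (c, @id (Fin L → Fin m → ℂ) Φ₀ + t • X) :=
          Prod.ext (show c + t • (0 : Mom d) = c by simp) rfl
        rw [← hYZ t, Function.comp_apply, he]
      rw [hfun] at hd2
      have hW0 : W = 0 := hd1.unique (hd2.congr_deriv hX)
      exact eq_zero_of_mul_eq_zero h3 hW0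
    have hbij := (⟨hinj, LinearMap.injective_iff_surjective.1 hinj⟩ : Function.Bijective
      (fderiv ℝ F u₀ ∘L .inr ℝ (Mom d) (Fin L → Fin m → ℂ)))
    exact ⟨(LinearEquiv.ofBijective _ hbij).toContinuousLinearEquiv, by ext; rfl⟩
  set Φ := hF.implicitFunction (by simp) hinv with hΦ
  have hc : Φ c = Φ₀ := hF.implicitFunction_apply_self (by simp) hinv
  have hev : ∀ᶠ k in 𝓝 c, F (k, Φ k) = F u₀ :=
    hF.eventually_apply_implicitFunction (by simp) hinv
  have hcd : ContDiffAt ℝ ⊤ Φ c := hF.contDiffAt_implicitFunction (by simp) hinv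
  have hΦa : MatAnalyticAt (fun k => (Φ k : Matrix (Fin L) (Fin m) ℂ)) c := fun i j =>
    (contDiffAt_pi.1 (contDiffAt_pi.1 hcd i) j).analyticAt
  refine ⟨Φ, hΦa, hc, ?_⟩
  -- At `c` this matrix is the identity. Its invertibility nearby upgrades `(1 - Φ₀ Φ₀ᴴ) Y = 0` to
  -- `Y = 0` for `Y = (1 - Φ Φᴴ) N Φ`, because `Φ Φᴴ Y = 0` as well.
  have hdet := ((MatAnalyticAt.const (1 - Φ₀ * Φ₀ᴴ)).add (hΦa.mul hΦa.conjTranspose)).eventually_det_ne_zero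
    (by rw [hc]; simp)
  filter_upwards [hev, hdet] with k hk hdk
  have h0 : F u₀ = 0 := frameEquation_self h1 h2
  obtain ⟨h4, h5⟩ := orthonormal_of_frameEquation_eq_zero h1 (hk.trans h0)
  refine ⟨h4, ?_⟩
  set Ψ : Matrix (Fin L) (Fin m) ℂ := Φ k
  have h6 : (1 - Φ₀ * Φ₀ᴴ + Ψ * Ψᴴ) * ((1 - Ψ * Ψᴴ) * (N k * Ψ)) = 0 := by
    have : Ψ * Ψᴴ * (1 - Ψ * Ψᴴ) = 0 := by
      rw [Matrix.mul_sub, Matrix.mul_one, Matrix.mul_assoc Ψ, ← Matrix.mul_assoc Ψᴴ, h4,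
        Matrix.one_mul, sub_self]
    rw [Matrix.add_mul, h5, ← Matrix.mul_assoc (Ψ * Ψᴴ), this, Matrix.zero_mul, add_zero]
  have h7 := eq_zero_of_mul_eq_zero hdk h6
  have h8 : N k * Ψ = A k * Ψ - (E : ℂ) • Ψ := by
    rw [hN, Matrix.sub_mul, Matrix.smul_mul, Matrix.one_mul]
  rw [h8, Matrix.sub_mul, Matrix.one_mul, Matrix.mul_sub, Matrix.mul_smul, Matrix.mul_assoc Ψ Ψᴴ Ψ,
    h4, Matrix.mul_one] at h7
  rw [← sub_eq_zero, ← h7]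
  simp only [Matrix.mul_assoc]
  abel

end LAP

/-! ### Eigenframes, Riesz projections and the splitting of the resolvent. -/

namespace LAP

section eigenframe

variable {L : ℕ} {A : Matrix (Fin L) (Fin L) ℂ}

theorem conjTranspose_ofReal_smul_one (E : ℝ) :
    ((E : ℂ) • (1 : Matrix (Fin L) (Fin L) ℂ))ᴴ = (E : ℂ) • 1 := by
  rw [Matrix.conjTranspose_smul, Matrix.conjTranspose_one]
  simp

/-- An orthonormal basis of an eigenspace, as the columns of a matrix. -/
theorem exists_eigenframe (A : Matrix (Fin L) (Fin L) ℂ) {E : ℝ} {m : ℕ} (hm : mult A E = m) :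
    ∃ Φ : Matrix (Fin L) (Fin m) ℂ, Φᴴ * Φ = 1 ∧ (A - (E : ℂ) • 1) * Φ = 0 ∧
      ∀ v, (A - (E : ℂ) • 1) *ᵥ v = 0 → (Φ * Φᴴ) *ᵥ v = v := by
  set S := (Module.End.eigenspace (Matrix.toLin' A) (E : ℂ)).comap
    (WithLp.linearEquiv 2 ℂ (Fin L → ℂ)).toLinearMap with hS
  have hfin : Module.finrank ℂ S = m := by
    rw [← hm, mult, hS]
    exact ((WithLp.linearEquiv 2 ℂ (Fin L → ℂ)).submoduleMap _).finrank_eq.trans (by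
      rw [Submodule.map_comap_eq_of_surjective (WithLp.linearEquiv 2 ℂ (Fin L → ℂ)).surjective])
  have hmem : ∀ v : EuclideanSpace ℂ (Fin L), v ∈ S ↔ (A - (E : ℂ) • 1) *ᵥ v.ofLp = 0 := fun v => by
    rw [hS, Submodule.mem_comap, Module.End.mem_eigenspace_iff, Matrix.sub_mulVec,
      Matrix.smul_mulVec, Matrix.one_mulVec, sub_eq_zero]
    rfl
  let b : OrthonormalBasis (Fin m) ℂ S := (stdOrthonormalBasis ℂ S).reindex (finCongr hfin)
  refine ⟨Matrix.of fun i j => (b j : EuclideanSpace ℂ (Fin L)) i, ?_, ?_, fun v hv => ?_⟩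
  · ext i j
    have h := orthonormal_iff_ite.1 b.orthonormal i j
    rw [Submodule.coe_inner, PiLp.inner_apply] at h
    rw [Matrix.mul_apply, Matrix.one_apply, ← h]
    refine Finset.sum_congr rfl fun l _ => ?_
    rw [RCLike.inner_apply, mul_comm]
    rfl
  · ext i j
    exact congrFun ((hmem _).1 (b j).2) i
  · have h := b.sum_repr' ⟨WithLp.toLp 2 v, (hmem _).2 hv⟩
    have h2 : ∀ i, ∑ j, ⟪(b j : EuclideanSpace ℂ (Fin L)), WithLp.toLp 2 v⟫_ℂ *
        (b j : EuclideanSpace ℂ (Fin L)) i = v i := fun i => by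
      have h3 := congrArg (fun w : S => (w : EuclideanSpace ℂ (Fin L)) i) h
      simpa using h3
    ext i
    rw [← h2 i, ← Matrix.mulVec_mulVec, Matrix.mulVec, dotProduct]
    refine Finset.sum_congr rfl fun j _ => ?_
    refine (mul_comm _ _).trans (congrArg₂ (· * ·) ?_ rfl)
    rw [PiLp.inner_apply, Matrix.mulVec, dotProduct]
    refine Finset.sum_congr rfl fun l _ => ?_
    rw [RCLike.inner_apply, mul_comm]
    rfl

/-- On a kernel vector, `Φᴴ` annihilates the term with `A - E`, so `Φᴴ v = 0`; then `v` is an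
eigenvector and equals `Φ Φᴴ v = 0`. The value `s = 2` is needed for the linearised frame equation
and `s = 1` for the shifted operator on the complement. -/
theorem det_add_frame_ne_zero (hA : A.IsHermitian) {E : ℝ} {m : ℕ} {Φ : Matrix (Fin L) (Fin m) ℂ}
    (h1 : Φᴴ * Φ = 1) (h2 : (A - (E : ℂ) • 1) * Φ = 0)
    (h3 : ∀ v, (A - (E : ℂ) • 1) *ᵥ v = 0 → (Φ * Φᴴ) *ᵥ v = v) {s : ℝ} (hs : s ≠ 0) :
    (A - (E : ℂ) • 1 + s • (Φ * Φᴴ)).det ≠ 0 := fun h0 => by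
  obtain ⟨v, hv, hv0⟩ := Matrix.exists_mulVec_eq_zero_iff.2 h0
  have h4 : Φᴴ * (A - (E : ℂ) • 1) = 0 := by
    have := congrArg Matrix.conjTranspose h2
    rwa [Matrix.conjTranspose_mul, Matrix.conjTranspose_sub, hA.eq, conjTranspose_ofReal_smul_one,
      Matrix.conjTranspose_zero] at this
  have h5 : Φᴴ *ᵥ v = 0 := by
    have h6 := congrArg (Φᴴ *ᵥ ·) hv0
    simp only [Matrix.mulVec_mulVec, Matrix.mulVec_zero, Matrix.mul_add, h4, zero_add,
      Matrix.mul_smul, ← Matrix.mul_assoc Φᴴ, h1, Matrix.one_mul, Matrix.smul_mulVec] at h6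
    exact (smul_eq_zero.1 h6).resolve_left hs
  rw [Matrix.add_mulVec, Matrix.smul_mulVec, ← Matrix.mulVec_mulVec, h5, Matrix.mulVec_zero,
    smul_zero, add_zero] at hv0
  have h6 := h3 v hv0
  rw [← Matrix.mulVec_mulVec, h5, Matrix.mulVec_zero] at h6
  exact hv h6.symm

end eigenframe

section invariantFrame

variable {L m : ℕ} {A : Matrix (Fin L) (Fin L) ℂ} {Φ : Matrix (Fin L) (Fin m) ℂ}

theorem commute_frame (hA : A.IsHermitian) (h2 : A * Φ = Φ * (Φᴴ * A * Φ)) :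
    A * (Φ * Φᴴ) = Φ * Φᴴ * A := by
  have h3 : A * (Φ * Φᴴ) = Φ * (Φᴴ * A * Φ) * Φᴴ := by rw [← Matrix.mul_assoc, h2]
  have h4 := congrArg Matrix.conjTranspose h3
  simp only [Matrix.conjTranspose_mul, Matrix.conjTranspose_conjTranspose, hA.eq] at h4
  rw [h4, h3]
  simp only [Matrix.mul_assoc]

/-- Eigenvectors with eigenvalue near `E` lie in the range of the frame. -/
theorem frame_mulVec_of_near (hA : A.IsHermitian) (h2 : A * Φ = Φ * (Φᴴ * A * Φ))
    {E lam : ℝ} (hT : (A - (E : ℂ) • 1 + Φ * Φᴴ - ((lam - E : ℝ) : ℂ) • 1).det ≠ 0)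
    (h1 : Φᴴ * Φ = 1) {v : Fin L → ℂ} (hv : A *ᵥ v = (lam : ℂ) • v) : (Φ * Φᴴ) *ᵥ v = v := by
  have hP : Φ * Φᴴ * (Φ * Φᴴ) = Φ * Φᴴ := by
    rw [Matrix.mul_assoc, ← Matrix.mul_assoc Φᴴ, h1, Matrix.one_mul]
  have h3 : (A - (E : ℂ) • 1 + Φ * Φᴴ - ((lam - E : ℝ) : ℂ) • 1) * (1 - Φ * Φᴴ) =
      (1 - Φ * Φᴴ) * (A - (lam : ℂ) • 1) := by
    simp only [Matrix.mul_sub, Matrix.sub_mul, Matrix.add_mul, Matrix.mul_one, Matrix.one_mul,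
      Matrix.smul_mul, Matrix.mul_smul, hP, commute_frame hA h2]
    push_cast
    module
  have h4 := congrArg (· *ᵥ v) h3
  simp only [← Matrix.mulVec_mulVec, Matrix.sub_mulVec A, hv, Matrix.smul_mulVec, Matrix.one_mulVec,
    sub_self, Matrix.mulVec_zero] at h4
  have h5 := Matrix.eq_zero_of_mulVec_eq_zero hT h4
  rw [Matrix.sub_mulVec, Matrix.one_mulVec, sub_eq_zero] at h5
  exact h5.symm

/-- Eigenvectors with eigenvalue away from `E` are orthogonal to the frame. -/
theorem frame_conjTranspose_mulVec_of_far (hA : A.IsHermitian) (h2 : A * Φ = Φ * (Φᴴ * A * Φ))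
    {E lam r : ℝ} (hM : ∑ i, ∑ j, ‖(Φᴴ * A * Φ - (E : ℂ) • 1 : Matrix (Fin m) (Fin m) ℂ) i j‖ < r) (hr : r ≤ |lam - E|)
    (h1 : Φᴴ * Φ = 1) {v : Fin L → ℂ} (hv : A *ᵥ v = (lam : ℂ) • v) : Φᴴ *ᵥ v = 0 := by
  have h3 : Φᴴ * A = Φᴴ * A * Φ * Φᴴ := by
    have h4 : Φᴴ * A = Φᴴ * (Φ * Φᴴ * A) := by
      rw [Matrix.mul_assoc, ← Matrix.mul_assoc Φᴴ, h1, Matrix.one_mul]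
    rw [h4, ← commute_frame hA h2]
    simp only [Matrix.mul_assoc]
    rw [← Matrix.mul_assoc Φᴴ Φ, h1, Matrix.one_mul]
  have h4 : (Φᴴ * A * Φ - (E : ℂ) • 1) *ᵥ (Φᴴ *ᵥ v) = ((lam - E : ℝ) : ℂ) • (Φᴴ *ᵥ v) := by
    rw [Matrix.sub_mulVec, Matrix.mulVec_mulVec, ← h3, ← Matrix.mulVec_mulVec, hv,
      Matrix.mulVec_smul, Matrix.smul_mulVec, Matrix.one_mulVec, ← sub_smul]
    push_cast
    rfl
  have h5 := norm_toEuclideanLin_le (Φᴴ * A * Φ - (E : ℂ) • 1) (WithLp.toLp 2 (Φᴴ *ᵥ v))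
  rw [Matrix.toLpLin_apply, h4, WithLp.toLp_smul, norm_smul, Complex.norm_real,
    Real.norm_eq_abs] at h5
  rcases (norm_nonneg (WithLp.toLp 2 (Φᴴ *ᵥ v))).eq_or_lt with h0 | h0
  · exact (WithLp.toLp_eq_zero 2).1 (norm_eq_zero.1 h0.symm)
  · exact absurd (le_of_mul_le_mul_right h5 h0) (not_le.2 (hM.trans_le hr))

theorem circleIntegral_sub_inv_of_lt {c w : ℂ} {r : ℝ} (hr : 0 ≤ r) (hw : r < ‖w - c‖) :
    (∮ z in C(c, r), (z - w)⁻¹) = 0 := by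
  have hne : ∀ z ∈ Metric.closedBall c r, z - w ≠ 0 := fun z hz h => by
    rw [sub_eq_zero] at h
    rw [h, Metric.mem_closedBall, dist_eq_norm] at hz
    exact absurd hz (not_le.2 hw)
  exact Complex.circleIntegral_eq_zero_of_differentiable_on_off_countable hr countable_empty
    ((continuousOn_id.sub continuousOn_const).inv₀ hne)
    fun z hz => (differentiableAt_id.sub_const w).inv
      (hne z (Metric.ball_subset_closedBall hz.1))

/-- In an eigenbasis, eigenvectors with eigenvalue within `r` of `E` lie in the range of the frame,
and those at distance at least `r` are orthogonal to it. An eigenvalue at distance exactly `r` would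
do both, so the circle misses the spectrum. Cauchy's integral then gives `1` or `0` on each
eigenvector. -/
theorem rieszProj_eq (hA : A.IsHermitian) (h1 : Φᴴ * Φ = 1) (h2 : A * Φ = Φ * (Φᴴ * A * Φ))
    {E r : ℝ} (hr : 0 < r)
    (hT : ∀ w : ℝ, |w| ≤ r → (A - (E : ℂ) • 1 + Φ * Φᴴ - (w : ℂ) • 1).det ≠ 0)
    (hM : ∑ i, ∑ j, ‖(Φᴴ * A * Φ - (E : ℂ) • 1 : Matrix (Fin m) (Fin m) ℂ) i j‖ < r) : rieszProj A E r = Φ * Φᴴ := by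
  set U : Matrix (Fin L) (Fin L) ℂ := hA.eigenvectorUnitary.1 with hU
  set lam := hA.eigenvalues with hlam
  have hUU : U * Uᴴ = 1 := Unitary.coe_mul_star_self hA.eigenvectorUnitary
  have hUU' : Uᴴ * U = 1 := Unitary.coe_star_mul_self hA.eigenvectorUnitary
  set u : Fin L → Fin L → ℂ := fun j => ⇑(hA.eigenvectorBasis j) with hu
  have hUu : ∀ i j, U i j = u j i := fun i j => hA.eigenvectorUnitary_apply i j
  have hAu : ∀ j, A *ᵥ u j = (lam j : ℂ) • u j := fun j => by
    have := hA.mulVec_eigenvectorBasis j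
    rw [hu, this]
    rfl
  have hmulU : ∀ (B : Matrix (Fin L) (Fin L) ℂ) i j, (B * U) i j = (B *ᵥ u j) i := fun B i j => by
    simp only [Matrix.mul_apply, Matrix.mulVec, dotProduct, hUu]
  have hu0 : ∀ j, u j ≠ 0 := fun j h => by
    have h3 := hmulU 1 j j
    have h4 := congrFun (congrFun hUU' j) j
    simp only [Matrix.mul_apply, hUu, h, Pi.zero_apply, mul_zero, Finset.sum_const_zero,
      Matrix.one_apply_eq] at h4
    exact zero_ne_one h4
  have hnear : ∀ j, |lam j - E| ≤ r → (Φ * Φᴴ) *ᵥ u j = u j := fun j hj =>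
    frame_mulVec_of_near hA h2 (hT _ hj) h1 (hAu j)
  have hfar : ∀ j, r ≤ |lam j - E| → (Φ * Φᴴ) *ᵥ u j = 0 := fun j hj => by
    rw [← Matrix.mulVec_mulVec, frame_conjTranspose_mulVec_of_far hA h2 hM hj h1 (hAu j),
      Matrix.mulVec_zero]
  have hne : ∀ j, |lam j - E| ≠ r := fun j hj => hu0 j ((hnear j hj.le).symm.trans (hfar j hj.ge))
  set χ : Fin L → ℂ := fun j => if |lam j - E| < r then 1 else 0 with hχ
  have hP : Φ * Φᴴ = U * Matrix.diagonal χ * Uᴴ := by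
    have h3 : Φ * Φᴴ * U = U * Matrix.diagonal χ := by
      ext i j
      rw [hmulU, Matrix.mul_diagonal, hUu]
      rcases lt_or_ge |lam j - E| r with h | h
      · rw [hnear j h.le, hχ]; simp [h]
      · rw [hfar j h, hχ]; simp [not_lt.2 h]
    rw [← h3, Matrix.mul_assoc, hUU, Matrix.mul_one]
  have hAU : A * U = U * Matrix.diagonal fun j => (lam j : ℂ) := by
    ext i j
    rw [hmulU, hAu, Matrix.mul_diagonal, hUu, Pi.smul_apply, smul_eq_mul, mul_comm]
  have hdist : ∀ j, ‖(lam j : ℂ) - E‖ = |lam j - E| := fun j => by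
    rw [← Complex.ofReal_sub, Complex.norm_real, Real.norm_eq_abs]
  have hsph : ∀ z ∈ Metric.sphere (E : ℂ) r, ∀ j, z - lam j ≠ 0 := fun z hz j h => by
    rw [sub_eq_zero] at h
    rw [h, mem_sphere_iff_norm, hdist] at hz
    exact hne j hz
  have hinv : ∀ z ∈ Metric.sphere (E : ℂ) r, (z • (1 : Matrix (Fin L) (Fin L) ℂ) - A)⁻¹ =
      U * Matrix.diagonal (fun j => (z - lam j)⁻¹) * Uᴴ := fun z hz => by
    refine Matrix.inv_eq_right_inv ?_
    have h3 : (z • (1 : Matrix (Fin L) (Fin L) ℂ) - A) * U =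
        U * Matrix.diagonal fun j => z - (lam j : ℂ) := by
      rw [Matrix.sub_mul, hAU, Matrix.smul_mul, Matrix.one_mul, ← Matrix.diagonal_sub,
        Matrix.mul_sub]
      congr 1
      ext i j
      rw [Matrix.mul_diagonal, Matrix.smul_apply, smul_eq_mul, mul_comm]
    have h4 : Matrix.diagonal (fun j => z - (lam j : ℂ)) * Matrix.diagonal (fun j => (z - lam j)⁻¹) =
        1 := by
      rw [Matrix.diagonal_mul_diagonal, ← Matrix.diagonal_one]
      congr 1
      funext j
      exact mul_inv_cancel₀ (hsph z hz j)
    rw [← Matrix.mul_assoc, ← Matrix.mul_assoc, h3, Matrix.mul_assoc U, h4, Matrix.mul_one, hUU]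
  have hentry : ∀ (x : Fin L → ℂ) i j, (U * Matrix.diagonal x * Uᴴ) i j =
      ∑ l, (U i l * conj (U j l)) * x l := fun x i j => by
    rw [Matrix.mul_apply]
    refine Finset.sum_congr rfl fun l _ => ?_
    rw [Matrix.mul_diagonal, Matrix.conjTranspose_apply]
    simp only [RCLike.star_def]
    ring
  ext i j
  rw [hP, hentry, rieszProj, Matrix.of_apply]
  have h3 : (∮ z in C((E : ℂ), r), ((z • (1 : Matrix (Fin L) (Fin L) ℂ) - A)⁻¹) i j) =
      ∮ z in C((E : ℂ), r), ∑ l, (U i l * conj (U j l)) * (z - lam l)⁻¹ :=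
    circleIntegral.integral_congr hr.le fun z hz => by
      simp only [hinv z hz, hentry]
  have hci : ∀ l, CircleIntegrable (fun z => (U i l * conj (U j l)) * (z - lam l)⁻¹) (E : ℂ) r :=
    fun l => ContinuousOn.circleIntegrable hr.le (continuousOn_const.mul
      ((continuousOn_id.sub continuousOn_const).inv₀ fun z hz => hsph z hz l))
  rw [h3, circleIntegral.integral_fun_sum fun l _ => hci l, Finset.mul_sum]
  refine Finset.sum_congr rfl fun l _ => ?_
  rw [circleIntegral.integral_const_mul]
  have hπ : (2 * (Real.pi : ℂ) * Complex.I) ≠ 0 := Complex.two_pi_I_ne_zero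
  rcases lt_or_ge |lam l - E| r with h | h
  · rw [circleIntegral.integral_sub_inv_of_mem_ball (by rw [mem_ball_iff_norm, hdist]; exact h)]
    simp only [hχ, h, if_true]
    field_simp
  · rw [circleIntegral_sub_inv_of_lt hr.le (by rw [hdist]; exact lt_of_le_of_ne h (hne l).symm)]
    simp [hχ, not_lt.2 h]

/-- The square of the resolvent splits into the part in the frame and a part that stays bounded
near `E`. -/
theorem resolvent_sq_eq (hA : A.IsHermitian) (h1 : Φᴴ * Φ = 1) (h2 : A * Φ = Φ * (Φᴴ * A * Φ))
    {E : ℝ} {z : ℂ} (hz : z.im ≠ 0)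
    (hT : (A - (E : ℂ) • 1 + Φ * Φᴴ - (z - E) • 1).det ≠ 0) :
    (A - z • 1)⁻¹ * (A - z • 1)⁻¹ =
      Φ * ((Φᴴ * A * Φ - z • 1)⁻¹ * (Φᴴ * A * Φ - z • 1)⁻¹) * Φᴴ +
      (A - (E : ℂ) • 1 + Φ * Φᴴ - (z - E) • 1)⁻¹ *
        (A - (E : ℂ) • 1 + Φ * Φᴴ - (z - E) • 1)⁻¹ * (1 - Φ * Φᴴ) := by
  set M := Φᴴ * A * Φ with hM
  -- `T` is `A - z` with the eigenvalues inside the frame shifted by `1`. It agrees with `A - z` on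
  -- the complement and commutes with `P`. The form in `z - E` isolates the small parameter.
  set T := A - (E : ℂ) • 1 + Φ * Φᴴ - (z - E) • 1 with hTdef
  have hMh : M.IsHermitian := by
    rw [Matrix.IsHermitian, hM]
    simp only [Matrix.conjTranspose_mul, Matrix.conjTranspose_conjTranspose, hA.eq,
      Matrix.mul_assoc]
  have hMdet := isUnit_iff_ne_zero.2 (det_sub_smul_one_ne_zero hMh hz)
  have hAdet := isUnit_iff_ne_zero.2 (det_sub_smul_one_ne_zero hA hz)
  have hTdet := isUnit_iff_ne_zero.2 hT
  set P := Φ * Φᴴ with hP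
  have hPP : P * P = P := by
    rw [hP, Matrix.mul_assoc, ← Matrix.mul_assoc Φᴴ, h1, Matrix.one_mul]
  have hcomm : A * P = P * A := commute_frame hA h2
  set R := (A - z • 1)⁻¹ with hR
  have hRA : R * (A - z • 1) = 1 := Matrix.nonsing_inv_mul _ hAdet
  have h3 : R * Φ = Φ * (M - z • 1)⁻¹ := by
    have h4 : (A - z • 1) * Φ = Φ * (M - z • 1) := by
      rw [Matrix.sub_mul, h2, Matrix.mul_sub]
      simp
    calc R * Φ = R * (Φ * (M - z • 1) * (M - z • 1)⁻¹) := by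
          rw [Matrix.mul_assoc Φ, Matrix.mul_nonsing_inv _ hMdet, Matrix.mul_one]
      _ = R * (A - z • 1) * Φ * (M - z • 1)⁻¹ := by
          rw [← h4]; simp only [Matrix.mul_assoc]
      _ = _ := by rw [hRA, Matrix.one_mul]
  have hTQ : T * (1 - P) = (A - z • 1) * (1 - P) := by
    rw [hTdef]
    simp only [Matrix.mul_sub, Matrix.sub_mul, Matrix.add_mul, Matrix.mul_one, Matrix.one_mul,
      Matrix.smul_mul, hPP]
    module
  have hQT : (1 - P) * T = T * (1 - P) := by
    rw [hTdef]
    simp only [Matrix.mul_sub, Matrix.sub_mul, Matrix.add_mul, Matrix.mul_add, Matrix.mul_one,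
      Matrix.one_mul, Matrix.smul_mul, Matrix.mul_smul, hcomm]
    module
  have hQTi : (1 - P) * T⁻¹ = T⁻¹ * (1 - P) := by
    calc _ = T⁻¹ * T * ((1 - P) * T⁻¹) := by rw [Matrix.nonsing_inv_mul _ hTdet, Matrix.one_mul]
      _ = T⁻¹ * ((T * (1 - P)) * T⁻¹) := by simp only [Matrix.mul_assoc]
      _ = T⁻¹ * ((1 - P) * (T * T⁻¹)) := by rw [← hQT]; simp only [Matrix.mul_assoc]
      _ = _ := by rw [Matrix.mul_nonsing_inv _ hTdet, Matrix.mul_one]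
  have h5 : R * (1 - P) = T⁻¹ * (1 - P) := by
    calc R * (1 - P) = R * ((1 - P) * (T * T⁻¹)) := by
          rw [Matrix.mul_nonsing_inv _ hTdet, Matrix.mul_one]
      _ = R * ((A - z • 1) * (1 - P) * T⁻¹) := by
          rw [← Matrix.mul_assoc (1 - P), hQT, hTQ]
      _ = R * (A - z • 1) * ((1 - P) * T⁻¹) := by simp only [Matrix.mul_assoc]
      _ = _ := by rw [hRA, Matrix.one_mul, hQTi]
  calc R * R = R * R * P + R * R * (1 - P) := by rw [← Matrix.mul_add, add_sub_cancel, Matrix.mul_one]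
    _ = R * (R * Φ) * Φᴴ + R * (R * (1 - P)) := by simp only [hP, Matrix.mul_assoc]
    _ = _ := by
      congr 1
      · rw [h3, ← Matrix.mul_assoc R, h3]; simp only [Matrix.mul_assoc]
      · rw [h5, ← hQTi, ← Matrix.mul_assoc R, h5, Matrix.mul_assoc, hQTi, Matrix.mul_assoc]

end invariantFrame

end LAP

/-! ### Morse bands and tilted cones are local bands. -/

namespace LAP

section bands

variable {d : ℕ} {c : Mom d}

theorem clm_apply_eq_sum {F : Type*} [NormedAddCommGroup F] [NormedSpace ℝ F] (T : Mom d →L[ℝ] F)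
    (v : Mom d) : T v = ∑ i, v i • T (momBasis i) := by
  conv_lhs => rw [eq_sum_momBasis v]
  simp only [map_sum, map_smul]

theorem sq_apply_le_sum (T : Mom d →L[ℝ] ℝ) (v : Mom d) :
    (T v) ^ 2 ≤ ‖v‖ ^ 2 * ∑ i, T (momBasis i) * T (momBasis i) := by
  rw [clm_apply_eq_sum T v, EuclideanSpace.real_norm_sq_eq]
  simp only [smul_eq_mul, ← pow_two]
  exact Finset.sum_mul_sq_le_sq_mul_sq _ _ _

theorem exists_pos_mul_norm_le {F : Type*} [NormedAddCommGroup F] [NormedSpace ℝ F]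
    (T : Mom d →L[ℝ] F) (hT : Function.Injective T) : ∃ a : ℝ, 0 < a ∧ ∀ v, a * ‖v‖ ≤ ‖T v‖ := by
  obtain ⟨K, hK, hT'⟩ := (T : Mom d →ₗ[ℝ] F).exists_antilipschitzWith (LinearMap.ker_eq_bot.2 hT)
  have hK' : (0 : ℝ) < K := hK
  refine ⟨(K : ℝ)⁻¹, inv_pos.2 hK', fun v => ?_⟩
  have := hT'.le_mul_dist v 0
  rw [map_zero, dist_zero_right, dist_zero_right] at this
  rw [inv_mul_le_iff₀ hK']
  exact this

theorem eventually_norm_ge {F : Type*} [NormedAddCommGroup F] [NormedSpace ℝ F]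
    {f : Mom d → F} {T : Mom d →L[ℝ] F} (hf : HasFDerivAt f T c) (h0 : f c = 0) {a : ℝ} (ha : 0 < a)
    (hT : ∀ v, a * ‖v‖ ≤ ‖T v‖) : ∀ᶠ k in 𝓝 c, a / 2 * ‖k - c‖ ≤ ‖f k‖ := by
  filter_upwards [hf.isLittleO.def (half_pos ha)] with k hk
  rw [h0, sub_zero] at hk
  have h1 := hT (k - c)
  have h2 : ‖T (k - c)‖ ≤ ‖f k‖ + ‖f k - T (k - c)‖ := by
    calc _ = ‖f k - (f k - T (k - c))‖ := by rw [sub_sub_cancel]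
      _ ≤ _ := norm_sub_le _ _
  linarith

/-- At a critical point an invertible Hessian makes the gradient comparable to `‖k - c‖`, so `p =
1`. At any other point the gradient is continuous and nonzero, so `p = 0`. -/
theorem isLocalBand_of_morse {lam : Mom d → ℝ} (hlam : AnalyticAt ℝ lam c)
    (hmorse : gradient lam c = 0 → (hessian lam c).det ≠ 0) : IsLocalBand c lam := by
  set g : Fin d → Mom d → ℝ := fun i k => fderiv ℝ lam k (momBasis i) with hg
  have hD : AnalyticAt ℝ (fderiv ℝ lam) c := hlam.fderiv
  have hga : ∀ i, ContDiffAt ℝ 1 (g i) c := fun i =>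
    (hD.contDiffAt (n := 1)).clm_apply contDiffAt_const
  have hev : ∀ᶠ k in 𝓝[≠] c, ContDiffAt ℝ 1 lam k ∧
      ∀ i, fderiv ℝ lam k (EuclideanSpace.single i 1) = g i k :=
    nhdsWithin_le_nhds ((hlam.eventually_analyticAt).mono fun k hk =>
      ⟨hk.contDiffAt, fun i => rfl⟩)
  by_cases h0 : fderiv ℝ lam c = 0
  · have hgrad : gradient lam c = 0 := by rw [gradient, h0, map_zero]
    have hinj : Function.Injective (fderiv ℝ (fderiv ℝ lam) c) := by
      rw [injective_iff_map_eq_zero]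
      intro v hv
      have h1 : (v.ofLp ᵥ* hessian lam c) = 0 := by
        funext j
        have h2 := congrArg (fun T : Mom d →L[ℝ] ℝ => T (momBasis j)) hv
        simp only [clm_apply_eq_sum (fderiv ℝ (fderiv ℝ lam) c) v, zero_apply] at h2
        refine Eq.trans ?_ h2
        simp [Matrix.vecMul, dotProduct, hessian]
      have := Matrix.eq_zero_of_vecMul_eq_zero (hmorse hgrad) h1
      exact (WithLp.ofLp_eq_zero 2).1 this
    obtain ⟨a, ha, hT⟩ := exists_pos_mul_norm_le _ hinj
    have hlow := eventually_norm_ge (hD.differentiableAt.hasFDerivAt) h0 ha hT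
    refine IsLocalBand.of_gradient (p := 1) le_rfl
      (fun i => IsSym.of_contDiffAt_zero (hga i) (by simp [hg, h0])) (a := (a / 2) ^ 2)
      (by positivity) ?_ hev
    filter_upwards [nhdsWithin_le_nhds hlow] with k hk
    have h1 : ‖fderiv ℝ lam k‖ ≤ Real.sqrt (∑ i, g i k * g i k) :=
      ContinuousLinearMap.opNorm_le_bound _ (Real.sqrt_nonneg _) fun v => by
        rw [Real.norm_eq_abs, mul_comm]
        refine abs_le_of_sq_le_sq ?_ (by positivity)
        rw [mul_pow, Real.sq_sqrt (Finset.sum_nonneg fun i _ => mul_self_nonneg _)]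
        exact sq_apply_le_sum _ _
    have h2 : (a / 2 * ‖k - c‖) ^ 2 ≤ ∑ i, g i k * g i k := by
      rw [← Real.sq_sqrt (Finset.sum_nonneg fun i _ => mul_self_nonneg (g i k))]
      exact pow_le_pow_left₀ (by positivity) (hk.trans h1) 2
    rw [show (1 : ℝ) + 1 = (2 : ℕ) by norm_num, Real.rpow_natCast, ← mul_pow]
    exact h2
  · set S := ∑ i, g i c * g i c with hS
    have hS0 : 0 < S := by
      refine (Finset.sum_nonneg fun i _ => mul_self_nonneg (g i c)).lt_of_ne fun h => h0 ?_
      have h1 := (Finset.sum_eq_zero_iff_of_nonneg fun i _ => mul_self_nonneg (g i c)).1 h.symm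
      ext v
      rw [clm_apply_eq_sum]
      exact Finset.sum_eq_zero fun i _ => by
        rw [show fderiv ℝ lam c (momBasis i) = 0 from mul_self_eq_zero.1 (h1 i (Finset.mem_univ i)),
          smul_zero]
    refine IsLocalBand.of_gradient (p := 0) zero_le_one
      (fun i => IsSym.of_contDiffAt (hga i)) (half_pos hS0) ?_ hev
    have hc : ContinuousAt (fun k => ∑ i, g i k * g i k) c :=
      tendsto_finsetSum _ fun i _ => (hga i).continuousAt.mul (hga i).continuousAt
    filter_upwards [nhdsWithin_le_nhds (hc.eventually_const_lt (half_lt_self hS0))] with k hk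
    rw [add_zero, Real.rpow_zero, mul_one]
    exact hk.le

theorem hasFDerivAt_norm_comp {h : Mom d → Mom d} {k : Mom d} (hh : DifferentiableAt ℝ h k)
    (h0 : h k ≠ 0) : HasFDerivAt (fun k => ‖h k‖)
      (‖h k‖⁻¹ • (innerSL ℝ (h k)).comp (fderiv ℝ h k)) k := by
  have h1 := (hh.hasFDerivAt.norm_sq).sqrt (by positivity)
  have h2 : (fun k => Real.sqrt (‖h k‖ ^ 2)) = fun k => ‖h k‖ := by
    funext k; exact Real.sqrt_sq (norm_nonneg _)
  rw [h2, Real.sqrt_sq (norm_nonneg _)] at h1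
  refine h1.congr_fderiv ?_
  ext v
  simp
  field_simp

theorem isSym_apply_of_eq_zero {h : Mom d → Mom d} (hh : AnalyticAt ℝ h c) (h0 : h c = 0)
    (j : Fin d) : IsSym c 1 fun k => h k j :=
  IsSym.of_contDiffAt_zero (((EuclideanSpace.proj (𝕜 := ℝ) j).contDiff.contDiffAt).comp c
    (hh.contDiffAt (n := 1))) (by simp [h0])

theorem eventually_ne_zero_of_injective {h : Mom d → Mom d} (hh : AnalyticAt ℝ h c) (h0 : h c = 0)
    (hinj : Function.Injective (fderiv ℝ h c)) : ∀ᶠ k in 𝓝[≠] c, h k ≠ 0 := by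
  obtain ⟨a, ha, hT⟩ := exists_pos_mul_norm_le _ hinj
  have hlow := eventually_norm_ge hh.differentiableAt.hasFDerivAt h0 ha hT
  filter_upwards [nhdsWithin_le_nhds hlow, eventually_norm_sub_pos c] with k hk hk0 h1
  rw [h1, norm_zero] at hk
  have : 0 < a / 2 * ‖k - c‖ := by positivity
  linarith

theorem isSym_norm_inv {h : Mom d → Mom d} (hh : AnalyticAt ℝ h c) (h0 : h c = 0)
    (hinj : Function.Injective (fderiv ℝ h c)) : IsSym c (-1) fun k => ‖h k‖⁻¹ := by
  obtain ⟨a, ha, hT⟩ := exists_pos_mul_norm_le _ hinj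
  have hlow := eventually_norm_ge hh.differentiableAt.hasFDerivAt h0 ha hT
  have hhj := isSym_apply_of_eq_zero hh h0
  have hsq : IsSym c (1 + 1) fun k => ∑ j, h k j * h k j :=
    IsSym.sum _ fun j _ => (hhj j).mul (hhj j)
  have hnorm : IsSym c 1 fun k => ‖h k‖ := by
    have h1 := hsq.rpow (a := (a / 2) ^ 2) (by positivity) (by
      filter_upwards [nhdsWithin_le_nhds hlow] with k hk
      rw [show (1 : ℝ) + 1 = (2 : ℕ) by norm_num, Real.rpow_natCast, ← mul_pow]
      calc _ ≤ ‖h k‖ ^ 2 := pow_le_pow_left₀ (by positivity) hk 2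
        _ = _ := by rw [EuclideanSpace.real_norm_sq_eq]; simp only [pow_two]) (1 / 2)
    have h2 : (fun k => (∑ j, h k j * h k j) ^ (1 / 2 : ℝ)) = fun k => ‖h k‖ := by
      funext k
      rw [← Real.sqrt_eq_rpow, EuclideanSpace.norm_eq]
      simp [pow_two]
    rw [h2] at h1
    norm_num at h1
    exact h1
  exact hnorm.inv (half_pos ha) (by
    filter_upwards [nhdsWithin_le_nhds hlow] with k hk
    rwa [Real.rpow_one])

/-- The gradient has order `0`; only its lower bound needs the tilt condition. Let `v` solve `Dh(c)
v = h(k) / ‖h(k)‖`, so that `‖v‖ ≤ 1 / a`. Along `v`, the term `s ‖h‖` has derivative close to `s`,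
of modulus `1`, while `e` has derivative at most about `κ < 1`; they cannot cancel. -/
theorem isLocalBand_cone {e : Mom d → ℝ} {h : Mom d → Mom d} (he : AnalyticAt ℝ e c)
    (hh : AnalyticAt ℝ h c) (h0 : h c = 0) (hinj : Function.Injective (fderiv ℝ h c)) {κ : ℝ}
    (hκ : κ < 1) (htilt : ∀ v, |fderiv ℝ e c v| ≤ κ * ‖fderiv ℝ h c v‖) {s : ℝ} (hs : |s| = 1) :
    IsLocalBand c fun k => e k + s * ‖h k‖ := by
  obtain ⟨a, ha, hT⟩ := exists_pos_mul_norm_le _ hinj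
  have hsurj : Function.Surjective (fderiv ℝ h c) :=
    (LinearMap.injective_iff_surjective (f := (fderiv ℝ h c : Mom d →ₗ[ℝ] Mom d))).1 hinj
  have hhj := isSym_apply_of_eq_zero hh h0
  have hinv := isSym_norm_inv hh h0 hinj
  set g : Fin d → Mom d → ℝ := fun i k => fderiv ℝ e k (momBasis i) +
    s * ((∑ j, h k j * (fderiv ℝ h k (momBasis i)) j) * ‖h k‖⁻¹) with hg
  have hgs : ∀ i, IsSym c 0 (g i) := fun i => by
    refine (IsSym.of_contDiffAt ((he.fderiv.contDiffAt (n := 1)).clm_apply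
      contDiffAt_const)).add (IsSym.const_mul ?_ s)
    have h1 : IsSym c (1 + 0) fun k => ∑ j, h k j * (fderiv ℝ h k (momBasis i)) j :=
      IsSym.sum _ fun j _ => (hhj j).mul (IsSym.of_contDiffAt
        (((EuclideanSpace.proj (𝕜 := ℝ) j).contDiff.contDiffAt).comp c
          ((hh.fderiv.contDiffAt (n := 1)).clm_apply contDiffAt_const)))
    have h2 := h1.mul hinv
    norm_num at h2
    exact h2
  have hne := eventually_ne_zero_of_injective hh h0 hinj
  have hder : ∀ᶠ k in 𝓝[≠] c, ContDiffAt ℝ 1 (fun k => e k + s * ‖h k‖) k ∧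
      HasFDerivAt (fun k => e k + s * ‖h k‖) (fderiv ℝ e k +
        s • (‖h k‖⁻¹ • (innerSL ℝ (h k)).comp (fderiv ℝ h k))) k := by
    filter_upwards [hne, nhdsWithin_le_nhds he.eventually_analyticAt,
      nhdsWithin_le_nhds hh.eventually_analyticAt] with k hk hek hhk
    exact ⟨hek.contDiffAt.add (contDiffAt_const.mul (hhk.contDiffAt.norm ℝ hk)),
      hek.differentiableAt.hasFDerivAt.add
        ((hasFDerivAt_norm_comp hhk.differentiableAt hk).const_mul s)⟩
  have hgeq : ∀ k i, (fderiv ℝ e k + s • (‖h k‖⁻¹ • (innerSL ℝ (h k)).comp (fderiv ℝ h k)))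
      (momBasis i) = g i k := fun k i => by
    simp only [hg, add_apply, smul_apply, ContinuousLinearMap.comp_apply, innerSL_apply_apply,
      smul_eq_mul, PiLp.inner_apply, RCLike.inner_apply, conj_trivial]
    rw [mul_comm ‖h k‖⁻¹]
    simp only [mul_comm]
  have hκ' : 0 < (1 - κ) / 2 := by linarith
  -- Freezing `De` and `Dh` at `c` costs at most `(1 - κ) / 4` each along `v`, which leaves `(1 - κ)
  -- / 2` of the gap `1 - κ`.
  set ε := (1 - κ) / 4 * a with hε
  have hε0 : 0 < ε := mul_pos (by linarith) ha
  have he1 : ∀ᶠ k in 𝓝 c, ‖fderiv ℝ e k - fderiv ℝ e c‖ < ε := by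
    have := he.fderiv.continuousAt.eventually (Metric.ball_mem_nhds _ hε0)
    exact this.mono fun k hk => mem_ball_iff_norm.1 hk
  have hh1 : ∀ᶠ k in 𝓝 c, ‖fderiv ℝ h k - fderiv ℝ h c‖ < ε := by
    have := hh.fderiv.continuousAt.eventually (Metric.ball_mem_nhds _ hε0)
    exact this.mono fun k hk => mem_ball_iff_norm.1 hk
  refine IsLocalBand.of_gradient (p := 0) zero_le_one hgs (a := ((1 - κ) / 2 * a) ^ 2)
    (by positivity) ?_ (hder.mono fun k hk => ⟨hk.1, fun i => by rw [hk.2.fderiv]; exact hgeq k i⟩)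
  filter_upwards [hne, nhdsWithin_le_nhds he1, nhdsWithin_le_nhds hh1] with k hk hek hhk
  rw [add_zero, Real.rpow_zero, mul_one]
  have hn0 : 0 < ‖h k‖ := norm_pos_iff.2 hk
  set u : Mom d := ‖h k‖⁻¹ • h k with hu
  have hu1 : ‖u‖ = 1 := by
    rw [hu, norm_smul, norm_inv, norm_norm, inv_mul_cancel₀ hn0.ne']
  obtain ⟨v, hv⟩ := hsurj u
  have hva : a * ‖v‖ ≤ 1 := by
    have := hT v
    rwa [hv, hu1] at this
  set T := fderiv ℝ e k + s • (‖h k‖⁻¹ • (innerSL ℝ (h k)).comp (fderiv ℝ h k)) with hTdef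
  have hTv : T v = fderiv ℝ e k v + s * ⟪u, fderiv ℝ h k v⟫_ℝ := by
    simp only [hTdef, add_apply, smul_apply, ContinuousLinearMap.comp_apply, innerSL_apply_apply,
      smul_eq_mul, hu, inner_smul_left, conj_trivial]
  have hεv : ε * ‖v‖ ≤ (1 - κ) / 4 := by
    rw [hε, mul_assoc]
    exact mul_le_of_le_one_right (by linarith) hva
  have hx1 : |fderiv ℝ e k v| ≤ κ + (1 - κ) / 4 := by
    have h1 : fderiv ℝ e k v = fderiv ℝ e c v + (fderiv ℝ e k - fderiv ℝ e c) v := by simp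
    rw [h1]
    refine (abs_add_le _ _).trans (add_le_add ?_ ?_)
    · have := htilt v
      rwa [hv, hu1, mul_one] at this
    · exact (((fderiv ℝ e k - fderiv ℝ e c).le_opNorm v).trans
        (mul_le_mul_of_nonneg_right hek.le (norm_nonneg v))).trans hεv
  have hx2 : 1 - (1 - κ) / 4 ≤ |s * ⟪u, fderiv ℝ h k v⟫_ℝ| := by
    have h1 : fderiv ℝ h k v = u + (fderiv ℝ h k - fderiv ℝ h c) v := by simp [hv]
    have h2 : |⟪u, (fderiv ℝ h k - fderiv ℝ h c) v⟫_ℝ| ≤ (1 - κ) / 4 := by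
      refine (abs_real_inner_le_norm _ _).trans ?_
      rw [hu1, one_mul]
      exact (((fderiv ℝ h k - fderiv ℝ h c).le_opNorm v).trans
        (mul_le_mul_of_nonneg_right hhk.le (norm_nonneg v))).trans hεv
    rw [abs_mul, hs, one_mul, h1, inner_add_right, real_inner_self_eq_norm_sq, hu1, one_pow]
    refine le_trans ?_ (le_abs_self _)
    have := neg_abs_le ⟪u, (fderiv ℝ h k - fderiv ℝ h c) v⟫_ℝ
    linarith
  have hx3 : (1 - κ) / 2 ≤ |T v| := by
    rw [hTv]
    have := abs_sub_abs_le_abs_sub (s * ⟪u, fderiv ℝ h k v⟫_ℝ) (-fderiv ℝ e k v)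
    rw [sub_neg_eq_add, abs_neg, add_comm (s * _)] at this
    linarith
  have hx4 := sq_apply_le_sum T v
  simp only [hTdef, hgeq] at hx4
  rw [← hTdef, ← sq_abs] at hx4
  set G := ∑ i, g i k * g i k with hG
  have hG0 : 0 ≤ G := Finset.sum_nonneg fun i _ => mul_self_nonneg _
  calc ((1 - κ) / 2 * a) ^ 2 ≤ (|T v| * a) ^ 2 := by gcongr
    _ = |T v| ^ 2 * a ^ 2 := by ring
    _ ≤ ‖v‖ ^ 2 * G * a ^ 2 := by gcongr
    _ = (a * ‖v‖) ^ 2 * G := by ring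
    _ ≤ 1 * G := by
      gcongr
      exact pow_le_one₀ (by positivity) hva
    _ = G := one_mul _

/-- The weak tilt condition, without the local inverse. -/
theorem abs_fderiv_le_of_gradient_comp_inverse {e : Mom d → ℝ} {h : Mom d → Mom d}
    (he : AnalyticAt ℝ e c) (hh : AnalyticAt ℝ h c) (h0 : h c = 0)
    (hdet : (fderiv ℝ h c).det ≠ 0)
    (htilt : ∀ hinv : Mom d → Mom d, (∀ᶠ k in 𝓝 c, hinv (h k) = k) →
        (∀ᶠ x in 𝓝 0, h (hinv x) = x) →
        ∃ κ : ℝ, κ < 1 ∧ ‖gradient (e ∘ hinv) 0‖ < κ) :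
    Function.Injective (fderiv ℝ h c) ∧
      ∃ κ : ℝ, κ < 1 ∧ ∀ v, |fderiv ℝ e c v| ≤ κ * ‖fderiv ℝ h c v‖ := by
  set T : Mom d ≃L[ℝ] Mom d := (fderiv ℝ h c).toContinuousLinearEquivOfDetNeZero hdet with hT
  have hTc : (T : Mom d →L[ℝ] Mom d) = fderiv ℝ h c := by ext1 v; rfl
  have hs : HasStrictFDerivAt h (T : Mom d →L[ℝ] Mom d) c := by
    rw [hTc]; exact hh.hasStrictFDerivAt
  refine ⟨by rw [← hTc]; exact T.injective, ?_⟩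
  have hl := hs.eventually_left_inverse
  have hr := hs.eventually_right_inverse
  rw [h0] at hr
  obtain ⟨κ, hκ, hgrad⟩ := htilt (hs.localInverse h T c) hl hr
  refine ⟨κ, hκ, fun v => ?_⟩
  have hd : HasFDerivAt (hs.localInverse h T c) (T.symm : Mom d →L[ℝ] Mom d) 0 := by
    have := hs.to_localInverse.hasFDerivAt
    rwa [h0] at this
  have hli : hs.localInverse h T c 0 = c := by rw [← h0]; exact hs.localInverse_apply_image
  have hcomp : HasFDerivAt (e ∘ hs.localInverse h T c)
      ((fderiv ℝ e c).comp (T.symm : Mom d →L[ℝ] Mom d)) 0 :=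
    HasFDerivAt.comp 0 (by rw [hli]; exact he.differentiableAt.hasFDerivAt) hd
  rw [gradient, LinearIsometryEquiv.norm_map, hcomp.fderiv] at hgrad
  have h1 : fderiv ℝ e c v = (fderiv ℝ e c).comp (T.symm : Mom d →L[ℝ] Mom d) (T v) := by simp
  rw [h1, ← hTc, ← Real.norm_eq_abs]
  exact (ContinuousLinearMap.le_opNorm _ _).trans
    (mul_le_mul_of_nonneg_right hgrad.le (norm_nonneg _))

end bands

end LAP

/-! ### Reduction of the squared resolvent to local bands. -/

namespace LAP

section localFrame

variable {d L m : ℕ}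

theorem continuousAt_matrix_inv {X : Type*} [TopologicalSpace X]
    {K : X → Matrix (Fin L) (Fin L) ℂ} {x : X} (hK : ContinuousAt K x) (h0 : (K x).det ≠ 0) :
    ContinuousAt (fun y => (K y)⁻¹) x := by
  simp only [Matrix.inv_def, Ring.inverse_eq_inv']
  have h1 : ContinuousAt (fun y => (K y).det) x :=
    (Continuous.matrix_det continuous_id).continuousAt.comp hK
  have h2 : ContinuousAt (fun y => (K y).adjugate) x :=
    (Continuous.matrix_adjugate continuous_id).continuousAt.comp hK
  exact (h1.inv₀ h0).smul h2

theorem mult_pos_of_mulVec {A : Matrix (Fin L) (Fin L) ℂ} {E : ℝ} {v : Fin L → ℂ} (hv : v ≠ 0)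
    (h : A *ᵥ v = (E : ℂ) • v) : 0 < mult A E := by
  refine Nat.pos_of_ne_zero fun h0 => hv ?_
  have h1 : v ∈ Module.End.eigenspace (Matrix.toLin' A) (E : ℂ) := by
    rw [Module.End.mem_eigenspace_iff, Matrix.toLin'_apply, h]
  rw [Submodule.finrank_eq_zero.1 h0] at h1
  exact (Submodule.mem_bot ℂ).1 h1

theorem exists_mulVec_of_mult_pos {A : Matrix (Fin L) (Fin L) ℂ} {E : ℝ} (h : 0 < mult A E) :
    ∃ v : Fin L → ℂ, v ≠ 0 ∧ A *ᵥ v = (E : ℂ) • v := by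
  obtain ⟨v, hv, hv0⟩ := Submodule.exists_mem_ne_zero_of_ne_bot
    (p := Module.End.eigenspace (Matrix.toLin' A) (E : ℂ)) fun h0 => by
      rw [mult, h0, finrank_bot] at h
      exact lt_irrefl _ h
  rw [Module.End.mem_eigenspace_iff, Matrix.toLin'_apply] at hv
  exact ⟨v, hv0, hv⟩

/-- An analytic orthonormal frame for the spectral subspace of `A k` near the eigenvalue `E` of
`A c`, and the bound for the square of the resolvent on the orthogonal complement. -/
theorem exists_local_frame {A : Mom d → Matrix (Fin L) (Fin L) ℂ} {c : Mom d}
    (hA : MatAnalyticAt A c) (hherm : ∀ k, (A k).IsHermitian) {E : ℝ} (hm : mult (A c) E = m) :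
    ∃ (Φ : Mom d → Matrix (Fin L) (Fin m) ℂ) (r B : ℝ), 0 < r ∧ MatAnalyticAt Φ c ∧
      (Φ c)ᴴ * A c * Φ c = (E : ℂ) • 1 ∧
      (∀ᶠ k in 𝓝 c, (Φ k)ᴴ * Φ k = 1 ∧ A k * Φ k = Φ k * ((Φ k)ᴴ * A k * Φ k)) ∧
      ∀ᶠ k in 𝓝 c, ∀ w : ℂ, ‖w‖ ≤ r →
        (A k - (E : ℂ) • 1 + Φ k * (Φ k)ᴴ - w • 1).det ≠ 0 ∧
        ∀ a b, ‖((A k - (E : ℂ) • 1 + Φ k * (Φ k)ᴴ - w • 1)⁻¹ *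
          (A k - (E : ℂ) • 1 + Φ k * (Φ k)ᴴ - w • 1)⁻¹ * (1 - Φ k * (Φ k)ᴴ) : Matrix (Fin L) (Fin L) ℂ) a b‖ ≤ B := by
  obtain ⟨Φ₀, h1, h2, h3⟩ := exists_eigenframe (A c) hm
  obtain ⟨Φ, hΦ, hΦc, hev⟩ := exists_analytic_frame hA (hherm c) h1 h2
    (det_add_frame_ne_zero (hherm c) h1 h2 h3 two_ne_zero)
  -- Momentum and spectral parameter are treated jointly: continuity at `(c, 0)` and a product
  -- neighbourhood give invertibility and the bound uniformly in `w`.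
  set T : Mom d × ℂ → Matrix (Fin L) (Fin L) ℂ := fun u =>
    A u.1 - (E : ℂ) • 1 + Φ u.1 * (Φ u.1)ᴴ - u.2 • 1 with hT
  have hT0 : (T (c, 0)).det ≠ 0 := by
    have := det_add_frame_ne_zero (hherm c) h1 h2 h3 one_ne_zero
    simpa [hT, hΦc] using this
  have hPc : ContinuousAt (fun k => Φ k * (Φ k)ᴴ) c := (hΦ.mul hΦ.conjTranspose).continuousAt
  have hPc' : ContinuousAt (fun u : Mom d × ℂ => Φ u.1 * (Φ u.1)ᴴ) (c, 0) :=
    ContinuousAt.comp (x := ((c, 0) : Mom d × ℂ)) (f := Prod.fst) hPc continuousAt_fst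
  have hAc' : ContinuousAt (fun u : Mom d × ℂ => A u.1) (c, 0) :=
    ContinuousAt.comp (x := ((c, 0) : Mom d × ℂ)) (f := Prod.fst) hA.continuousAt continuousAt_fst
  have hTc : ContinuousAt T (c, 0) :=
    ((hAc'.sub continuousAt_const).add hPc').sub (continuousAt_snd.smul continuousAt_const)
  set S : Mom d × ℂ → Matrix (Fin L) (Fin L) ℂ := fun u =>
    (T u)⁻¹ * (T u)⁻¹ * (1 - Φ u.1 * (Φ u.1)ᴴ) with hS
  have hTi := continuousAt_matrix_inv hTc hT0
  have hSc : ContinuousAt S (c, 0) := (hTi.mul hTi).mul (continuousAt_const.sub hPc')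
  have hdet : ∀ᶠ u in 𝓝 ((c, 0) : Mom d × ℂ), (T u).det ≠ 0 :=
    ((Continuous.matrix_det continuous_id).continuousAt.comp hTc).eventually_ne hT0
  have hbd : ∀ᶠ u in 𝓝 ((c, 0) : Mom d × ℂ), ∑ a, ∑ b, ‖S u a b‖ < ∑ a, ∑ b, ‖S (c, 0) a b‖ + 1 := by
    have : ContinuousAt (fun u => ∑ a, ∑ b, ‖S u a b‖) (c, 0) :=
      tendsto_finsetSum _ fun a _ => tendsto_finsetSum _ fun b _ =>
        (((continuous_apply b).comp (continuous_apply a)).continuousAt.comp hSc).norm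
    exact this.eventually_lt_const (lt_add_one _)
  have hboth := hdet.and hbd
  rw [nhds_prod_eq, eventually_prod_iff] at hboth
  obtain ⟨pa, hpa, pb, hpb, hab⟩ := hboth
  obtain ⟨r, hr, hrb⟩ := Metric.eventually_nhds_iff.1 hpb
  refine ⟨Φ, r / 2, ∑ a, ∑ b, ‖S (c, 0) a b‖ + 1, half_pos hr, hΦ, ?_, hev, ?_⟩
  · have h4 : A c * Φ₀ = (E : ℂ) • Φ₀ := by
      rw [Matrix.sub_mul, sub_eq_zero] at h2
      simpa using h2
    rw [hΦc, Matrix.mul_assoc, h4, Matrix.mul_smul, h1]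
  · filter_upwards [hpa] with k hk w hw
    obtain ⟨h4, h5⟩ := hab hk (hrb (y := w) (by rw [dist_zero_right]; linarith))
    refine ⟨h4, fun a b => le_trans ?_ h5.le⟩
    exact (Finset.single_le_sum (f := fun b => ‖S (k, w) a b‖) (fun b _ => norm_nonneg _)
      (Finset.mem_univ b)).trans (Finset.single_le_sum (f := fun a => ∑ b, ‖S (k, w) a b‖)
        (fun a _ => Finset.sum_nonneg fun b _ => norm_nonneg _) (Finset.mem_univ a))

/-- Orthogonality of the `π j` is not needed: they sum to `1` and each maps into an eigenspace, on
which the resolvent acts as the scalar `(lam j - z)⁻¹`. -/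
theorem inv_sq_eq_sum {n : ℕ} {M : Matrix (Fin m) (Fin m) ℂ} {lam : Fin n → ℝ}
    {π : Fin n → Matrix (Fin m) (Fin m) ℂ} (hsum : ∑ j, π j = 1)
    (hπ : ∀ j, M * π j = (lam j : ℂ) • π j) {z : ℂ} (hz : z.im ≠ 0) (hM : (M - z • 1).det ≠ 0) :
    (M - z • 1)⁻¹ * (M - z • 1)⁻¹ = ∑ j, (((lam j : ℂ) - z)⁻¹) ^ 2 • π j := by
  have h1 : ∀ j, (M - z • 1)⁻¹ * π j = ((lam j : ℂ) - z)⁻¹ • π j := fun j => by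
    have h0 : (lam j : ℂ) - z ≠ 0 := ofReal_sub_ne_zero hz _
    have h2 : (M - z • 1) * π j = ((lam j : ℂ) - z) • π j := by
      rw [Matrix.sub_mul, hπ, Matrix.smul_mul, Matrix.one_mul, sub_smul]
    have h3 : π j = ((lam j : ℂ) - z)⁻¹ • ((M - z • 1) * π j) := by
      rw [h2, inv_smul_smul₀ h0]
    conv_lhs => rw [h3]
    rw [Matrix.mul_smul, ← Matrix.mul_assoc, Matrix.nonsing_inv_mul _ (isUnit_iff_ne_zero.2 hM),
      Matrix.one_mul]
  calc _ = (M - z • 1)⁻¹ * ((M - z • 1)⁻¹ * ∑ j, π j) := by rw [hsum, Matrix.mul_one]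
    _ = _ := by
      rw [Finset.mul_sum, Finset.mul_sum]
      refine Finset.sum_congr rfl fun j _ => ?_
      rw [h1, Matrix.mul_smul, h1, smul_smul, pow_two]

/-- The matrix elements of `π` are symbols of order `p`. -/
def IsMatSym {n : ℕ} (c : Mom d) (p : ℝ) (π : Mom d → Matrix (Fin m) (Fin n) ℂ) : Prop :=
  ∀ a b, IsSym c p fun k => π k a b

theorem IsMatSym.mul {l n : ℕ} {c : Mom d} {π : Mom d → Matrix (Fin l) (Fin m) ℂ}
    {ρ : Mom d → Matrix (Fin m) (Fin n) ℂ} (hπ : IsMatSym c 0 π) (hρ : IsMatSym c 0 ρ) :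
    IsMatSym c 0 fun k => π k * ρ k := fun a b => by
  simp only [Matrix.mul_apply]
  exact IsSym.sum _ fun j _ => by simpa using (hπ a j).mul (hρ j b)

theorem MatAnalyticAt.isMatSym {n : ℕ} {c : Mom d} {π : Mom d → Matrix (Fin m) (Fin n) ℂ}
    (h : MatAnalyticAt π c) : IsMatSym c 0 π := fun a b => IsSym.of_contDiffAt (h a b).contDiffAt

/-- Near the point `c` of momentum space and the energy `E`, the square of the resolvent is the
sum of the contributions of finitely many local bands, up to a bounded remainder. -/
def HasLocalBands (A : Mom d → Matrix (Fin L) (Fin L) ℂ) (c : Mom d) (E : ℝ) : Prop :=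
  ∃ (n : ℕ) (lam : Fin n → Mom d → ℝ) (p : Fin n → Mom d → Matrix (Fin L) (Fin L) ℂ) (δ B : ℝ),
    0 < δ ∧ (∀ j, IsLocalBand c (lam j)) ∧ (∀ j, IsMatSym c 0 (p j)) ∧
    ∀ᶠ k in 𝓝[≠] c, ∀ z : ℂ, z.im ≠ 0 → ‖z - E‖ ≤ δ → ∀ a b,
      ‖((A k - z • 1)⁻¹ * (A k - z • 1)⁻¹) a b -
        ∑ j, p j k a b * (((lam j k : ℂ) - z)⁻¹) ^ 2‖ ≤ B

/-- Spectral data of the small matrix `Φᴴ A Φ` are transported back to `A` with coefficients `Φ π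
Φᴴ`, and the complement of the frame is the bounded remainder. The spectral data may be singular at
`c` and are required only off that point. -/
theorem hasLocalBands_of_frame {n : ℕ} {A : Mom d → Matrix (Fin L) (Fin L) ℂ} {c : Mom d}
    (hherm : ∀ k, (A k).IsHermitian) {E r B : ℝ} (hr : 0 < r)
    {Φ : Mom d → Matrix (Fin L) (Fin m) ℂ} (hΦ : MatAnalyticAt Φ c)
    (hev : ∀ᶠ k in 𝓝 c, (Φ k)ᴴ * Φ k = 1 ∧ A k * Φ k = Φ k * ((Φ k)ᴴ * A k * Φ k))
    (hT : ∀ᶠ k in 𝓝 c, ∀ w : ℂ, ‖w‖ ≤ r →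
        (A k - (E : ℂ) • 1 + Φ k * (Φ k)ᴴ - w • 1).det ≠ 0 ∧
        ∀ a b, ‖((A k - (E : ℂ) • 1 + Φ k * (Φ k)ᴴ - w • 1)⁻¹ *
          (A k - (E : ℂ) • 1 + Φ k * (Φ k)ᴴ - w • 1)⁻¹ * (1 - Φ k * (Φ k)ᴴ) : Matrix (Fin L) (Fin L) ℂ) a b‖ ≤ B)
    {lam : Fin n → Mom d → ℝ} (hlam : ∀ j, IsLocalBand c (lam j))
    {π : Fin n → Mom d → Matrix (Fin m) (Fin m) ℂ} (hπ : ∀ j, IsMatSym c 0 (π j))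
    (hspec : ∀ᶠ k in 𝓝[≠] c, ∑ j, π j k = 1 ∧
      ∀ j, ((Φ k)ᴴ * A k * Φ k) * π j k = (lam j k : ℂ) • π j k) : HasLocalBands A c E := by
  refine ⟨n, lam, fun j k => Φ k * π j k * (Φ k)ᴴ, r, B, hr, hlam, fun j =>
    (hΦ.isMatSym.mul (hπ j)).mul hΦ.conjTranspose.isMatSym, ?_⟩
  filter_upwards [nhdsWithin_le_nhds hev, nhdsWithin_le_nhds hT, hspec]
    with k ⟨h1, h2⟩ hTk ⟨hs1, hs2⟩ z hz hzE a b
  obtain ⟨hdet, hB⟩ := hTk _ hzE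
  have hMh : ((Φ k)ᴴ * A k * Φ k).IsHermitian := by
    rw [Matrix.IsHermitian]
    simp only [Matrix.conjTranspose_mul, Matrix.conjTranspose_conjTranspose, (hherm k).eq,
      Matrix.mul_assoc]
  rw [resolvent_sq_eq (hherm k) h1 h2 hz hdet,
    inv_sq_eq_sum hs1 hs2 hz (det_sub_smul_one_ne_zero hMh hz)]
  have h3 : (Φ k * (∑ j, (((lam j k : ℂ) - z)⁻¹) ^ 2 • π j k) * (Φ k)ᴴ) a b =
      ∑ j, (Φ k * π j k * (Φ k)ᴴ) a b * (((lam j k : ℂ) - z)⁻¹) ^ 2 := by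
    rw [Matrix.mul_sum, Matrix.sum_mul, Matrix.sum_apply]
    refine Finset.sum_congr rfl fun j _ => ?_
    rw [Matrix.mul_smul, Matrix.smul_mul, Matrix.smul_apply, smul_eq_mul, mul_comm]
  rw [Matrix.add_apply, h3, add_sub_cancel_left]
  exact hB a b

end localFrame

section threeDim

variable {L : ℕ} {𝓔 : Mom 3 → Matrix (Fin L) (Fin L) ℂ} {c : Mom 3} {E : ℝ}

/-- The frame has no columns, so there are no bands and the squared resolvent is itself the bounded
remainder. -/
theorem hasLocalBands_of_mult_eq_zero (hA : MatAnalyticAt 𝓔 c) (hherm : ∀ k, (𝓔 k).IsHermitian)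
    (hm : mult (𝓔 c) E = 0) : HasLocalBands 𝓔 c E := by
  obtain ⟨Φ, r, B, hr, hΦ, -, hev, hT⟩ := exists_local_frame hA hherm hm
  exact hasLocalBands_of_frame (n := 0) hherm hr hΦ hev hT (lam := Fin.elim0) (fun j => j.elim0)
    (π := fun j => j.elim0) (fun j => j.elim0)
    (Eventually.of_forall fun k => ⟨Subsingleton.elim _ _, fun j => j.elim0⟩)

/-- The compressed `1 × 1` matrix is an analytic band which is simple at `c`, so the Morse
hypothesis applies to it. -/
theorem hasLocalBands_of_mult_eq_one (hA : MatAnalyticAt 𝓔 c) (hherm : ∀ k, (𝓔 k).IsHermitian)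
    (hmorse : BandsMorse 𝓔) (hm : mult (𝓔 c) E = 1) : HasLocalBands 𝓔 c E := by
  obtain ⟨Φ, r, B, hr, hΦ, hc, hev, hT⟩ := exists_local_frame hA hherm hm
  set M : Mom 3 → Matrix (Fin 1) (Fin 1) ℂ := fun k => (Φ k)ᴴ * 𝓔 k * Φ k with hM
  have hMa : MatAnalyticAt M c := (hΦ.conjTranspose.mul hA).mul hΦ
  set lam : Mom 3 → ℝ := fun k => (M k 0 0).re with hlam
  have hMlam : ∀ k, M k = (lam k : ℂ) • 1 := fun k => by
    have hMh : (M k).IsHermitian := by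
      rw [Matrix.IsHermitian, hM]
      simp only [Matrix.conjTranspose_mul, Matrix.conjTranspose_conjTranspose, (hherm k).eq,
        Matrix.mul_assoc]
    ext i j
    rw [Subsingleton.elim i 0, Subsingleton.elim j 0, Matrix.smul_apply, Matrix.one_apply_eq,
      smul_eq_mul, mul_one]
    exact (Complex.conj_eq_iff_re.1 (hMh.apply 0 0)).symm
  have hlamc : lam c = E := by
    simp only [hlam, hM, hc]
    simp
  have hsimple : IsSimpleBandAt 𝓔 lam c := by
    refine ⟨analyticAt_re (hMa 0 0), ?_, by rw [hlamc, hm]⟩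
    filter_upwards [hev] with k ⟨h1, h2⟩
    refine mult_pos_of_mulVec (v := fun i => Φ k i 0) (fun h0 => ?_) ?_
    · have h3 := congrFun (congrFun h1 0) 0
      rw [Matrix.mul_apply, Matrix.one_apply_eq] at h3
      refine zero_ne_one (Eq.trans ?_ h3)
      exact (Finset.sum_eq_zero fun i _ => by rw [show Φ k i 0 = 0 from congrFun h0 i, mul_zero]).symm
    · change 𝓔 k * Φ k = Φ k * M k at h2
      rw [hMlam, Matrix.mul_smul, Matrix.mul_one] at h2
      funext i
      exact congrFun (congrFun h2 i) 0
  refine hasLocalBands_of_frame (n := 1) hherm hr hΦ hev hT (lam := fun _ => lam)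
    (fun _ => isLocalBand_of_morse hsimple.analytic (hmorse c lam hsimple))
    (π := fun _ _ => 1) (fun _ => (MatAnalyticAt.const 1).isMatSym)
    (Eventually.of_forall fun k => ⟨by simp, fun _ => ?_⟩)
  change M k * 1 = _
  rw [hMlam, Matrix.mul_one]

/-- The coefficients of a Hermitian `2 × 2` matrix in the basis of Pauli matrices. -/
noncomputable def pauliCoeff (M : Matrix (Fin 2) (Fin 2) ℂ) : Mom 3 :=
  !₂[(M 0 1).re, -(M 0 1).im, ((M 0 0).re - (M 1 1).re) / 2]

theorem eq_pauli_sum {M : Matrix (Fin 2) (Fin 2) ℂ} (hM : M.IsHermitian) :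
    M = ((((M 0 0).re + (M 1 1).re) / 2 : ℝ) : ℂ) • (1 : Matrix (Fin 2) (Fin 2) ℂ) +
      ∑ j, (pauliCoeff M j : ℂ) • pauli j := by
  have h0 := Complex.conj_eq_iff_im.1 (hM.apply 0 0)
  have h1 := Complex.conj_eq_iff_im.1 (hM.apply 1 1)
  have h2 : M 1 0 = conj (M 0 1) := (hM.apply 1 0).symm
  ext i j
  fin_cases i <;> fin_cases j <;> refine Complex.ext ?_ ?_ <;>
    simp [Fin.sum_univ_three, pauliCoeff, pauli, h2, h0, h1] <;> ring

theorem pauli_sum_mul_self (h : Mom 3) :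
    (∑ j, (h j : ℂ) • pauli j) * (∑ j, (h j : ℂ) • pauli j) =
      ((‖h‖ ^ 2 : ℝ) : ℂ) • (1 : Matrix (Fin 2) (Fin 2) ℂ) := by
  rw [EuclideanSpace.real_norm_sq_eq]
  ext i j
  fin_cases i <;> fin_cases j <;> refine Complex.ext ?_ ?_ <;>
    simp [Fin.sum_univ_three, pauli, Matrix.mul_apply, Fin.sum_univ_two, pow_two] <;> ring

end threeDim

end LAP

/-! ### Weyl points. -/

namespace LAP

section twoBand

variable {L : ℕ} {𝓔 : Mom 3 → Matrix (Fin L) (Fin L) ℂ} {c : Mom 3} {E : ℝ}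

theorem analyticAt_pauliCoeff {V : Type*} [NormedAddCommGroup V] [NormedSpace ℝ V]
    {M : V → Matrix (Fin 2) (Fin 2) ℂ} {x : V} (hM : MatAnalyticAt M x) :
    AnalyticAt ℝ (fun y => pauliCoeff (M y)) x := by
  have h : AnalyticAt ℝ (fun y => ![(M y 0 1).re, -(M y 0 1).im,
      ((M y 0 0).re - (M y 1 1).re) / 2]) x := by
    refine analyticAt_pi_iff.2 fun j => ?_
    fin_cases j
    · exact analyticAt_re (hM 0 1)
    · exact (analyticAt_im (hM 0 1)).neg
    · exact ((analyticAt_re (hM 0 0)).sub (analyticAt_re (hM 1 1))).div_const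
  exact ((EuclideanSpace.equiv (Fin 3) ℝ).symm.toContinuousLinearMap.analyticAt _).comp h

/-- This makes the type I hypothesis, which refers to frames of the Riesz projection, applicable to
the frame obtained from the implicit function theorem. Another eigenvalue of `𝓔 c` within `r` of `E`
is excluded, as its eigenvectors would be both in the range of the frame and orthogonal to it. -/
theorem isTwoBandModel_of_frame (hherm : ∀ k, (𝓔 k).IsHermitian) {r : ℝ} (hr : 0 < r)
    {Φ : Mom 3 → Matrix (Fin L) (Fin 2) ℂ} (hA : MatAnalyticAt 𝓔 c) (hΦ : MatAnalyticAt Φ c)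
    (hc : (Φ c)ᴴ * 𝓔 c * Φ c = (E : ℂ) • 1)
    (hev : ∀ᶠ k in 𝓝 c, (Φ k)ᴴ * Φ k = 1 ∧ 𝓔 k * Φ k = Φ k * ((Φ k)ᴴ * 𝓔 k * Φ k))
    (hT : ∀ᶠ k in 𝓝 c, ∀ w : ℂ, ‖w‖ ≤ r →
        (𝓔 k - (E : ℂ) • 1 + Φ k * (Φ k)ᴴ - w • 1).det ≠ 0)
    {e : Mom 3 → ℝ} {h : Mom 3 → Mom 3}
    (heh : ∀ k, (Φ k)ᴴ * 𝓔 k * Φ k =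
      (e k : ℂ) • (1 : Matrix (Fin 2) (Fin 2) ℂ) + ∑ j, (h k j : ℂ) • pauli j) :
    IsTwoBandModel 𝓔 c E e h := by
  have hT' : ∀ᶠ k in 𝓝 c, ∀ w : ℝ, |w| ≤ r →
      (𝓔 k - (E : ℂ) • 1 + Φ k * (Φ k)ᴴ - (w : ℂ) • 1).det ≠ 0 := hT.mono fun k hk w hw =>
    hk w (by rwa [Complex.norm_real])
  refine ⟨r, Φ, hr, fun E' hE' hm => ?_, hΦ, ?_, Eventually.of_forall heh⟩
  · by_contra hne
    obtain ⟨h1, h2⟩ := hev.self_of_nhds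
    obtain ⟨v, hv0, hv⟩ := exists_mulVec_of_mult_pos hm
    have h3 := frame_mulVec_of_near (hherm c) h2 (hT'.self_of_nhds _ hE') h1 hv
    have h4 := frame_conjTranspose_mulVec_of_far (hherm c) h2 (E := E) (r := |E' - E|)
      (by rw [hc]; simpa [sub_eq_zero] using hne) le_rfl h1 hv
    rw [← Matrix.mulVec_mulVec, h4, Matrix.mulVec_zero] at h3
    exact hv0 h3.symm
  · have hMa : MatAnalyticAt (fun k => (Φ k)ᴴ * 𝓔 k * Φ k - (E : ℂ) • 1) c :=
      ((hΦ.conjTranspose.mul hA).mul hΦ).sub (MatAnalyticAt.const _)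
    have hcont : ContinuousAt (fun k => ∑ i, ∑ j,
        ‖((Φ k)ᴴ * 𝓔 k * Φ k - (E : ℂ) • 1 : Matrix (Fin 2) (Fin 2) ℂ) i j‖) c :=
      tendsto_finsetSum _ fun i _ => tendsto_finsetSum _ fun j _ => (hMa i j).continuousAt.norm
    have hsmall := hcont.eventually_lt_const (u := r) (by beta_reduce; rw [hc]; simpa using hr)
    filter_upwards [hev, hT', hsmall] with k ⟨h1, h2⟩ hk hks
    exact ⟨h1, (rieszProj_eq (hherm k) h1 h2 hr hk hks).symm⟩

/-- Since `(h·σ)² = ‖h‖²`, the bands are `e ± ‖h‖` with projections `½ (1 ± ‖h‖⁻¹ h·σ)`. As `h` has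
order `1` and `‖h‖⁻¹` has order `-1`, the projections have order `0` although they have no limit at
`c`. -/
theorem hasLocalBands_of_mult_eq_two (hA : MatAnalyticAt 𝓔 c) (hherm : ∀ k, (𝓔 k).IsHermitian)
    (hweyl : WeylTypeI 𝓔) (hm : mult (𝓔 c) E = 2) : HasLocalBands 𝓔 c E := by
  obtain ⟨Φ, r, B, hr, hΦ, hc, hev, hT⟩ := exists_local_frame hA hherm hm
  set M : Mom 3 → Matrix (Fin 2) (Fin 2) ℂ := fun k => (Φ k)ᴴ * 𝓔 k * Φ k with hM
  have hMa : MatAnalyticAt M c := (hΦ.conjTranspose.mul hA).mul hΦ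
  have hMh : ∀ k, (M k).IsHermitian := fun k => by
    rw [Matrix.IsHermitian, hM]
    simp only [Matrix.conjTranspose_mul, Matrix.conjTranspose_conjTranspose, (hherm k).eq,
      Matrix.mul_assoc]
  set e : Mom 3 → ℝ := fun k => ((M k 0 0).re + (M k 1 1).re) / 2 with he
  set h : Mom 3 → Mom 3 := fun k => pauliCoeff (M k) with hh
  have hea : AnalyticAt ℝ e c := ((analyticAt_re (hMa 0 0)).add (analyticAt_re (hMa 1 1))).div_const
  have hha : AnalyticAt ℝ h c := analyticAt_pauliCoeff hMa
  have hMc : M c = (E : ℂ) • 1 := hc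
  have h0 : h c = 0 := by
    ext j
    fin_cases j <;> simp [hh, hMc, pauliCoeff]
  have heh : ∀ k, M k = (e k : ℂ) • (1 : Matrix (Fin 2) (Fin 2) ℂ) + ∑ j, (h k j : ℂ) • pauli j :=
    fun k => eq_pauli_sum (hMh k)
  have hmodel := isTwoBandModel_of_frame hherm hr hA hΦ hc hev
    (hT.mono fun k hk w hw => (hk w hw).1) heh
  obtain ⟨hdet, htilt⟩ := hweyl c ⟨E, hm.ge⟩ E hm.ge e h hmodel
  obtain ⟨hinj, κ, hκ, hκv⟩ := abs_fderiv_le_of_gradient_comp_inverse hea hha h0 hdet htilt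
  set s : Fin 2 → ℝ := ![1, -1] with hs
  have hs1 : ∀ j, |s j| = 1 := fun j => by fin_cases j <;> simp [hs]
  have hs2 : ∀ j, s j * s j = 1 := fun j => by fin_cases j <;> simp [hs]
  set K : Mom 3 → Matrix (Fin 2) (Fin 2) ℂ := fun k => ∑ j, (h k j : ℂ) • pauli j with hK
  set π : Fin 2 → Mom 3 → Matrix (Fin 2) (Fin 2) ℂ := fun j k =>
    (2⁻¹ : ℂ) • (1 + ((s j * ‖h k‖⁻¹ : ℝ) : ℂ) • K k) with hπ
  have hinv := isSym_norm_inv hha h0 hinj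
  refine hasLocalBands_of_frame (n := 2) hherm hr hΦ hev hT
    (lam := fun j k => e k + s j * ‖h k‖)
    (fun j => isLocalBand_cone hea hha h0 hinj hκ hκv (hs1 j)) (π := π) (fun j a b => ?_) ?_
  · have h1 : IsSym c 0 fun k => ∑ l, ((s j * ‖h k‖⁻¹ * h k l : ℝ) : ℂ) * pauli l a b :=
      IsSym.sum _ fun l _ => by
        have h2 := ((hinv.const_mul (s j)).mul (isSym_apply_of_eq_zero hha h0 l)).ofReal.mul
          (IsSym.const (pauli l a b))
        norm_num at h2
        simpa using h2
    have h2 : (fun k => π j k a b) = fun k => (2⁻¹ : ℂ) * ((1 : Matrix (Fin 2) (Fin 2) ℂ) a b +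
        ∑ l, ((s j * ‖h k‖⁻¹ * h k l : ℝ) : ℂ) * pauli l a b) := by
      funext k
      simp only [hπ, hK, Matrix.smul_apply, Matrix.add_apply, Matrix.sum_apply, smul_eq_mul,
        Finset.mul_sum]
      push_cast
      simp only [mul_assoc]
    rw [h2]
    exact ((IsSym.const _).add h1).const_mul _
  · filter_upwards [eventually_ne_zero_of_injective hha h0 hinj] with k hk
    have hn : (‖h k‖ : ℂ) ≠ 0 := Complex.ofReal_ne_zero.2 (norm_ne_zero_iff.2 hk)
    have hKK : K k * K k = ((‖h k‖ ^ 2 : ℝ) : ℂ) • 1 := pauli_sum_mul_self (h k)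
    refine ⟨?_, fun j => ?_⟩
    · rw [Fin.sum_univ_two]
      simp only [hπ, hs, Matrix.cons_val_zero, Matrix.cons_val_one]
      push_cast
      module
    · have hs3 : (s j : ℂ) * s j = 1 := by exact_mod_cast hs2 j
      have h1 : ((s j * ‖h k‖⁻¹ : ℝ) : ℂ) * ((‖h k‖ ^ 2 : ℝ) : ℂ) = s j * ‖h k‖ := by
        push_cast
        field_simp
      have h2 : ((s j : ℂ) * ‖h k‖) * ((s j * ‖h k‖⁻¹ : ℝ) : ℂ) = 1 := by
        push_cast
        field_simp
        rw [pow_two, hs3]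
      have h3 : K k * π j k = ((s j : ℂ) * ‖h k‖) • π j k := by
        set a : ℂ := ((s j * ‖h k‖⁻¹ : ℝ) : ℂ)
        set b : ℂ := (s j : ℂ) * ‖h k‖
        calc K k * π j k = (2⁻¹ : ℂ) • (K k + a • (K k * K k)) := by
              simp only [hπ, Matrix.mul_smul, Matrix.mul_add, Matrix.mul_one]
              rfl
          _ = (2⁻¹ : ℂ) • (b • 1 + (b * a) • K k) := by
              rw [hKK, smul_smul a, h1, h2]; module
          _ = b • ((2⁻¹ : ℂ) • (1 + a • K k)) := by module
      have h4 : M k * π j k = (e k : ℂ) • π j k + K k * π j k := by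
        rw [heh k, Matrix.add_mul, Matrix.smul_mul, Matrix.one_mul]
      refine h4.trans ?_
      rw [h3, ← add_smul]
      push_cast
      rfl

/-- Under the hypotheses on the symbol, local bands exist at every point and every energy. -/
theorem hasLocalBands (hA : MatAnalyticAt 𝓔 c) (hherm : ∀ k, (𝓔 k).IsHermitian)
    (hdouble : AtMostDouble 𝓔) (hmorse : BandsMorse 𝓔) (hweyl : WeylTypeI 𝓔) :
    HasLocalBands 𝓔 c E := by
  rcases le_or_gt 2 (mult (𝓔 c) E) with h | h
  · exact hasLocalBands_of_mult_eq_two hA hherm hweyl (le_antisymm (hdouble c ⟨E, h⟩ E) h)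
  · interval_cases hm : mult (𝓔 c) E
    · exact hasLocalBands_of_mult_eq_zero hA hherm hm
    · exact hasLocalBands_of_mult_eq_one hA hherm hmorse hm

end twoBand

end LAP

/-! ### The resolvent bound localised in momentum. -/

namespace LAP

theorem ofReal_norm_sq_le_localDensity {d : ℕ} {β : ℝ} (hβ : 0 < β) {c k : Mom d} (hk : k ≠ c)
    (h1 : ‖k - c‖ ≤ 1) (u : Mom d → ℂ) : ‖u k‖ ^ 2 ≤ localDensity β c u k := by
  have h0 : 0 < ‖k - c‖ := norm_pos_iff.2 (sub_ne_zero.2 hk)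
  have h2 : 1 ≤ ‖k - c‖ ^ (-2 - 2 * β) :=
    Real.one_le_rpow_of_pos_of_le_one_of_nonpos h0 h1 (by linarith)
  calc ‖u k‖ ^ 2 = 1 * ‖u k‖ ^ 2 := (one_mul _).symm
    _ ≤ ‖k - c‖ ^ (-2 - 2 * β) * ‖u k‖ ^ 2 := by gcongr
    _ ≤ _ := le_add_of_nonneg_right (by positivity)

/-- Within distance `1` of `c` the weight `‖k - c‖^{-2-2β}` is at least `1`, so a bounded kernel is
already controlled by the local energies. -/
theorem norm_integral_bounded_le {β : ℝ} (hβ0 : 0 < β) (hβ : β < 1 / 2) {c : Mom 3} {r B : ℝ}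
    (hr : r ≤ 1) (hB : 0 ≤ B) {u v q : Mom 3 → ℂ} (hu : ContDiff ℝ 1 u) (hv : ContDiff ℝ 1 v)
    (hq : ∀ k ≠ c, k ∈ Metric.ball c r → ‖q k‖ ≤ B * (‖u k‖ * ‖v k‖))
    (hq0 : ∀ k ∉ Metric.ball c r, q k = 0) :
    ‖∫ k, q k‖ ≤ B * (localEnergy β c r u + localEnergy β c r v) := by
  have hi : IntegrableOn (fun k => B * (localDensity β c u k + localDensity β c v k))
      (Metric.ball c r) :=
    ((integrableOn_localDensity hβ0 hβ c r hu).add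
      (integrableOn_localDensity hβ0 hβ c r hv)).const_mul B
  have h1 : ∫ k in Metric.ball c r, B * (localDensity β c u k + localDensity β c v k) =
      B * (localEnergy β c r u + localEnergy β c r v) := by
    rw [integral_const_mul, integral_add (integrableOn_localDensity hβ0 hβ c r hu)
      (integrableOn_localDensity hβ0 hβ c r hv)]
    rfl
  rw [← h1, ← integral_indicator measurableSet_ball]
  refine norm_integral_le_of_norm_le (hi.integrable_indicator measurableSet_ball) ?_
  have hc : ∀ᵐ k : Mom 3, k ≠ c := by
    rw [ae_iff]
    simp
  filter_upwards [hc] with k hk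
  by_cases hkb : k ∈ Metric.ball c r
  · rw [indicator_of_mem hkb]
    refine (hq k hk hkb).trans (mul_le_mul_of_nonneg_left ?_ hB)
    have h2 : ‖k - c‖ ≤ 1 := by
      rw [Metric.mem_ball, dist_eq_norm] at hkb
      linarith
    have h3 := ofReal_norm_sq_le_localDensity hβ0 hk h2 u
    have h4 := ofReal_norm_sq_le_localDensity hβ0 hk h2 v
    nlinarith [sq_nonneg (‖u k‖ - ‖v k‖), norm_nonneg (u k), norm_nonneg (v k)]
  · rw [indicator_of_notMem hkb, hq0 k hkb, norm_zero]

/-- The bound for the square of the resolvent, localized near a point of momentum space. -/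
theorem HasLocalBands.resolvent_bound {L : ℕ} {A : Mom 3 → Matrix (Fin L) (Fin L) ℂ}
    (hA : Continuous A) (hherm : ∀ k, (A k).IsHermitian) {c : Mom 3} {E : ℝ}
    (hb : HasLocalBands A c E) {β : ℝ} (hβ0 : 0 < β) (hβ : β < 1 / 2) :
    ∃ R > 0, ∃ δ > 0, ∀ r, 0 < r → r ≤ R → ∀ g : Mom 3 → ℝ, ContDiff ℝ 1 g →
      tsupport g ⊆ Metric.ball c (r / 2) → ∃ C, 0 ≤ C ∧ ∀ z : ℂ, z.im ≠ 0 → |z.im| ≤ 1 →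
        ‖z - E‖ ≤ δ → ∀ u v : Fin L → Mom 3 → ℂ, (∀ a, ContDiff ℝ 1 (u a)) →
        (∀ a, ContDiff ℝ 1 (v a)) →
        ‖∫ k, (g k : ℂ) * ∑ a, ∑ b, u a k * ((A k - z • 1)⁻¹ * (A k - z • 1)⁻¹) a b * v b k‖ ≤
          C * |z.im| ^ (β - 1) *
            (∑ a, localEnergy β c r (u a) + ∑ a, localEnergy β c r (v a)) := by
  obtain ⟨n, lam, p, δ, B, hδ, hlam, hp, hev⟩ := hb
  choose R₁ hR₁ hband using fun j a b => band_estimate (hlam j) (hp j a b) hβ0 hβ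
  obtain ⟨R₂, hR₂, hall⟩ := eventually_nhdsNE_ball hev
  have hmin : ∀ᶠ R in 𝓝[>] (0 : ℝ), 0 < R ∧ R ≤ 1 ∧ R ≤ R₂ ∧ ∀ j a b, R ≤ R₁ j a b := by
    have hle : ∀ x : ℝ, 0 < x → ∀ᶠ R in 𝓝[>] (0 : ℝ), R ≤ x := fun x hx =>
      mem_nhdsWithin_of_mem_nhds (Iic_mem_nhds hx)
    exact eventually_mem_nhdsWithin.and ((hle 1 one_pos).and ((hle R₂ hR₂).and
      (eventually_all.2 fun j => eventually_all.2 fun a => eventually_all.2 fun b =>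
        hle _ (hR₁ j a b))))
  obtain ⟨R, hR0, hR1, hRR₂, hRR₁⟩ := hmin.exists
  refine ⟨R, hR0, δ, hδ, fun r hr hrR g hg hgs => ?_⟩
  choose C₁ hC₁0 hC₁ using fun j a b =>
    hband j a b r hr (hrR.trans (hRR₁ j a b)) g hg hgs
  have hgc : HasCompactSupport g := HasCompactSupport.of_support_subset_isCompact
    (isCompact_closedBall c (r / 2))
    ((subset_tsupport g).trans (hgs.trans Metric.ball_subset_closedBall))
  obtain ⟨Kg, hKg0, hKg⟩ := exists_bound_fderiv hg hgc
  set B' := max B 0 with hB'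
  have hB'0 : 0 ≤ B' := le_max_right _ _
  set C := ∑ a, ∑ b, ((∑ j, C₁ j a b) + Kg * B') with hC
  have hCab : ∀ a b, 0 ≤ (∑ j, C₁ j a b) + Kg * B' := fun a b =>
    add_nonneg (Finset.sum_nonneg fun j _ => hC₁0 j a b) (by positivity)
  refine ⟨C, Finset.sum_nonneg fun a _ => Finset.sum_nonneg fun b _ => hCab a b,
    fun z hz hz1 hzE u v hu hv => ?_⟩
  set Q : Mom 3 → Matrix (Fin L) (Fin L) ℂ := fun k => (A k - z • 1)⁻¹ * (A k - z • 1)⁻¹ with hQ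
  have hQc : Continuous Q := by
    have h1 := continuous_matrix_inv (hA.sub continuous_const)
      (fun k => det_sub_smul_one_ne_zero (hherm k) hz)
    exact h1.mul h1
  have hgC : Continuous fun k => (g k : ℂ) := Complex.continuous_ofReal.comp hg.continuous
  have hint : ∀ a b, Integrable fun k => (g k : ℂ) * (u a k * Q k a b * v b k) := fun a b =>
    (hgC.mul (((hu a).continuous.mul (hQc.matrix_elem a b)).mul
      (hv b).continuous)).integrable_of_hasCompactSupport
      ((hgc.comp_left (g := ((↑) : ℝ → ℂ)) Complex.ofReal_zero).mul_right)
  set y := |z.im| ^ (β - 1) with hy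
  -- The remainder is bounded uniformly in `z`; `y ≥ 1` absorbs it into the singular bound.
  have hy1 : 1 ≤ y := Real.one_le_rpow_of_pos_of_le_one_of_nonpos (abs_pos.2 hz) hz1 (by linarith)
  have hpair : ∀ a b, ‖∫ k, (g k : ℂ) * (u a k * Q k a b * v b k)‖ ≤
      ((∑ j, C₁ j a b) + Kg * B') * y * (localEnergy β c r (u a) + localEnergy β c r (v b)) :=
    fun a b => by
      set S := localEnergy β c r (u a) + localEnergy β c r (v b) with hS
      have hS0 : 0 ≤ S := add_nonneg (localEnergy_nonneg _ _ _ _) (localEnergy_nonneg _ _ _ _)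
      set F : Fin n → Mom 3 → ℂ := fun j k =>
        (g k : ℂ) * p j k a b * (u a k * v b k) * (((lam j k : ℂ) - z)⁻¹) ^ 2 with hF
      have hFi : ∀ j, Integrable (F j) := fun j => (hC₁ j a b z hz (u a) (v b) (hu a) (hv b)).1
      have hFb : ∀ j, ‖∫ k, F j k‖ ≤ C₁ j a b * y * S := fun j =>
        (hC₁ j a b z hz (u a) (v b) (hu a) (hv b)).2
      set q : Mom 3 → ℂ := fun k => (g k : ℂ) * (u a k * Q k a b * v b k) - ∑ j, F j k with hq
      have hqeq : ∀ k, q k = (g k : ℂ) * (u a k * v b k) *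
          (Q k a b - ∑ j, p j k a b * (((lam j k : ℂ) - z)⁻¹) ^ 2) := fun k => by
        simp only [hq, hF, mul_sub, Finset.mul_sum]
        congr 1
        · ring
        · exact Finset.sum_congr rfl fun j _ => by ring
      have hsplit : ∫ k, (g k : ℂ) * (u a k * Q k a b * v b k) = (∑ j, ∫ k, F j k) + ∫ k, q k := by
        rw [hq, integral_sub (hint a b) (integrable_finsetSum _ fun j _ => hFi j),
          integral_finsetSum _ fun j _ => hFi j]
        ring
      have hqb : ‖∫ k, q k‖ ≤ Kg * B' * S := by
        refine norm_integral_bounded_le hβ0 hβ (hrR.trans hR1) (by positivity) (hu a) (hv b)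
          (fun k hk hkb => ?_) fun k hk => ?_
        · rw [Metric.mem_ball, dist_eq_norm] at hkb
          have h1 := hall k (norm_pos_iff.2 (sub_ne_zero.2 hk)) (hkb.trans_le (hrR.trans hRR₂))
            z hz hzE a b
          rw [hqeq, norm_mul, norm_mul, norm_mul, Complex.norm_real]
          calc ‖g k‖ * (‖u a k‖ * ‖v b k‖) * _ ≤ Kg * (‖u a k‖ * ‖v b k‖) * B' := by
                gcongr
                · exact (hKg k).1
                · exact h1.trans (le_max_left _ _)
            _ = _ := by ring
        · have h1 : g k = 0 := by
            by_contra h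
            exact hk (Metric.ball_subset_ball (by linarith) (hgs (subset_tsupport g h)))
          rw [hqeq, h1]
          simp
      rw [hsplit]
      calc _ ≤ ∑ j, C₁ j a b * y * S + Kg * B' * S := by
            refine (norm_add_le _ _).trans (add_le_add ?_ hqb)
            exact (norm_sum_le _ _).trans (Finset.sum_le_sum fun j _ => hFb j)
        _ ≤ ∑ j, C₁ j a b * y * S + Kg * B' * y * S := by
            exact add_le_add le_rfl (mul_le_mul_of_nonneg_right
              (le_mul_of_one_le_right (by positivity) hy1) hS0)
        _ = _ := by rw [← Finset.sum_mul, ← Finset.sum_mul]; ring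
  have hsum : ∫ k, (g k : ℂ) * ∑ a, ∑ b, u a k * Q k a b * v b k =
      ∑ a, ∑ b, ∫ k, (g k : ℂ) * (u a k * Q k a b * v b k) := by
    simp only [Finset.mul_sum]
    rw [integral_finsetSum _ fun a _ => integrable_finsetSum _ fun b _ => hint a b]
    exact Finset.sum_congr rfl fun a _ => integral_finsetSum _ fun b _ => hint a b
  change ‖∫ k, (g k : ℂ) * ∑ a, ∑ b, u a k * Q k a b * v b k‖ ≤ _
  rw [hsum]
  set S := ∑ a, localEnergy β c r (u a) + ∑ a, localEnergy β c r (v a) with hS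
  have hle : ∀ a b, localEnergy β c r (u a) + localEnergy β c r (v b) ≤ S := fun a b =>
    add_le_add
      (Finset.single_le_sum (f := fun a => localEnergy β c r (u a))
        (fun a _ => localEnergy_nonneg _ _ _ _) (Finset.mem_univ a))
      (Finset.single_le_sum (f := fun a => localEnergy β c r (v a))
        (fun a _ => localEnergy_nonneg _ _ _ _) (Finset.mem_univ b))
  calc _ ≤ ∑ a, ∑ b, ((∑ j, C₁ j a b) + Kg * B') * y * S := by
        refine (norm_sum_le _ _).trans (Finset.sum_le_sum fun a _ =>
          (norm_sum_le _ _).trans (Finset.sum_le_sum fun b _ => (hpair a b).trans ?_))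
        exact mul_le_mul_of_nonneg_left (hle a b)
          (mul_nonneg (hCab a b) (zero_le_one.trans hy1))
    _ = _ := by simp only [hC, Finset.sum_mul]

end LAP

/-! ### Compactness in momentum and energy. -/

namespace LAP

/-- A partition of unity over the compact support of `unfoldMom`, multiplied by `unfoldMom`. Only
finitely many local estimates are then needed. -/
theorem exists_decomposition_unfoldMom {d : ℕ} {ρ : Mom d → ℝ} (hρ : ∀ c, 0 < ρ c) :
    ∃ (t : Finset (Mom d)) (g : t → Mom d → ℝ), (∀ i, ContDiff ℝ 1 (g i)) ∧
      (∀ i, tsupport (g i) ⊆ Metric.ball i (ρ i)) ∧ ∀ k, unfoldMom k = ∑ i, g i k := by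
  have hK : IsCompact (tsupport (unfoldMom (d := d))) := hasCompactSupport_unfoldMom
  obtain ⟨t, -, ht⟩ := hK.elim_nhds_subcover (fun c => Metric.ball c (ρ c))
    fun c _ => Metric.ball_mem_nhds c (hρ c)
  obtain ⟨f, hf⟩ := SmoothPartitionOfUnity.exists_isSubordinate (modelWithCornersSelf ℝ (Mom d))
    (isClosed_tsupport (unfoldMom (d := d))) (fun i : t => Metric.ball (i : Mom d) (ρ i))
    (fun _ => Metric.isOpen_ball) (by rwa [iUnion_subtype (p := (· ∈ t))
      (s := fun i => Metric.ball (i : Mom d) (ρ i))])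
  refine ⟨t, fun i k => f i k * unfoldMom k, fun i => ?_, fun i => ?_, fun k => ?_⟩
  · exact ((f i).contMDiff.contDiff.of_le (by simp)).mul (contDiff_unfoldMom (m := 1))
  · exact (tsupport_mul_subset_left (f := f i) (g := unfoldMom)).trans (hf i)
  · rw [← Finset.sum_mul]
    by_cases hk : unfoldMom k = 0
    · rw [hk, mul_zero]
    · have h1 := f.sum_eq_one (subset_tsupport _ hk)
      rw [finsum_eq_sum_of_fintype] at h1
      rw [h1, one_mul]

theorem bracket_neg {d : ℕ} (n : Fin d → ℤ) : bracket (-n) = bracket n := by simp [bracket]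

/-- The local bounds are bilinear in `u` and `v`, whereas matrix elements are sesquilinear.
Conjugation only reflects the frequencies and leaves the weights `bracket n` unchanged. -/
theorem conj_trigPoly {d : ℕ} (s : Finset (Fin d → ℤ)) (a : (Fin d → ℤ) → ℂ) (k : Mom d) :
    conj (trigPoly s a k) =
      trigPoly (s.map (Equiv.neg (Fin d → ℤ)).toEmbedding) (fun n => conj (a (-n))) k := by
  simp [trigPoly, conj_planeWave]

theorem damping_finState {d L : ℕ} {α : ℝ} (hα : 0 ≤ α) (s : Finset (Fin d → ℤ))
    (a : (Fin d → ℤ) → EuclideanSpace ℂ (Fin L)) :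
    damping d L α hα (finState s a) = finState s fun n => ((bracket n ^ (-α) : ℝ) : ℂ) • a n := by
  ext1
  funext n
  rw [damping_apply, finState_apply, finState_apply]
  split_ifs <;> simp

theorem inner_finState_damping {d L : ℕ} {α : ℝ} (hα : 0 ≤ α) (s : Finset (Fin d → ℤ))
    (a : (Fin d → ℤ) → EuclideanSpace ℂ (Fin L)) (x : LatticeHilbert d L) :
    ⟪finState s a, damping d L α hα x⟫_ℂ = ⟪damping d L α hα (finState s a), x⟫_ℂ := by
  rw [damping_finState, inner_finState_left, inner_finState_left]
  refine Finset.sum_congr rfl fun n _ => ?_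
  rw [damping_apply, inner_smul_left, inner_smul_right, Complex.conj_ofReal]

theorem inner_toEuclideanLin_eq_sum {L : ℕ} (A : Matrix (Fin L) (Fin L) ℂ)
    (v w : EuclideanSpace ℂ (Fin L)) :
    ⟪v, Matrix.toEuclideanLin A w⟫_ℂ = ∑ a, ∑ b, conj (v a) * A a b * w b := by
  rw [PiLp.inner_apply]
  refine Finset.sum_congr rfl fun a _ => ?_
  rw [Matrix.toLpLin_apply, RCLike.inner_apply, mul_comm]
  simp only [Matrix.mulVec, dotProduct, Finset.mul_sum, mul_assoc]

theorem sum_bracket_mul_norm_sq_le {d L : ℕ} {α : ℝ} (s : Finset (Fin d → ℤ))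
    (a : (Fin d → ℤ) → EuclideanSpace ℂ (Fin L)) :
    ∑ i, ∑ n ∈ s, bracket n ^ (2 * α) * ‖(((bracket n ^ (-α) : ℝ) : ℂ) • a n) i‖ ^ 2 =
      ‖finState s a‖ ^ 2 := by
  rw [norm_finState_sq, Finset.sum_comm]
  refine Finset.sum_congr rfl fun n _ => ?_
  rw [EuclideanSpace.norm_sq_eq]
  refine Finset.sum_congr rfl fun i _ => ?_
  have h0 : 0 < bracket n := zero_lt_one.trans_le (one_le_bracket n)
  rw [PiLp.smul_apply, norm_smul, Complex.norm_real, Real.norm_of_nonneg (Real.rpow_nonneg h0.le _),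
    mul_pow, ← Real.rpow_natCast (bracket n ^ (-α)), ← Real.rpow_mul h0.le, ← mul_assoc,
    ← Real.rpow_add h0]
  simp [mul_comm]

/-- The weighted bound for the square of the resolvent near a fixed energy. -/
theorem exists_bound_near_energy {L : ℕ} {H : BoundedOp 3 L} (hsa : IsSelfAdjoint H)
    {𝓔 : Mom 3 → Matrix (Fin L) (Fin L) ℂ} (hsymb : IsAnalyticSymbol H 𝓔) {E : ℝ}
    (hbands : ∀ c, HasLocalBands 𝓔 c E) {α β : ℝ} (hα : 0 ≤ α) (hβ0 : 0 < β) (hβ : β < 1 / 2)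
    (hαβ : 1 + β < α) :
    ∃ δ > 0, ∃ C, 0 ≤ C ∧ ∀ z : ℂ, z.im ≠ 0 → |z.im| ≤ 1 → ‖z - E‖ ≤ δ →
      ‖damping 3 L α hα * (Ring.inverse (H - algebraMap ℂ (BoundedOp 3 L) z) *
        Ring.inverse (H - algebraMap ℂ (BoundedOp 3 L) z)) * damping 3 L α hα‖ ≤
          C * |z.im| ^ (β - 1) := by
  have hcont := hsymb.continuous
  choose R hR δ hδ hloc using fun c => (hbands c).resolvent_bound hcont hsymb.isHermitian hβ0 hβ
  -- Radii up to `π` keep the ball inside one translated cell, as Hardy's inequality demands; the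
  -- partition is subordinate to half of this radius, as the local estimate demands.
  set r : Mom 3 → ℝ := fun c => min (R c) Real.pi with hr
  have hr0 : ∀ c, 0 < r c := fun c => lt_min (hR c) Real.pi_pos
  obtain ⟨t, g, hg, hgs, hgsum⟩ := exists_decomposition_unfoldMom fun c => half_pos (hr0 c)
  choose C₁ hC₁0 hC₁ using fun i : t => hloc i (r i) (hr0 i) (min_le_left _ _) (g i) (hg i) (hgs i)
  have hmin : ∀ᶠ x in 𝓝[>] (0 : ℝ), 0 < x ∧ ∀ i : t, x ≤ δ i :=
    eventually_mem_nhdsWithin.and (eventually_all.2 fun i =>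
      mem_nhdsWithin_of_mem_nhds (Iic_mem_nhds (hδ i)))
  obtain ⟨δ₀, hδ₀, hδ₀i⟩ := hmin.exists
  obtain ⟨C₂, hC₂0, hC₂⟩ := localEnergy_trigPoly_le hβ0 hβ hαβ
  set γ : ℝ := (2 * Real.pi) ^ (-((3 : ℕ) : ℝ) / 2) with hγ
  refine ⟨δ₀, hδ₀, γ ^ 2 * ((∑ i, C₁ i) * (C₂ + C₂)), by
    have := Finset.sum_nonneg fun i (_ : i ∈ Finset.univ) => hC₁0 i
    positivity, fun z hz hz1 hzE => ?_⟩
  set Rz := Ring.inverse (H - algebraMap ℂ (BoundedOp 3 L) z) with hRz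
  have hinv : (H - algebraMap ℂ (BoundedOp 3 L) z) * Rz = 1 :=
    Ring.mul_inverse_cancel _ (isUnit_sub_algebraMap hsa hz)
  set Q : Mom 3 → Matrix (Fin L) (Fin L) ℂ := fun k => (𝓔 k - z • 1)⁻¹ * (𝓔 k - z • 1)⁻¹ with hQ
  have hsym : HasSymbol (Rz * Rz) Q := hsymb.hasSymbol_resolvent_sq hz hinv
  have hQc : Continuous Q := by
    have h1 := continuous_matrix_inv (hcont.sub continuous_const)
      (fun k => det_sub_smul_one_ne_zero (hsymb.isHermitian k) hz)
    exact h1.mul h1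
  have hQper : RecipPeriodic Q := fun k n => by simp only [hQ, hsymb.periodic]
  set y := |z.im| ^ (β - 1) with hy
  have hy0 : 0 ≤ y := Real.rpow_nonneg (abs_nonneg _) _
  refine opNorm_le_of_forall_finState (by
    have := Finset.sum_nonneg fun i (_ : i ∈ Finset.univ) => hC₁0 i
    positivity) fun s a s' b ha hb => ?_
  rw [mul_apply_eq_comp, mul_apply_eq_comp, inner_finState_damping, damping_finState,
    damping_finState]
  set a' : (Fin 3 → ℤ) → EuclideanSpace ℂ (Fin L) :=
    fun n => ((bracket n ^ (-α) : ℝ) : ℂ) • a n with ha'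
  set b' : (Fin 3 → ℤ) → EuclideanSpace ℂ (Fin L) :=
    fun n => ((bracket n ^ (-α) : ℝ) : ℂ) • b n with hb'
  rw [hsym]
  set u : Fin L → Mom 3 → ℂ := fun i => trigPoly (s.map (Equiv.neg (Fin 3 → ℤ)).toEmbedding)
    (fun n => conj (a' (-n) i)) with hu
  set v : Fin L → Mom 3 → ℂ := fun i => trigPoly s' fun n => b' n i with hv
  have huc : ∀ i, ContDiff ℝ 1 (u i) := fun i => contDiff_trigPoly _ _
  have hvc : ∀ i, ContDiff ℝ 1 (v i) := fun i => contDiff_trigPoly _ _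
  set f : Mom 3 → ℂ := fun k => ∑ i, ∑ j, u i k * Q k i j * v j k with hf
  have hfc : Continuous f := continuous_finsetSum _ fun i _ => continuous_finsetSum _ fun j _ =>
    ((huc i).continuous.mul (hQc.matrix_elem i j)).mul (hvc j).continuous
  have hfper : RecipPeriodic f := fun k n => by
    simp only [hf, hu, hv, recipPeriodic_trigPoly _ _ k n, hQper k n]
  have hintegrand : ∀ k, ⟪latticeFourier (finState s a') k,
      Matrix.toEuclideanLin (Q k) (latticeFourier (finState s' b') k)⟫_ℂ = (γ : ℂ) ^ 2 * f k :=
    fun k => by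
      rw [inner_toEuclideanLin_eq_sum, hf, Finset.mul_sum]
      refine Finset.sum_congr rfl fun i _ => ?_
      rw [Finset.mul_sum]
      refine Finset.sum_congr rfl fun j _ => ?_
      rw [latticeFourier_finState, latticeFourier_finState, map_mul, Complex.conj_ofReal,
        conj_trigPoly]
      ring
  simp only [hintegrand]
  rw [integral_const_mul, ← integral_unfoldMom_mul hfc hfper, norm_mul, norm_pow, Complex.norm_real,
    Real.norm_eq_abs, sq_abs]
  have hint : ∀ i, Integrable fun k => (g i k : ℂ) * f k := fun i => by
    have hgc : HasCompactSupport (g i) := HasCompactSupport.of_support_subset_isCompact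
      (isCompact_closedBall (i : Mom 3) (r i / 2))
      ((subset_tsupport _).trans ((hgs i).trans Metric.ball_subset_closedBall))
    exact ((Complex.continuous_ofReal.comp (hg i).continuous).mul
      hfc).integrable_of_hasCompactSupport
      ((hgc.comp_left (g := ((↑) : ℝ → ℂ)) Complex.ofReal_zero).mul_right)
  have hsplit : ∫ k, (unfoldMom k : ℂ) * f k = ∑ i, ∫ k, (g i k : ℂ) * f k := by
    rw [← integral_finsetSum _ fun i _ => hint i]
    congr 1
    funext k
    rw [hgsum, Complex.ofReal_sum, Finset.sum_mul]
  have henergy_u : ∀ c, ∑ i, localEnergy β c (r c) (u i) ≤ C₂ := fun c => by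
    calc _ ≤ ∑ i, C₂ * ∑ n ∈ s, bracket n ^ (2 * α) * ‖a' n i‖ ^ 2 :=
          Finset.sum_le_sum fun i _ => by
            refine (hC₂ c (r c) (min_le_right _ _) _ _).trans (le_of_eq ?_)
            simp [bracket_neg]
      _ = C₂ * ‖finState s a‖ ^ 2 := by rw [← Finset.mul_sum, sum_bracket_mul_norm_sq_le]
      _ ≤ C₂ := mul_le_of_le_one_right hC₂0 (pow_le_one₀ (norm_nonneg _) ha)
  have henergy_v : ∀ c, ∑ i, localEnergy β c (r c) (v i) ≤ C₂ := fun c => by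
    calc _ ≤ ∑ i, C₂ * ∑ n ∈ s', bracket n ^ (2 * α) * ‖b' n i‖ ^ 2 :=
          Finset.sum_le_sum fun i _ => hC₂ c (r c) (min_le_right _ _) _ _
      _ = C₂ * ‖finState s' b‖ ^ 2 := by rw [← Finset.mul_sum, sum_bracket_mul_norm_sq_le]
      _ ≤ C₂ := mul_le_of_le_one_right hC₂0 (pow_le_one₀ (norm_nonneg _) hb)
  rw [hsplit, mul_assoc]
  refine mul_le_mul_of_nonneg_left ?_ (sq_nonneg γ)
  calc _ ≤ ∑ i, C₁ i * y * (C₂ + C₂) := by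
        refine (norm_sum_le _ _).trans (Finset.sum_le_sum fun i _ => ?_)
        refine (hC₁ i z hz hz1 (hzE.trans (hδ₀i i)) u v huc hvc).trans ?_
        exact mul_le_mul_of_nonneg_left (add_le_add (henergy_u i) (henergy_v i))
          (mul_nonneg (hC₁0 i) hy0)
    _ = _ := by rw [← Finset.sum_mul, ← Finset.sum_mul]; ring

/-- The weighted bound for the square of the resolvent, uniformly in the energy. -/
theorem exists_uniform_bound {L : ℕ} {H : BoundedOp 3 L} (hsa : IsSelfAdjoint H) {α β : ℝ}
    (hα : 0 ≤ α) (hβ1 : β ≤ 1)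
    (hloc : ∀ E : ℝ, ∃ δ > 0, ∃ C, 0 ≤ C ∧ ∀ z : ℂ, z.im ≠ 0 → |z.im| ≤ 1 → ‖z - E‖ ≤ δ →
      ‖damping 3 L α hα * (Ring.inverse (H - algebraMap ℂ (BoundedOp 3 L) z) *
        Ring.inverse (H - algebraMap ℂ (BoundedOp 3 L) z)) * damping 3 L α hα‖ ≤
          C * |z.im| ^ (β - 1)) :
    ∃ C, 0 ≤ C ∧ ∀ z : ℂ, z.im ≠ 0 → |z.im| ≤ 1 → ‖damping 3 L α hα *
      (Ring.inverse (H - algebraMap ℂ (BoundedOp 3 L) z) *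
        Ring.inverse (H - algebraMap ℂ (BoundedOp 3 L) z)) * damping 3 L α hα‖ ≤
          C * |z.im| ^ (β - 1) := by
  choose δ hδ C hC0 hC using hloc
  obtain ⟨t, -, ht⟩ := (isCompact_Icc (a := -(‖H‖ + 1)) (b := ‖H‖ + 1)).elim_nhds_subcover
    (fun E => Metric.ball E (δ E / 2)) fun E _ => Metric.ball_mem_nhds E (half_pos (hδ E))
  have hmin : ∀ᶠ x in 𝓝[>] (0 : ℝ), 0 < x ∧ ∀ i : t, x ≤ δ i / 2 :=
    eventually_mem_nhdsWithin.and (eventually_all.2 fun i =>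
      mem_nhdsWithin_of_mem_nhds (Iic_mem_nhds (half_pos (hδ i))))
  obtain ⟨η, hη, hηi⟩ := hmin.exists
  have hsum0 : 0 ≤ ∑ E ∈ t, C E := Finset.sum_nonneg fun E _ => hC0 E
  refine ⟨∑ E ∈ t, C E + η⁻¹ ^ 2 + 1, by positivity, fun z hz hz1 => ?_⟩
  have hy1 : 1 ≤ |z.im| ^ (β - 1) :=
    Real.one_le_rpow_of_pos_of_le_one_of_nonpos (abs_pos.2 hz) hz1 (by linarith)
  have hu := isUnit_sub_algebraMap hsa hz
  have htriv : ∀ {x : ℝ}, 0 ≤ x → ‖Ring.inverse (H - algebraMap ℂ (BoundedOp 3 L) z)‖ ≤ x →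
      ‖damping 3 L α hα * (Ring.inverse (H - algebraMap ℂ (BoundedOp 3 L) z) *
        Ring.inverse (H - algebraMap ℂ (BoundedOp 3 L) z)) * damping 3 L α hα‖ ≤ x ^ 2 :=
    fun {x} hx h => by
      refine (norm_damping_mul_mul_le hα _).trans ((norm_mul_le _ _).trans ?_)
      rw [pow_two]
      exact mul_le_mul h h (norm_nonneg _) hx
  -- Three regions: `|Im z| > η` and `|Re z| > ‖H‖ + 1` are covered by elementary resolvent bounds.
  -- In the remaining rectangle `z` lies within `δ E / 2 + η ≤ δ E` of some point `E` of the finite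
  -- cover.
  rcases lt_or_ge η |z.im| with h1 | h1
  · have h2 := norm_ringInverse_le hu (hη.trans h1) (abs_im_mul_norm_le hsa z)
    refine (htriv (by positivity) (h2.trans (inv_anti₀ hη h1.le))).trans ?_
    calc η⁻¹ ^ 2 ≤ (∑ E ∈ t, C E + η⁻¹ ^ 2 + 1) * 1 := by linarith
      _ ≤ _ := mul_le_mul_of_nonneg_left hy1 (by positivity)
  rcases lt_or_ge (‖H‖ + 1) |z.re| with h2 | h2
  · have h3 := norm_ringInverse_le hu one_pos fun x => by
      refine (mul_le_mul_of_nonneg_right ?_ (norm_nonneg x)).trans (abs_re_sub_mul_norm_le z x)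
      linarith
    rw [inv_one] at h3
    refine (htriv zero_le_one h3).trans ?_
    calc (1 : ℝ) ^ 2 ≤ (∑ E ∈ t, C E + η⁻¹ ^ 2 + 1) * 1 := by nlinarith [sq_nonneg η⁻¹]
      _ ≤ _ := mul_le_mul_of_nonneg_left hy1 (by positivity)
  obtain ⟨E, hE, hzE⟩ := mem_iUnion₂.1 (ht (abs_le.1 h2))
  rw [Metric.mem_ball, Real.dist_eq] at hzE
  have h3 : ‖z - E‖ ≤ δ E := by
    refine (Complex.norm_le_abs_re_add_abs_im _).trans ?_
    rw [Complex.sub_re, Complex.sub_im, Complex.ofReal_re, Complex.ofReal_im, sub_zero]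
    have := hηi ⟨E, hE⟩
    simp only at this
    linarith
  refine (hC E z hz hz1 h3).trans (mul_le_mul_of_nonneg_right ?_ (zero_le_one.trans hy1))
  have h4 : C E ≤ ∑ E ∈ t, C E := Finset.single_le_sum (fun E _ => hC0 E) hE
  have : 0 ≤ η⁻¹ ^ 2 := sq_nonneg _
  linarith

end LAP

/-! ### The limiting absorption principle. -/

theorem mainTheorem1 {L : ℕ} (H : LAP.BoundedOp 3 L)
    (hsa : IsSelfAdjoint H) (htrans : LAP.TranslationInvariant H)
    (𝓔 : LAP.Mom 3 → Matrix (Fin L) (Fin L) ℂ) (hsymb : LAP.IsAnalyticSymbol H 𝓔)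
    (hdiscrete : IsDiscrete (LAP.weylSet 𝓔))
    (hdouble : LAP.AtMostDouble 𝓔)
    (hmorse : LAP.BandsMorse 𝓔)
    (hweyl : LAP.WeylTypeI 𝓔)
    (α : ℝ) (hα : 5 / 4 < α) :
    ∃ Rplus Rminus : ℝ → LAP.BoundedOp 3 L,
      (∀ E : ℝ,
        Tendsto (fun ε : ℝ => LAP.dampedResolvent H α (by linarith) (E + Complex.I * ε))
          (𝓝[>] 0) (𝓝 (Rplus E)) ∧
        Tendsto (fun ε : ℝ => LAP.dampedResolvent H α (by linarith) (E - Complex.I * ε))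
          (𝓝[>] 0) (𝓝 (Rminus E))) ∧
      ∀ β : ℝ, 0 < β → β < 1 → β < min (2 * α - 5 / 2) (min (1 / 2) (α - 1)) →
        ∃ C : ℝ, ∀ E E' : ℝ,
          ‖Rplus E - Rplus E'‖ ≤ C * |E - E'| ^ β ∧
          ‖Rminus E - Rminus E'‖ ≤ C * |E - E'| ^ β := by
  have hα0 : 0 ≤ α := by linarith
  -- The admissible exponents are those of the derivative bound. The value `1/4` belongs to them
  -- precisely because `5/4 < α`, so the limits exist for every such `α`.
  obtain ⟨Rplus, Rminus, h1, h2⟩ := LAP.boundary_values (d := 3) hsa hα0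
    (S := {β | 0 < β ∧ β < 1 / 2 ∧ 1 + β < α}) ⟨1 / 4, by norm_num, by norm_num, by linarith⟩
    (fun β hβ => hβ.1) fun β ⟨hβ0, hβ, hαβ⟩ =>
      LAP.exists_uniform_bound hsa hα0 (by linarith) fun E =>
        LAP.exists_bound_near_energy hsa hsymb
          (fun c => LAP.hasLocalBands (fun i j => hsymb.analytic i j c (mem_univ c))
            hsymb.isHermitian hdouble hmorse hweyl) hα0 hβ0 hβ hαβ
  refine ⟨Rplus, Rminus, h1, fun β hβ0 _ hβ => h2 β ⟨hβ0, ?_, ?_⟩⟩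
  · exact hβ.trans_le ((min_le_right _ _).trans (min_le_left _ _))
  · have := hβ.trans_le ((min_le_right _ _).trans (min_le_right _ _))
    linarith
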